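/- **Setting.** Let $l,L>0$ and $\Omega:=(-l,l)\times(-L,\infty)\subset\mathbb R^2$. A set $K\subset\mathbb R^2$ is called $\mathcal H^1$-rectifiable if $\mathcal H^1(K)<\infty$ and $\lim_{r\to0^+}\mathcal H^1(K\cap B_r(x))/(2r)=1$ for $\mathcal H^1$-a.e. $x\in K$. An admissible pair $(h,K)\in \mathrm{AHK}(\Omega)$ consists of an upper semicontinuous function $h:[-l,l]\to[0,L]$ of finite pointwise variation and a closed $\mathcal H^1$-rectifiable set $K\subset\overline\Omega$ with $K\subset\overline{\mathrm{Int}(S_h)}$, where $S_h:=\{(x,y): -l\le x\le l,\ y\le h(x)\}$. Put $S_{h,K}:=(S_h\setminus K)\cap\overline\Omega$. $\mathcal B^1$ is the set of all pairs $(S_{h^1,K^1},S_{h^0,K^0})$ (film composite, substrate) with $(h^i,K^i)\in\mathrm{AHK}(\Omega)$ for $i=0,1$, $h^0\le h^1$ on $[-l,l]$ and $\partial S_{h^1,K^1}\cap\mathrm{Int}(S_{h^0,K^0})=\emptyset$. For $\mathbf m=(m_1,m_0)\in\mathbb N^2$, $\mathcal B^1_{\mathbf m}$ is the set of those pairs in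 $\mathcal B^1$ for which $\partial S_{h^i,K^i}$ has at most $m_i$ connected components for $i=0,1$. The signed distance is $\mathrm{sdist}(x,\partial E):=\mathrm{dist}(x,E)$ if $x\notin E$ and $-\mathrm{dist}(x,\mathbb R^2\setminus E)$ if $x\in E$. A sequence $(S^1_k,S^0_k)\in\mathcal B^1$ $\tau_{\mathcal B^1}$-converges to $(S^1,S^0)\in\mathcal B^1$ if, for $i=0,1$, $\sup_k\mathcal H^1(\partial S^i_k)<\infty$ and $\mathrm{sdist}(\cdot,\partial S^i_k)\to\mathrm{sdist}(\cdot,\partial S^i)$ locally uniformly in $\mathbb R^2$. **Surface energy.** Let $\varphi_0,\varphi_1,\varphi_{01}:\overline\Omega\times\mathbb R^2\to\mathbb R$, $\varphi^1:=\min\{\varphi_0,\varphi_1+\varphi_{01}\}$ and $\varphi^2:=\min\{\varphi_1,\varphi_0\}$. Assume that $\varphi_1,\varphi_{01},\varphi^1,\varphi^2$ are Finsler norms (continuous on $\overline\Omega\times\mathbb R^2$ and a norm in the second variable), that there are $c_2\ge c_1>0$ with $c_1|\xi|\le\varphi_1(x,\xi),\varphi^1(x,\xi),\varphi_{01}(x,\xi)\le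 c_2|\xi|$, and that $\varphi^1(x,\xi)\ge|\varphi_{01}(x,\xi)-\varphi_1(x,\xi)|$, for all $x\in\overline\Omega$, $\xi\in\mathbb R^2$. For $(S_1,S_0)\in\mathcal B^1$ let $$\mathcal S^1(S_1,S_0):=\int_{\partial S_0\cup\partial S_1}\psi\,d\mathcal H^1,$$ where, writing $\partial^*E$ for the reduced boundary, $E^{(\theta)}$ for the points of density $\theta$ and $\nu_i$ for the unit normal of $\partial S_i$ (the outer normal on $\partial^*S_i$, and a normal to the approximate tangent line elsewhere), $\psi(x)$ equals - $\varphi_1(x,\nu_1)$ on $\Omega\cap(\partial^*S_1\setminus\partial^*S_0)$; - $\varphi^1(x,\nu_1)$ on $\Omega\cap\partial^*S_0\cap\partial^*S_1$; - $\varphi_{01}(x,\nu_0)$ on $\Omega\cap(\partial^*S_0\setminus\partial S_1)$; - $(\varphi_1+\varphi^1)(x,\nu_1)$ on $\Omega\cap\partial^*S_0\cap\partial S_1\cap S_1^{(1)}$; - $2\varphi_1(x,\nu_1)$ on $\Omega\cap\partial S_1\cap S_1^{(1)}\cap S_0^{(0)}$; - $2\varphi^2(x,\nu_1)$ on $\Omega\cap\partial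 S_1\cap S_1^{(0)}$; - $2\varphi_{01}(x,\nu_0)$ on $\Omega\cap(\partial S_0\setminus\partial S_1)\cap(S_0^{(1)}\cup S_0^{(0)})\cap S_1^{(1)}$; - $\varphi^1(x,\nu_1)$ on $\Omega\cap\partial S_0\cap\partial S_1\cap S_0^{(1)}$; and $\psi=0$ elsewhere. **Proposition.** Let $\mathbf m\in\mathbb N^2$ and let $(S_{h^1_k,K^1_k},S_{h^0_k,K^0_k})_{k\in\mathbb N}\subset\mathcal B^1_{\mathbf m}$ satisfy $$\sup_{k\in\mathbb N}\Big(\mathcal S^1(S_{h^1_k,K^1_k},S_{h^0_k,K^0_k})+\mathcal L^2(S_{h^1_k,K^1_k})\Big)<\infty .$$ Then there are a subsequence and a pair $(S_{h^1,K^1},S_{h^0,K^0})\in\mathcal B^1_{\mathbf m}$ (in particular $h^0\le h^1$) such that the subsequence $\tau_{\mathcal B^1}$-converges to $(S_{h^1,K^1},S_{h^0,K^0})$. -/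

import Mathlib

open MeasureTheory Set Filter Topology
open scoped ENNReal ContDiff

namespace FilmLayers

noncomputable section

/-- The Euclidean plane. -/
abbrev Plane : Type := EuclideanSpace ℝ (Fin 2)

/-- The one-dimensional Hausdorff measure on the plane. -/
abbrev H1 : Measure Plane := Measure.hausdorffMeasure 1

/-- The container `Ω = (-l, l) × (-L, ∞)`. -/
def Omega (l L : ℝ) : Set Plane := {p | p 0 ∈ Ioo (-l) l ∧ -L < p 1}

/-! ### Geometric measure theory -/

/-- The set of points of density `θ` of `E`. -/
def densityPoints (E : Set Plane) (θ : ℝ≥0∞) : Set Plane :=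
  {x | Tendsto (fun r : ℝ => volume (E ∩ Metric.ball x r) / volume (Metric.ball x r))
    (𝓝[>] 0) (𝓝 θ)}

/-- `K` has finite `H1`-measure, and one-dimensional density one at `H1`-almost each of its
points. Sets of measure zero (in particular the empty crack) are included. -/
def IsH1Rectifiable (K : Set Plane) : Prop :=
  H1 K < ⊤ ∧
    ∀ᵐ x ∂(H1.restrict K),
      Tendsto (fun r : ℝ => H1 (K ∩ Metric.ball x r) / ENNReal.ofReal (2 * r)) (𝓝[>] 0) (𝓝 1)

/-- The divergence of a vector field on the plane. -/
def divergence (X : Plane → Plane) (x : Plane) : ℝ :=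
  ∑ i : Fin 2, fderiv ℝ X x (EuclideanSpace.single i 1) i

/-- `E` has finite perimeter and `-σ P` is the polar decomposition of the distributional
derivative `D 1_E`, that is, `P = |D 1_E|` and `D 1_E = -σ P`. -/
structure IsPolarOfDeriv (E : Set Plane) (P : Measure Plane) (σ : Plane → Plane) : Prop where
  finite : IsFiniteMeasure P
  measurable : Measurable σ
  norm_eq_one : ∀ᵐ x ∂P, ‖σ x‖ = 1
  integral_div : ∀ X : Plane → Plane, ContDiff ℝ ∞ X → HasCompactSupport X →
    ∫ x in E, divergence X x = ∫ x, inner ℝ (X x) (σ x) ∂P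

/-- `ν` is the measure-theoretic outer unit normal of `E` at `x`:
`ν = - lim D 1_E (B_r x) / |D 1_E| (B_r x)` as `r → 0`, and `|ν| = 1`. -/
def IsOuterNormal (E : Set Plane) (x ν : Plane) : Prop :=
  ‖ν‖ = 1 ∧ ∃ (P : Measure Plane) (σ : Plane → Plane), IsPolarOfDeriv E P σ ∧
    (∀ r : ℝ, 0 < r → 0 < P (Metric.ball x r)) ∧
    Tendsto (fun r : ℝ => ⨍ y in Metric.ball x r, σ y ∂P) (𝓝[>] 0) (𝓝 ν)

/-- The reduced boundary. -/
def reducedBoundary (E : Set Plane) : Set Plane := {x | ∃ ν, IsOuterNormal E x ν}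

/-- `ν` is a unit vector orthogonal to the approximate tangent line of `Γ` at `x`: the set `Γ` has
positive upper density at `x`, and its part outside every cone around the line `x + ν^⊥` has
density zero at `x`. -/
def IsApproxNormal (Γ : Set Plane) (x ν : Plane) : Prop :=
  ‖ν‖ = 1 ∧
    0 < limsup (fun r : ℝ => H1 (Γ ∩ Metric.ball x r) / ENNReal.ofReal (2 * r)) (𝓝[>] 0) ∧
    ∀ s : ℝ, 0 < s →
      Tendsto (fun r : ℝ =>
        H1 {y ∈ Γ ∩ Metric.ball x r | s * ‖y - x‖ < |inner ℝ ν (y - x)|} / ENNReal.ofReal (2 * r))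
        (𝓝[>] 0) (𝓝 0)

open Classical in
/-- The unit normal `ν_E` on the boundary of `E`: the outer normal on the reduced boundary, and
elsewhere a unit normal (determined up to sign) to the rectifiable set `∂E`. If `∂E` is
rectifiable, the remaining points of `∂E` are `H1`-negligible, and a fixed unit vector is used
there. -/
def unitNormal (E : Set Plane) (x : Plane) : Plane :=
  if h : ∃ ν, IsOuterNormal E x ν then h.choose
  else if h : ∃ ν, IsApproxNormal (frontier E) x ν then h.choose
  else EuclideanSpace.single 1 1

open Classical in
/-- The signed distance from `∂E`, negative inside `E`. -/
def sdist (E : Set Plane) (x : Plane) : ℝ :=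
  if x ∈ E then -Metric.infDist x Eᶜ else Metric.infDist x E

/-! ### Admissible heights, cracks and layers -/

/-- Admissible heights `h : [-l, l] → [0, L]`: upper semicontinuous with finite pointwise
variation. Only the values on `[-l, l]` matter. -/
structure IsAdmissibleHeight (l L : ℝ) (h : ℝ → ℝ) : Prop where
  mapsTo : MapsTo h (Icc (-l) l) (Icc 0 L)
  usc : UpperSemicontinuousOn h (Icc (-l) l)
  variation : BoundedVariationOn h (Icc (-l) l)

/-- The closed subgraph `S_h`. -/
def subgraph (l : ℝ) (h : ℝ → ℝ) : Set Plane := {p | p 0 ∈ Icc (-l) l ∧ p 1 ≤ h (p 0)}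

/-- Admissible cracks. -/
structure IsAdmissibleCrack (l L : ℝ) (K : Set Plane) : Prop where
  subset : K ⊆ closure (Omega l L)
  closed : IsClosed K
  rectifiable : IsH1Rectifiable K

/-- Admissible pairs of a height and a crack set. -/
structure IsAdmissiblePair (l L : ℝ) (h : ℝ → ℝ) (K : Set Plane) : Prop where
  height : IsAdmissibleHeight l L h
  crack : IsAdmissibleCrack l L K
  subset : K ⊆ closure (interior (subgraph l h))

/-- The subgraph `S_{h,K}` with height `h` and cracks `K`. -/
def region (l L : ℝ) (h : ℝ → ℝ) (K : Set Plane) : Set Plane :=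
  (subgraph l h \ K) ∩ closure (Omega l L)

/-- The family `B^1` of pairs (film composite, substrate). -/
def B1 (l L : ℝ) : Set (Set Plane × Set Plane) :=
  {A | ∃ (h₁ h₀ : ℝ → ℝ) (K₁ K₀ : Set Plane),
    IsAdmissiblePair l L h₁ K₁ ∧ IsAdmissiblePair l L h₀ K₀ ∧
    A = (region l L h₁ K₁, region l L h₀ K₀) ∧
    (∀ x ∈ Icc (-l) l, h₀ x ≤ h₁ x) ∧
    frontier (region l L h₁ K₁) ∩ interior (region l L h₀ K₀) = ∅}

/-- The family `B^1_m`: the boundary of the film composite has at most `m₁` connected components,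
and that of the substrate at most `m₀`. -/
def B1m (l L : ℝ) (m₁ m₀ : ℕ) : Set (Set Plane × Set Plane) :=
  {A ∈ B1 l L | ENat.card (ConnectedComponents (frontier A.1)) ≤ m₁ ∧
    ENat.card (ConnectedComponents (frontier A.2)) ≤ m₀}

/-- Convergence in `τ_{B^1}`. -/
structure TauConverges (l L : ℝ) (A : ℕ → Set Plane × Set Plane) (B : Set Plane × Set Plane) :
    Prop where
  mem : ∀ k, A k ∈ B1 l L
  mem_limit : B ∈ B1 l L
  length_film : (⨆ k, H1 (frontier (A k).1)) < ⊤
  length_substrate : (⨆ k, H1 (frontier (A k).2)) < ⊤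
  sdist_film : TendstoLocallyUniformly (fun k => sdist (A k).1) (sdist B.1) atTop
  sdist_substrate : TendstoLocallyUniformly (fun k => sdist (A k).2) (sdist B.2) atTop

/-! ### Surface tensions and the surface energy -/

/-- The regime tension `φ^1_{01} = min {φ_0, φ_1 + φ_{01}}`. -/
def regimeOne (φ₀ φ₁ φ₀₁ : Plane → Plane → ℝ) (x ξ : Plane) : ℝ :=
  min (φ₀ x ξ) (φ₁ x ξ + φ₀₁ x ξ)

/-- The regime tension `φ^2_{01} = min {φ_1, φ_0}`. -/
def regimeTwo (φ₀ φ₁ : Plane → Plane → ℝ) (x ξ : Plane) : ℝ := min (φ₁ x ξ) (φ₀ x ξ)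

/-- Continuous Finsler norms on `closure Ω`. -/
structure IsFinslerNorm (l L : ℝ) (φ : Plane → Plane → ℝ) : Prop where
  continuousOn : ContinuousOn (Function.uncurry φ) (closure (Omega l L) ×ˢ univ)
  homogeneous : ∀ x ∈ closure (Omega l L), ∀ (t : ℝ) (ξ : Plane), φ x (t • ξ) = |t| * φ x ξ
  subadditive : ∀ x ∈ closure (Omega l L), ∀ ξ η : Plane, φ x (ξ + η) ≤ φ x ξ + φ x η
  pos : ∀ x ∈ closure (Omega l L), ∀ ξ : Plane, ξ ≠ 0 → 0 < φ x ξ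

/-- `c₁ |ξ| ≤ φ(x, ξ) ≤ c₂ |ξ|` on `closure Ω`. -/
def IsComparable (l L c₁ c₂ : ℝ) (φ : Plane → Plane → ℝ) : Prop :=
  ∀ x ∈ closure (Omega l L), ∀ ξ : Plane, c₁ * ‖ξ‖ ≤ φ x ξ ∧ φ x ξ ≤ c₂ * ‖ξ‖

/-- The standing assumptions on the surface tensions: Finsler norms with uniform two-sided bounds,
and `φ^1_{01} ≥ |φ_{01} - φ_1|`. -/
structure AdmissibleTensions (l L : ℝ) (φ₀ φ₁ φ₀₁ : Plane → Plane → ℝ) : Prop where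
  finsler_film : IsFinslerNorm l L φ₁
  finsler_interface : IsFinslerNorm l L φ₀₁
  finsler_regimeOne : IsFinslerNorm l L (regimeOne φ₀ φ₁ φ₀₁)
  finsler_regimeTwo : IsFinslerNorm l L (regimeTwo φ₀ φ₁)
  bounds : ∃ c₁ c₂ : ℝ, 0 < c₁ ∧ c₁ ≤ c₂ ∧ IsComparable l L c₁ c₂ φ₁ ∧
    IsComparable l L c₁ c₂ (regimeOne φ₀ φ₁ φ₀₁) ∧ IsComparable l L c₁ c₂ φ₀₁
  triangle : ∀ x ∈ closure (Omega l L), ∀ ξ : Plane,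
    |φ₀₁ x ξ - φ₁ x ξ| ≤ regimeOne φ₀ φ₁ φ₀₁ x ξ

open Classical in
/-- The density `ψ_{0,1}` for the film composite `S₁` and the substrate `S₀`. For admissible pairs
the eight portions are disjoint and exhaust `Ω ∩ (∂S₀ ∪ ∂S₁)` up to an `H1`-negligible set; the
parts of the boundaries on `∂Ω` carry no energy. -/
def density (l L : ℝ) (φ₀ φ₁ φ₀₁ : Plane → Plane → ℝ) (S₁ S₀ : Set Plane) (x : Plane) : ℝ :=
  if x ∈ Omega l L ∩ (reducedBoundary S₁ \ reducedBoundary S₀) then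
    φ₁ x (unitNormal S₁ x)
  else if x ∈ Omega l L ∩ reducedBoundary S₀ ∩ reducedBoundary S₁ then
    regimeOne φ₀ φ₁ φ₀₁ x (unitNormal S₁ x)
  else if x ∈ Omega l L ∩ (reducedBoundary S₀ \ frontier S₁) then
    φ₀₁ x (unitNormal S₀ x)
  else if x ∈ Omega l L ∩ reducedBoundary S₀ ∩ frontier S₁ ∩ densityPoints S₁ 1 then
    φ₁ x (unitNormal S₁ x) + regimeOne φ₀ φ₁ φ₀₁ x (unitNormal S₁ x)
  else if x ∈ Omega l L ∩ frontier S₁ ∩ densityPoints S₁ 1 ∩ densityPoints S₀ 0 then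
    2 * φ₁ x (unitNormal S₁ x)
  else if x ∈ Omega l L ∩ frontier S₁ ∩ densityPoints S₁ 0 then
    2 * regimeTwo φ₀ φ₁ x (unitNormal S₁ x)
  else if x ∈ Omega l L ∩ (frontier S₀ \ frontier S₁) ∩ (densityPoints S₀ 1 ∪ densityPoints S₀ 0)
      ∩ densityPoints S₁ 1 then
    2 * φ₀₁ x (unitNormal S₀ x)
  else if x ∈ Omega l L ∩ frontier S₀ ∩ frontier S₁ ∩ densityPoints S₀ 1 then
    regimeOne φ₀ φ₁ φ₀₁ x (unitNormal S₁ x)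
  else 0

/-- The surface energy `S^1 = S^{(0,1)}`, with values in `[0, ∞]`. -/
def surfaceEnergy (l L : ℝ) (φ₀ φ₁ φ₀₁ : Plane → Plane → ℝ) (A : Set Plane × Set Plane) : ℝ≥0∞ :=
  ∫⁻ x in frontier A.2 ∪ frontier A.1, ENNReal.ofReal (density l L φ₀ φ₁ φ₀₁ A.1 A.2 x) ∂H1

end

end FilmLayers

open MeasureTheory Set Filter Topology
open scoped ENNReal ContDiff

namespace FilmLayers

/-! The energy bounds the length of the boundaries. Bounded length together with boundedly many
components is a compact condition for Hausdorff convergence, and all the constraints are closed.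

Length. In Ω the integrand is at least `c₁` at every boundary point that falls into one of the eight
portions (`le_density`). That H1-almost every boundary point does so rests on Federer's trichotomy
(`ae_mem_reducedBoundary_or_densityPoints`): reduced boundary, density zero or density one. It
applies because an admissible region has finite perimeter, its height having bounded variation and
its crack having no area. Off the reduced boundary the perimeter measure has zero linear density
H1-almost everywhere, and a Poincaré inequality then forces the area density to tend to zero or to
one. Outside Ω the boundaries lie on three fixed segments. Hence the lengths are uniformly bounded
(`exists_length_bound`).

One layer (`exists_layer_limit`). Along a subsequence the closed films, their boundaries and `m`
connected pieces covering each boundary converge in the Hausdorff sense, to F, Γ and pieces of Γ.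
The limit pieces are connected, and of finite length by a covering argument; since only finiteness
matters, a crude factor 16 replaces sharp semicontinuity of length. A continuum of finite length has
density one almost everywhere (`isH1Rectifiable_of_subset_iUnion`): the upper bound is a Besicovitch
covering, and the lower bound holds because almost every point is the centre only of small circles
that meet the continuum twice. F is again the film below some height g; its boundary lies in Γ, so
it has finite length and g has bounded variation. Taking as crack the part of Γ in the closure of
the interior of the subgraph gives a region with closure exactly F and boundary exactly Γ. As the
signed distance is twice the distance to the closure minus the distance to the boundary
(`sdist_eq`), it converges uniformly.

Pairs. The order of the heights is an inclusion of closures, which survives in the limit. A boundary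
point of the limit film composite inside the limit substrate would already produce one for large
indices. -/

/-! ### One-dimensional Hausdorff measure -/

/-- Almost-everywhere coverings of small mesh bound the one-dimensional Hausdorff measure. -/
theorem H1_le_of_covers {s : Set Plane} {c : ℝ≥0∞}
    (h : ∀ δ : ℝ, 0 < δ → ∃ (ι : Type) (_ : Countable ι) (t : ι → Set Plane),
      H1 (s \ ⋃ i, t i) = 0 ∧ (∀ i, Metric.ediam (t i) ≤ ENNReal.ofReal δ) ∧
        ∑' i, Metric.ediam (t i) ≤ c) : H1 s ≤ c := by
  have hpos : ∀ n : ℕ, (0 : ℝ) < 1 / ((n : ℝ) + 1) := fun n => by positivity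
  choose ι hι t h0 hd hs using fun n : ℕ => h _ (hpos n)
  -- The uncovered remainders of all the meshes 1/(n+1) are discarded together; what is left is
  -- covered exactly at every mesh, so the liminf bound for the Hausdorff measure applies.
  set N : Set Plane := ⋃ n, s \ ⋃ i, t n i
  have hN : H1 N = 0 := measure_iUnion_null h0
  have h1 : H1 s ≤ H1 (s \ N) := by
    calc H1 s ≤ H1 ((s \ N) ∪ N) := measure_mono (by intro x hx; by_cases x ∈ N <;> simp_all)
      _ ≤ H1 (s \ N) + H1 N := measure_union_le _ _
      _ = H1 (s \ N) := by rw [hN, add_zero]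
  refine h1.trans ?_
  have hr : Tendsto (fun n : ℕ => ENNReal.ofReal (1 / ((n : ℝ) + 1))) atTop (𝓝 0) := by
    simpa using (ENNReal.tendsto_ofReal tendsto_one_div_add_atTop_nhds_zero_nat)
  have h2 := Measure.hausdorffMeasure_le_liminf_tsum (X := Plane) 1 (s \ N) _ hr t
    (Eventually.of_forall hd) (Eventually.of_forall fun n x hx => by
      by_contra hxt
      exact hx.2 (mem_iUnion.2 ⟨n, hx.1, hxt⟩))
  refine h2.trans ?_
  simp only [ENNReal.rpow_one]
  exact (liminf_le_liminf (Eventually.of_forall hs)).trans (by simp)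

/-- Finite length forces zero two-dimensional Hausdorff measure, hence zero area; this makes cracks
invisible to area, density and perimeter. -/
theorem volume_eq_zero_of_H1_lt_top {s : Set Plane} (hs : H1 s < ⊤) : volume s = 0 := by
  have h2 : (Measure.hausdorffMeasure 2 : Measure Plane) s = 0 :=
    (Measure.hausdorffMeasure_zero_or_top (by norm_num : (1 : ℝ) < 2) s).resolve_right hs.ne
  have hfr : ((Module.finrank ℝ Plane : ℕ) : ℝ) = 2 := by simp
  have : (volume : Measure Plane) ≪ Measure.hausdorffMeasure (Module.finrank ℝ Plane : ℕ) :=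
    Measure.absolutelyContinuous_isAddHaarMeasure _ _
  rw [hfr] at this
  exact this h2

theorem ediam_closedBall_le (x : Plane) (r : ℝ) :
    Metric.ediam (Metric.closedBall x r) ≤ ENNReal.ofReal (2 * r) := by
  refine Metric.ediam_le fun y hy z hz => ?_
  rw [edist_dist]
  refine ENNReal.ofReal_le_ofReal ?_
  have := dist_triangle_right y z x
  rw [Metric.mem_closedBall] at hy hz
  linarith

/-- The upper one-dimensional density of a set of finite length is at most one almost
everywhere. -/
theorem ae_upper_density_le_one {A : Set Plane} (hm : MeasurableSet A) (hA : H1 A < ⊤) :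
    ∀ᵐ x ∂(H1.restrict A), ∀ t : ℝ, 1 < t → ∀ᶠ r in 𝓝[>] (0 : ℝ),
      H1 (A ∩ Metric.closedBall x r) ≤ ENNReal.ofReal (t * (2 * r)) := by
  set μ := H1.restrict A with hμ
  have : IsFiniteMeasure μ := ⟨by simpa [hμ] using hA⟩
  have hμb : ∀ x r, μ (Metric.closedBall x r) = H1 (A ∩ Metric.closedBall x r) := fun x r => by
    rw [hμ, Measure.restrict_apply' hm, inter_comm]
  have key : ∀ t : ℝ, 1 < t → ∀ᵐ x ∂μ, ∀ᶠ r in 𝓝[>] (0 : ℝ),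
      H1 (A ∩ Metric.closedBall x r) ≤ ENNReal.ofReal (t * (2 * r)) := by
    intro t ht
    set Z : Set Plane := {x | ¬ ∀ᶠ r in 𝓝[>] (0 : ℝ),
      H1 (A ∩ Metric.closedBall x r) ≤ ENNReal.ofReal (t * (2 * r))} ∩ A with hZ
    suffices H1 Z = 0 by
      rw [ae_iff, hμ, Measure.restrict_apply' hm]; exact this
    have hZtop : H1 Z < ⊤ := (measure_mono inter_subset_right).trans_lt hA
    have hμZ : ∀ S, S ⊆ Z → μ S = H1 S := fun S hS => by
      rw [hμ, Measure.restrict_apply' hm, inter_eq_left.2 (hS.trans inter_subset_right)]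
    -- Each point of Z is the centre of small balls whose mass exceeds t times the diameter, inside
    -- an open U of mass close to that of Z. A disjoint Besicovitch family of them covers almost all
    -- of Z with total diameter at most μ(U)/t. Letting ε tend to 0 gives H1 Z ≤ H1 Z / t,
    -- impossible for 0 < H1 Z < ∞.
    have happrox : ∀ ε : ℝ≥0∞, ε ≠ 0 → H1 Z ≤ (H1 Z + ε) * ENNReal.ofReal t⁻¹ := by
      intro ε hε
      obtain ⟨U, hZU, hU, hUlt⟩ := Z.exists_isOpen_lt_of_lt (μ := μ) (μ Z + ε)
        (ENNReal.lt_add_right (measure_ne_top _ _) hε)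
      rw [hμZ Z subset_rfl] at hUlt
      refine H1_le_of_covers fun δ hδ => ?_
      set f : Plane → Set ℝ := fun x => {r | ENNReal.ofReal (t * (2 * r)) <
        μ (Metric.closedBall x r) ∧ Metric.closedBall x r ⊆ U}
      have hf : ∀ x ∈ Z, ∀ δ > 0, (f x ∩ Ioo 0 δ).Nonempty := by
        intro x hx δ hδ
        have h1 : ∃ᶠ r in 𝓝[>] (0 : ℝ), ENNReal.ofReal (t * (2 * r)) <
            μ (Metric.closedBall x r) := by
          have := hx.1
          simpa [hμb] using this
        obtain ⟨ε', hε', hball⟩ := Metric.isOpen_iff.1 hU x (hZU hx)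
        have h2 : ∀ᶠ r in 𝓝[>] (0 : ℝ), r ∈ Ioo 0 (min δ ε') :=
          Ioo_mem_nhdsGT (lt_min hδ hε')
        obtain ⟨r, hr1, hr2⟩ := (h1.and_eventually h2).exists
        exact ⟨r, ⟨hr1, (Metric.closedBall_subset_ball
          (hr2.2.trans_le (min_le_right _ _))).trans hball⟩, hr2.1,
          hr2.2.trans_le (min_le_left _ _)⟩
      obtain ⟨T, r, hTc, hTZ, hTr, hT0, hTd⟩ := Besicovitch.exists_disjoint_closedBall_covering_ae
        μ f Z hf (fun _ => δ / 2) (fun _ _ => by positivity)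
      have := hTc.to_subtype
      refine ⟨T, this, fun x => Metric.closedBall x.1 (r x.1), ?_, ?_, ?_⟩
      · rw [← hμZ _ sdiff_subset]
        simpa [iUnion_subtype] using hT0
      · intro x
        refine (ediam_closedBall_le _ _).trans (ENNReal.ofReal_le_ofReal ?_)
        linarith [(hTr x.1 x.2).2.2]
      · calc ∑' x : T, Metric.ediam (Metric.closedBall x.1 (r x.1))
            ≤ ∑' x : T, μ (Metric.closedBall x.1 (r x.1)) * ENNReal.ofReal t⁻¹ := by
              refine ENNReal.tsum_le_tsum fun x => ?_
              refine (ediam_closedBall_le _ _).trans ?_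
              refine le_trans (le_of_eq ?_) (mul_le_mul_left (hTr x.1 x.2).1.1.le _)
              rw [← ENNReal.ofReal_mul (by have := (hTr x.1 x.2).2.1; positivity)]
              congr 1
              field_simp
          _ = (∑' x : T, μ (Metric.closedBall x.1 (r x.1))) * ENNReal.ofReal t⁻¹ :=
              ENNReal.tsum_mul_right
          _ ≤ μ U * ENNReal.ofReal t⁻¹ := by
              gcongr
              have hdis : Pairwise (Function.onFun Disjoint
                  fun x : T => Metric.closedBall x.1 (r x.1)) :=
                fun x y hxy => hTd x.2 y.2 (Subtype.coe_injective.ne hxy)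
              rw [← measure_iUnion hdis fun x => Metric.isClosed_closedBall.measurableSet]
              exact measure_mono (iUnion_subset fun x => (hTr x.1 x.2).1.2)
          _ ≤ _ := by gcongr
    have hcontract : H1 Z ≤ H1 Z * ENNReal.ofReal t⁻¹ := by
      have hlim : Tendsto (fun ε : ℝ≥0∞ => (H1 Z + ε) * ENNReal.ofReal t⁻¹) (𝓝[≠] 0)
          (𝓝 ((H1 Z + 0) * ENNReal.ofReal t⁻¹)) := by
        refine ENNReal.Tendsto.mul_const ?_ (Or.inr ENNReal.ofReal_ne_top)
        exact (tendsto_const_nhds.add tendsto_id).mono_left nhdsWithin_le_nhds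
      rw [add_zero] at hlim
      have : NeBot (𝓝[≠] (0 : ℝ≥0∞)) := by
        have : (𝓝[>] (0 : ℝ≥0∞)).NeBot := inferInstance
        exact this.mono (nhdsWithin_mono _ fun x hx => (ne_of_gt hx))
      exact ge_of_tendsto hlim (eventually_mem_nhdsWithin.mono fun ε hε => happrox ε hε)
    by_contra hne
    have h3 : H1 Z * ENNReal.ofReal t⁻¹ < H1 Z * 1 := by
      refine (ENNReal.mul_lt_mul_iff_right hne hZtop.ne).2 ?_
      rw [← ENNReal.ofReal_one, ENNReal.ofReal_lt_ofReal_iff one_pos]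
      exact inv_lt_one_of_one_lt₀ ht
    rw [mul_one] at h3
    exact absurd hcontract (not_le.2 h3)
  have hall := ae_all_iff.2 fun n : ℕ => key (1 + 1 / ((n : ℝ) + 1))
    (by have : (0 : ℝ) < 1 / ((n : ℝ) + 1) := by positivity
        linarith)
  filter_upwards [hall] with x hx t ht
  obtain ⟨n, hn⟩ := exists_nat_one_div_lt (sub_pos.2 ht)
  filter_upwards [hx n, self_mem_nhdsWithin] with r hr hr0
  refine hr.trans (ENNReal.ofReal_le_ofReal ?_)
  have hr0 : 0 < r := hr0
  gcongr
  linarith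

/-- A finite measure has zero one-dimensional density at `H1`-almost every point of each of its
null sets. -/
theorem ae_density_eq_zero_of_null {P : Measure Plane} [IsFiniteMeasure P] {N : Set Plane}
    (hN : P N = 0) :
    ∀ᵐ x ∂H1, x ∈ N → ∀ t : ℝ, 0 < t → ∀ᶠ r in 𝓝[>] (0 : ℝ),
      P (Metric.closedBall x r) ≤ ENNReal.ofReal (t * r) := by
  have key : ∀ t : ℝ, 0 < t → ∀ᵐ x ∂H1, x ∈ N → ∀ᶠ r in 𝓝[>] (0 : ℝ),
      P (Metric.closedBall x r) ≤ ENNReal.ofReal (t * r) := by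
    intro t ht
    rw [ae_iff]
    set Z : Set Plane := {x | ¬ (x ∈ N → ∀ᶠ r in 𝓝[>] (0 : ℝ),
      P (Metric.closedBall x r) ≤ ENNReal.ofReal (t * r))} with hZ
    have hZN : Z ⊆ N := fun x hx => by
      by_contra h
      exact hx fun h' => absurd h' h
    have happrox : ∀ ε : ℝ≥0∞, ε ≠ 0 → H1 Z ≤ ε * ENNReal.ofReal (8 * t⁻¹) := by
      intro ε hε
      obtain ⟨U, hZU, hU, hUlt⟩ := Z.exists_isOpen_lt_of_lt (μ := P) ε
        (by rw [measure_mono_null hZN hN]; exact pos_iff_ne_zero.2 hε)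
      refine H1_le_of_covers fun δ hδ => ?_
      -- P vanishes on Z, so a covering up to P-null sets says nothing about H1 Z. All of Z has to
      -- be covered, which the Vitali enlargement by 4 achieves; the diameter 8r of an enlarged ball
      -- is 8/t times tr.
      set T : Set (Plane × ℝ) := {p | p.1 ∈ Z ∧ 0 < p.2 ∧ p.2 < δ / 8 ∧
        Metric.closedBall p.1 p.2 ⊆ U ∧ ENNReal.ofReal (t * p.2) < P (Metric.closedBall p.1 p.2)}
      obtain ⟨u, huT, hud, hucov⟩ := Vitali.exists_disjoint_subfamily_covering_enlargement_closedBall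
        T Prod.fst Prod.snd (δ / 8) (fun p hp => hp.2.2.1.le) 4 (by norm_num)
      have huc : u.Countable := hud.countable_of_nonempty_interior fun p hp => by
        have : Metric.ball p.1 p.2 ⊆ interior (Metric.closedBall p.1 p.2) :=
          Metric.ball_subset_interior_closedBall
        exact ⟨p.1, this (Metric.mem_ball_self (huT hp).2.1)⟩
      have := huc.to_subtype
      refine ⟨u, this, fun p => Metric.closedBall p.1.1 (4 * p.1.2), ?_, ?_, ?_⟩
      · have : Z ⊆ ⋃ p : u, Metric.closedBall p.1.1 (4 * p.1.2) := by
          intro x hx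
          have h1 : ∃ᶠ r in 𝓝[>] (0 : ℝ), ENNReal.ofReal (t * r) <
              P (Metric.closedBall x r) := by
            have : x ∈ N ∧ ¬ ∀ᶠ r in 𝓝[>] (0 : ℝ),
              P (Metric.closedBall x r) ≤ ENNReal.ofReal (t * r) := by simpa [hZ] using hx
            simpa using this.2
          obtain ⟨ε', hε', hball⟩ := Metric.isOpen_iff.1 hU x (hZU hx)
          have h2 : ∀ᶠ r in 𝓝[>] (0 : ℝ), r ∈ Ioo 0 (min (δ / 8) ε') :=
            Ioo_mem_nhdsGT (lt_min (by positivity) hε')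
          obtain ⟨r, hr1, hr2⟩ := (h1.and_eventually h2).exists
          obtain ⟨b, hb, hsub⟩ := hucov (x, r) ⟨hx, hr2.1, hr2.2.trans_le (min_le_left _ _),
            (Metric.closedBall_subset_ball (hr2.2.trans_le (min_le_right _ _))).trans hball, hr1⟩
          exact mem_iUnion.2 ⟨⟨b, hb⟩, hsub (Metric.mem_closedBall_self hr2.1.le)⟩
        rw [sdiff_eq_empty.2 this, measure_empty]
      · intro p
        have := huT p.2
        refine (ediam_closedBall_le _ _).trans (ENNReal.ofReal_le_ofReal ?_)
        linarith [this.2.2.1]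
      · calc ∑' p : u, Metric.ediam (Metric.closedBall p.1.1 (4 * p.1.2))
            ≤ ∑' p : u, P (Metric.closedBall p.1.1 p.1.2) * ENNReal.ofReal (8 * t⁻¹) := by
              refine ENNReal.tsum_le_tsum fun p => ?_
              have hp := huT p.2
              refine (ediam_closedBall_le _ _).trans ?_
              refine le_trans (le_of_eq ?_) (mul_le_mul_left hp.2.2.2.2.le _)
              rw [← ENNReal.ofReal_mul (by have := hp.2.1; positivity)]
              congr 1
              field_simp
              ring
          _ = (∑' p : u, P (Metric.closedBall p.1.1 p.1.2)) * ENNReal.ofReal (8 * t⁻¹) :=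
              ENNReal.tsum_mul_right
          _ ≤ P U * ENNReal.ofReal (8 * t⁻¹) := by
              gcongr
              have hdis : Pairwise (Function.onFun Disjoint
                  fun p : u => Metric.closedBall p.1.1 p.1.2) :=
                fun x y hxy => hud x.2 y.2 (Subtype.coe_injective.ne hxy)
              rw [← measure_iUnion hdis fun x => Metric.isClosed_closedBall.measurableSet]
              exact measure_mono (iUnion_subset fun p => (huT p.2).2.2.2.1)
          _ ≤ _ := by gcongr
    have hlim : Tendsto (fun ε : ℝ≥0∞ => ε * ENNReal.ofReal (8 * t⁻¹)) (𝓝[≠] 0)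
        (𝓝 (0 * ENNReal.ofReal (8 * t⁻¹))) :=
      ENNReal.Tendsto.mul_const (tendsto_id.mono_left nhdsWithin_le_nhds)
        (Or.inr ENNReal.ofReal_ne_top)
    rw [zero_mul] at hlim
    have : NeBot (𝓝[≠] (0 : ℝ≥0∞)) := by
      have : (𝓝[>] (0 : ℝ≥0∞)).NeBot := inferInstance
      exact this.mono (nhdsWithin_mono _ fun x hx => (ne_of_gt hx))
    exact le_antisymm
      (ge_of_tendsto hlim (eventually_mem_nhdsWithin.mono fun ε hε => happrox ε hε)) (zero_le)
  have hall := ae_all_iff.2 fun n : ℕ => key (1 / ((n : ℝ) + 1)) (by positivity)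
  filter_upwards [hall] with x hx hxN t ht
  obtain ⟨n, hn⟩ := exists_nat_one_div_lt ht
  filter_upwards [hx n hxN, self_mem_nhdsWithin] with r hr hr0
  refine hr.trans (ENNReal.ofReal_le_ofReal ?_)
  have hr0 : 0 < r := hr0
  gcongr

/-! ### Length estimates by radial projection. -/

theorem volume_image_dist_le (x : Plane) (A : Set Plane) :
    volume ((fun p => dist p x) '' A) ≤ H1 A := by
  rw [← hausdorffMeasure_real]
  have := (LipschitzWith.dist_left x).hausdorffMeasure_image_le (d := 1) zero_le_one A
  simpa using this

/-- A connected set that crosses an annulus has length at least the width of the annulus. -/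
theorem H1_inter_ball_ge {C : Set Plane} (hC : IsPreconnected C) {x p q : Plane} {a b : ℝ}
    (hp : p ∈ C) (hpa : dist p x ≤ a) (hq : q ∈ C) (hqb : b ≤ dist q x) :
    ENNReal.ofReal (b - a) ≤ H1 (C ∩ Metric.ball x b) := by
  refine le_trans ?_ (volume_image_dist_le x _)
  rw [← Real.volume_Ico]
  refine measure_mono fun ρ hρ => ?_
  have hpre := hC.image (fun p => dist p x) (by fun_prop)
  obtain ⟨y, hy, hyρ⟩ := hpre.ordConnected.out (mem_image_of_mem _ hp) (mem_image_of_mem _ hq)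
    (⟨hpa.trans hρ.1, hρ.2.le.trans hqb⟩ : ρ ∈ Icc _ _)
  exact ⟨y, ⟨hy, by simpa [hyρ] using hρ.2⟩, hyρ⟩

/-- If every small circle around `x` meets `C` at least twice, then the length of `C` in the ball
is at least the diameter. -/
theorem H1_inter_ball_ge_two_mul {C : Set Plane} (hC : MeasurableSet C) {x : Plane} {r : ℝ}
    (h : ∀ ρ ∈ Ioo 0 r, ∃ p ∈ C, ∃ q ∈ C, p ≠ q ∧ dist p x = ρ ∧ dist q x = ρ) :
    ENNReal.ofReal (2 * r) ≤ H1 (C ∩ Metric.ball x r) := by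
  -- The plane is cut into cells of side 1/(n+1). The count `g n ρ` of cells whose radial image
  -- contains ρ has integral at most the length, and is eventually at least 2, because two distinct
  -- points on the circle end up in different cells. Fatou's lemma concludes.
  set c : ℕ → Plane → ℤ × ℤ := fun n p => (⌊((n : ℝ) + 1) * p 0⌋, ⌊((n : ℝ) + 1) * p 1⌋)
  have hcm : ∀ n, Measurable (c n) := fun n => by
    refine Measurable.prodMk ?_ ?_ <;> refine Int.measurable_floor.comp ?_ <;> fun_prop
  set S : Set Plane := C ∩ Metric.ball x r
  have hS : MeasurableSet S := hC.inter measurableSet_ball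
  set A : ℕ → ℤ × ℤ → Set Plane := fun n i => S ∩ c n ⁻¹' {i}
  have hA : ∀ n i, MeasurableSet (A n i) := fun n i => hS.inter (hcm n (measurableSet_singleton i))
  -- The radial image of a Borel set need not be Borel, so a measurable hull of the same measure is
  -- used.
  set a : ℕ → ℤ × ℤ → Set ℝ := fun n i => toMeasurable volume ((fun p => dist p x) '' A n i)
  have hsum : ∀ n, ∑' i, H1 (A n i) ≤ H1 S := by
    intro n
    rw [← measure_iUnion (fun i j hij => ?_) (hA n)]
    · exact measure_mono (iUnion_subset fun i => inter_subset_left)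
    · refine disjoint_left.2 fun p hp hq => hij ?_
      exact hp.2.symm.trans hq.2
  set g : ℕ → ℝ → ℝ≥0∞ := fun n ρ => ∑' i, (a n i).indicator 1 ρ
  have hgm : ∀ n, Measurable (g n) := fun n =>
    Measurable.tsum fun i => measurable_one.indicator (measurableSet_toMeasurable _ _)
  have hgint : ∀ n, ∫⁻ ρ, g n ρ ≤ H1 S := by
    intro n
    rw [lintegral_tsum fun i =>
      (measurable_one.indicator (measurableSet_toMeasurable _ _)).aemeasurable]
    refine le_trans (ENNReal.tsum_le_tsum fun i => ?_) (hsum n)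
    rw [lintegral_indicator_one (measurableSet_toMeasurable _ _), measure_toMeasurable]
    exact volume_image_dist_le x _
  have hlim : ∀ ρ ∈ Ioo 0 r, 2 ≤ liminf (fun n => g n ρ) atTop := by
    intro ρ hρ
    obtain ⟨p, hp, q, hq, hpq, hpρ, hqρ⟩ := h ρ hρ
    have hsep : ∀ᶠ n : ℕ in atTop, c n p ≠ c n q := by
      have hco : ∃ i : Fin 2, p i ≠ q i := by
        by_contra! hcon
        exact hpq (PiLp.ext hcon)
      obtain ⟨i, hi⟩ := hco
      have hpos : 0 < |p i - q i| := abs_pos.2 (sub_ne_zero.2 hi)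
      obtain ⟨n₀, hn₀⟩ := exists_nat_gt (1 / |p i - q i|)
      filter_upwards [eventually_ge_atTop n₀] with n hn heq
      have hfl : ⌊((n : ℝ) + 1) * p i⌋ = ⌊((n : ℝ) + 1) * q i⌋ := by
        have h1 := congrArg Prod.fst heq
        have h2 := congrArg Prod.snd heq
        fin_cases i
        · exact h1
        · exact h2
      have h3 := Int.abs_sub_lt_one_of_floor_eq_floor hfl
      rw [← mul_sub, abs_mul, abs_of_pos (by positivity)] at h3
      have h4 : 1 < (n₀ : ℝ) * |p i - q i| := by rwa [div_lt_iff₀ hpos] at hn₀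
      have h5 : (n₀ : ℝ) * |p i - q i| ≤ ((n : ℝ) + 1) * |p i - q i| := by
        gcongr
        have : (n₀ : ℝ) ≤ n := by exact_mod_cast hn
        linarith
      linarith
    refine le_liminf_of_le (by isBoundedDefault) ?_
    filter_upwards [hsep] with n hn
    have hmem : ∀ z ∈ C, dist z x = ρ → ρ ∈ a n (c n z) := fun z hz hzρ =>
      subset_toMeasurable _ _ ⟨z, ⟨⟨hz, by rw [Metric.mem_ball, hzρ]; exact hρ.2⟩, rfl⟩, hzρ⟩
    refine le_trans (le_of_eq ?_) (ENNReal.sum_le_tsum {c n p, c n q})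
    rw [Finset.sum_pair hn, indicator_of_mem (hmem p hp hpρ), indicator_of_mem (hmem q hq hqρ)]
    simp [one_add_one_eq_two]
  calc ENNReal.ofReal (2 * r) = ∫⁻ ρ in Ioo 0 r, (2 : ℝ≥0∞) := by
        rw [setLIntegral_const, Real.volume_Ioo, sub_zero, ENNReal.ofReal_mul (by norm_num)]
        simp
    _ ≤ ∫⁻ ρ in Ioo 0 r, liminf (fun n => g n ρ) atTop :=
        setLIntegral_mono' measurableSet_Ioo hlim
    _ ≤ ∫⁻ ρ, liminf (fun n => g n ρ) atTop := setLIntegral_le_lintegral _ _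
    _ ≤ liminf (fun n => ∫⁻ ρ, g n ρ) atTop := lintegral_liminf_le hgm
    _ ≤ H1 S := (liminf_le_liminf (Eventually.of_forall hgint)).trans (by simp)

/-! ### Continua of finite length -/

/-- Removing an open ball whose boundary circle meets a closed connected set in at most one point
leaves a connected set. -/
theorem isPreconnected_sdiff_ball {C : Set Plane} (hC : IsPreconnected C) (hcl : IsClosed C)
    {x : Plane} {ρ : ℝ} (hs : (C ∩ Metric.sphere x ρ).Subsingleton) :
    IsPreconnected (C \ Metric.ball x ρ) := by
  classical
  rcases hs.eq_empty_or_singleton with h | ⟨y, hy⟩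
  · rcases (C ∩ Metric.ball x ρ).eq_empty_or_nonempty with hb | hb
    · rwa [sdiff_eq_left.2 (disjoint_iff_inter_eq_empty.2 hb)]
    · have hsub : C ⊆ Metric.ball x ρ := by
        refine hC.subset_left_of_subset_union Metric.isOpen_ball
          (Metric.isClosed_closedBall (x := x) (ε := ρ)).isOpen_compl ?_ ?_ hb
        · exact disjoint_left.2 fun z hz hz' => hz' (Metric.ball_subset_closedBall hz)
        · intro z hz
          rcases lt_trichotomy (dist z x) ρ with h1 | h1 | h1
          · exact Or.inl h1
          · exact absurd (show z ∈ C ∩ Metric.sphere x ρ from ⟨hz, h1⟩) (by simp [h])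
          · exact Or.inr (by simpa using h1)
      rw [sdiff_eq_empty.2 hsub]
      exact isPreconnected_empty
  · have hyC : y ∈ C ∧ dist y x = ρ := by
      have : y ∈ C ∩ Metric.sphere x ρ := by rw [hy]; exact mem_singleton y
      exact this
    -- Collapsing the ball to the only point of C on its circle is continuous on C, and its image is
    -- C without the ball.
    set f : Plane → Plane := fun p => if p ∈ Metric.ball x ρ then y else p with hf
    have hunion : C = (C ∩ Metric.closedBall x ρ) ∪ (C \ Metric.ball x ρ) := by
      ext z
      simp only [mem_union, mem_inter_iff, Metric.mem_closedBall, Set.mem_sdiff, Metric.mem_ball, not_lt]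
      constructor
      · intro hz
        rcases le_total (dist z x) ρ with h1 | h1
        · exact Or.inl ⟨hz, h1⟩
        · exact Or.inr ⟨hz, h1⟩
      · rintro (h1 | h1) <;> exact h1.1
    have h1 : ContinuousOn f (C ∩ Metric.closedBall x ρ) := by
      refine (continuousOn_const (c := y)).congr fun z hz => ?_
      by_cases hzb : z ∈ Metric.ball x ρ
      · simp only [hf, if_pos hzb]
      · have : z ∈ C ∩ Metric.sphere x ρ :=
          ⟨hz.1, le_antisymm hz.2 (by simpa using hzb)⟩
        rw [hy] at this
        simp only [hf, if_neg hzb]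
        exact this
    have h2 : ContinuousOn f (C \ Metric.ball x ρ) :=
      continuousOn_id.congr fun z hz => by simp only [hf, if_neg hz.2, id]
    have hcont : ContinuousOn f C := by
      rw [hunion]
      exact h1.union_of_isClosed h2 (hcl.inter Metric.isClosed_closedBall)
        (hcl.sdiff Metric.isOpen_ball)
    have himg : f '' C = C \ Metric.ball x ρ := by
      ext z
      constructor
      · rintro ⟨w, hw, rfl⟩
        by_cases hwb : w ∈ Metric.ball x ρ
        · simp only [hf, if_pos hwb]
          exact ⟨hyC.1, by simp [hyC.2]⟩
        · simp only [hf, if_neg hwb]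
          exact ⟨hw, hwb⟩
      · intro hz
        exact ⟨z, hz.1, by simp only [hf, if_neg hz.2]⟩
    rw [← himg]
    exact hC.image f hcont

theorem isPreconnected_sdiff_biUnion_ball {C : Set Plane} (hC : IsPreconnected C)
    (hcl : IsClosed C) (r : Plane → ℝ) (s : Finset Plane)
    (hs : ∀ x ∈ s, (C ∩ Metric.sphere x (r x)).Subsingleton) :
    IsPreconnected (C \ ⋃ x ∈ s, Metric.ball x (r x)) := by
  classical
  induction s using Finset.induction_on with
  | empty => simpa using hC
  | insert a s _ ih =>
    have h1 := ih fun x hx => hs x (Finset.mem_insert_of_mem hx)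
    have hcl' : IsClosed (C \ ⋃ x ∈ s, Metric.ball x (r x)) :=
      hcl.sdiff (isOpen_biUnion fun _ _ => Metric.isOpen_ball)
    have := isPreconnected_sdiff_ball h1 hcl' (x := a) (ρ := r a)
      ((hs a (Finset.mem_insert_self _ _)).anti (inter_subset_inter_left _ sdiff_subset))
    rw [Finset.set_biUnion_insert, union_comm, ← sdiff_sdiff]
    exact this

/-- Almost no point of a continuum of finite length is the centre of arbitrarily small circles
meeting the continuum at most once. -/
theorem H1_subsingleton_sphere_eq_zero {C : Set Plane} (hC : IsPreconnected C) (hcl : IsClosed C)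
    (hfin : H1 C < ⊤) :
    H1 {x ∈ C | ∃ᶠ ρ in 𝓝[>] (0 : ℝ), (C ∩ Metric.sphere x ρ).Subsingleton} = 0 := by
  classical
  set Z : Set Plane := {x ∈ C | ∃ᶠ ρ in 𝓝[>] (0 : ℝ), (C ∩ Metric.sphere x ρ).Subsingleton} with hZ
  by_contra hne
  have hnull : NullSingletonClass H1 := Measure.nullSingletonClass_hausdorff Plane one_pos
  have hm := hcl.measurableSet
  set μ := H1.restrict C with hμ
  have : IsFiniteMeasure μ := ⟨by simpa [hμ] using hfin⟩
  have hμa : ∀ S, μ S = H1 (S ∩ C) := fun S => Measure.restrict_apply' hm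
  have hμZ : μ Z ≠ 0 := by
    rwa [hμa, inter_eq_left.2 fun x hx => hx.1]
  -- Near a density point of Z, finitely many disjoint balls whose circles meet C at most once
  -- contain most of the length of C. Removing them keeps C connected, and it still has to cross
  -- from near x₀ to distance r: length at least 3r/4 against at most r/2.
  obtain ⟨x₀, hx₀Z, hx₀d, hx₀u⟩ : ∃ x ∈ Z,
      Tendsto (fun r => μ (Z ∩ Metric.closedBall x r) / μ (Metric.closedBall x r)) (𝓝[>] 0) (𝓝 1) ∧
      ∀ t : ℝ, 1 < t → ∀ᶠ r in 𝓝[>] (0 : ℝ),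
        H1 (C ∩ Metric.closedBall x r) ≤ ENNReal.ofReal (t * (2 * r)) := by
    have h1 := Besicovitch.ae_tendsto_measure_inter_div μ Z
    have h2 := ae_upper_density_le_one hm hfin
    have h1' := Measure.measure_inter_eq_zero_of_restrict (ae_iff.1 h1)
    have h2' := ae_iff.1 h2
    by_contra! hcon
    refine hμZ (measure_mono_null (fun x hx => ?_) (measure_union_null h1' h2'))
    by_cases hx1 : Tendsto (fun r => μ (Z ∩ Metric.closedBall x r) / μ (Metric.closedBall x r))
        (𝓝[>] 0) (𝓝 1)
    · right
      obtain ⟨t, ht, hft⟩ := hcon x hx hx1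
      exact fun hall => hft ((hall t ht).mono fun _ h => not_lt.2 h)
    · exact Or.inl ⟨hx1, hx⟩
  obtain ⟨q, hqC, hq⟩ : ∃ q ∈ C, q ≠ x₀ := by
    by_contra! hcon
    refine hne (measure_mono_null (fun x hx => hcon x hx.1) (measure_singleton x₀))
  set D := dist q x₀ with hD
  have hD0 : 0 < D := dist_pos.2 hq
  have e1 := hx₀u 2 (by norm_num)
  have e2 : ∀ᶠ r in 𝓝[>] (0 : ℝ), ENNReal.ofReal (15 / 16) <
      μ (Z ∩ Metric.closedBall x₀ r) / μ (Metric.closedBall x₀ r) :=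
    hx₀d.eventually (lt_mem_nhds (by
      rw [← ENNReal.ofReal_one, ENNReal.ofReal_lt_ofReal_iff] <;> norm_num))
  have e3 : ∀ᶠ r in 𝓝[>] (0 : ℝ), r ∈ Ioo 0 (D / 2) := Ioo_mem_nhdsGT (by positivity)
  obtain ⟨r, hr1, hr2, hr0, hrD⟩ := (e1.and (e2.and e3)).exists
  set B := Metric.closedBall x₀ r with hB
  have hμB : μ B ≤ ENNReal.ofReal (4 * r) := by
    rw [hμa, inter_comm]
    convert hr1 using 2
    ring
  have hZB : ENNReal.ofReal (15 / 16) * μ B ≤ μ (Z ∩ B) :=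
    ENNReal.mul_le_of_le_div hr2.le
  set δ := r / 8 with hδ
  have hδ0 : 0 < δ := by positivity
  set f : Plane → Set ℝ := fun x => {ρ | (C ∩ Metric.sphere x ρ).Subsingleton}
  obtain ⟨T, ρ, hTc, hTZ, hTr, hT0, hTd⟩ := Besicovitch.exists_disjoint_closedBall_covering_ae
    μ f Z (fun x hx δ hδ => by
      obtain ⟨s, hs1, hs2⟩ := (hx.2.and_eventually (Ioo_mem_nhdsGT hδ)).exists
      exact ⟨s, hs1, hs2⟩) (fun _ => δ) (fun _ _ => hδ0)
  have := hTc.to_subtype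
  set W : Set Plane := ⋃ x ∈ T, Metric.ball x (ρ x)
  have hWm : MeasurableSet W := MeasurableSet.biUnion hTc fun _ _ => measurableSet_ball
  have hZW : μ (Z \ W) = 0 := by
    have hsub : Z \ W ⊆ (Z \ ⋃ x ∈ T, Metric.closedBall x (ρ x)) ∪
        ⋃ x ∈ T, (C ∩ Metric.sphere x (ρ x)) := by
      intro z hz
      by_cases hz' : z ∈ ⋃ x ∈ T, Metric.closedBall x (ρ x)
      · right
        simp only [mem_iUnion, exists_prop] at hz' ⊢
        obtain ⟨x, hx, hzx⟩ := hz'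
        refine ⟨x, hx, hz.1.1, le_antisymm hzx ?_⟩
        by_contra hlt
        exact hz.2 (mem_biUnion hx (not_le.1 hlt))
      · exact Or.inl ⟨hz.1, hz'⟩
    refine measure_mono_null hsub (measure_union_null hT0 ?_)
    refine (measure_biUnion_null_iff hTc).2 fun x hx => ?_
    rw [hμa]
    exact (((hTr x hx).1 : (C ∩ Metric.sphere x (ρ x)).Subsingleton).anti
      inter_subset_left).measure_zero _
  -- The upper density bound with t = 2 gives μ(B) ≤ 4r, and at most one sixteenth of it is missed
  -- by Z, hence by W.
  have hBW : μ (B \ W) ≤ ENNReal.ofReal (r / 4) := by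
    have h1 : μ (Z ∩ B) ≤ μ (B ∩ W) := by
      calc μ (Z ∩ B) ≤ μ ((B ∩ W) ∪ (Z \ W)) := measure_mono fun z hz => by
            by_cases hzW : z ∈ W
            · exact Or.inl ⟨hz.2, hzW⟩
            · exact Or.inr ⟨hz.1, hzW⟩
        _ ≤ μ (B ∩ W) + μ (Z \ W) := measure_union_le _ _
        _ = μ (B ∩ W) := by rw [hZW, add_zero]
    have h2 := measure_inter_add_sdiff (μ := μ) B hWm
    have hBt : μ B ≠ ⊤ := measure_ne_top _ _
    have h3 : (15 / 16) * (μ B).toReal ≤ (μ (B ∩ W)).toReal := by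
      have := ENNReal.toReal_mono (measure_ne_top _ _) (hZB.trans h1)
      rwa [ENNReal.toReal_mul, ENNReal.toReal_ofReal (by norm_num)] at this
    have h4 : (μ (B ∩ W)).toReal + (μ (B \ W)).toReal = (μ B).toReal := by
      rw [← ENNReal.toReal_add (measure_ne_top _ _) (measure_ne_top _ _), h2]
    have h5 : (μ B).toReal ≤ 4 * r := ENNReal.toReal_le_of_le_ofReal (by positivity) hμB
    rw [← ENNReal.ofReal_toReal (measure_ne_top μ (B \ W))]
    exact ENNReal.ofReal_le_ofReal (by linarith)
  have hdisj : Pairwise (Function.onFun Disjoint fun x : T => Metric.ball x.1 (ρ x.1)) :=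
    fun x y hxy => (hTd x.2 y.2 (Subtype.coe_injective.ne hxy)).mono
      Metric.ball_subset_closedBall Metric.ball_subset_closedBall
  have hsum : ∑' x : T, μ (Metric.ball x.1 (ρ x.1)) ≠ ⊤ := by
    rw [← measure_iUnion hdisj fun x => measurableSet_ball]
    exact measure_ne_top _ _
  -- Only finitely many balls can be removed by induction; the discarded tail costs another r/4.
  obtain ⟨s, hs⟩ : ∃ s : Finset T,
      ∑' x : {x // x ∉ s}, μ (Metric.ball x.1.1 (ρ x.1.1)) < ENNReal.ofReal (r / 4) :=
    ((ENNReal.tendsto_tsum_compl_atTop_zero hsum).eventually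
      (gt_mem_nhds (ENNReal.ofReal_pos.2 (by positivity)))).exists
  set s' : Finset Plane := s.map (Function.Embedding.subtype _)
  have hs'T : ∀ x ∈ s', x ∈ T := fun x hx => by
    obtain ⟨y, _, rfl⟩ := Finset.mem_map.1 hx
    exact y.2
  set C' : Set Plane := C \ ⋃ x ∈ s', Metric.ball x (ρ x) with hC'
  have hC'conn : IsPreconnected C' := isPreconnected_sdiff_biUnion_ball hC hcl ρ s'
    fun x hx => (hTr x (hs'T x hx)).1
  have hC'small : H1 (C' ∩ Metric.ball x₀ r) ≤ ENNReal.ofReal (r / 2) := by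
    calc H1 (C' ∩ Metric.ball x₀ r) ≤ μ (B \ ⋃ x ∈ s', Metric.ball x (ρ x)) := by
          rw [hμa]
          exact measure_mono fun z hz => ⟨⟨Metric.ball_subset_closedBall hz.2, hz.1.2⟩, hz.1.1⟩
      _ ≤ μ ((B \ W) ∪ ⋃ x : {x // x ∉ s}, Metric.ball x.1.1 (ρ x.1.1)) := by
          refine measure_mono fun z hz => ?_
          by_cases hzW : z ∈ W
          · right
            simp only [W, mem_iUnion, exists_prop] at hzW
            obtain ⟨x, hx, hzx⟩ := hzW
            refine mem_iUnion.2 ⟨⟨⟨x, hx⟩, fun hxs => hz.2 ?_⟩, hzx⟩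
            exact mem_biUnion (Finset.mem_coe.2 (Finset.mem_map.2 ⟨⟨x, hx⟩, hxs, rfl⟩)) hzx
          · exact Or.inl ⟨hz.1, hzW⟩
      _ ≤ μ (B \ W) + ∑' x : {x // x ∉ s}, μ (Metric.ball x.1.1 (ρ x.1.1)) :=
          (measure_union_le _ _).trans (by gcongr; exact measure_iUnion_le _)
      _ ≤ ENNReal.ofReal (r / 4) + ENNReal.ofReal (r / 4) := add_le_add hBW hs.le
      _ = ENNReal.ofReal (r / 2) := by
          rw [← ENNReal.ofReal_add (by positivity) (by positivity)]
          congr 1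
          ring
  -- A removed point lies in a ball of radius less than δ that does not contain C, so C meets its
  -- circle. The selected closed balls are disjoint, so a point of C on that circle is not removed.
  have hdense : ∀ z ∈ C, ∃ z' ∈ C', dist z' z ≤ 2 * δ := by
    intro z hz
    by_cases hzs : z ∈ ⋃ x ∈ s', Metric.ball x (ρ x)
    · simp only [mem_iUnion, exists_prop] at hzs
      obtain ⟨x, hx, hzx⟩ := hzs
      have hρ := (hTr x (hs'T x hx)).2
      obtain ⟨w, hw, hwρ⟩ : ∃ w ∈ C, ρ x ≤ dist w x := by
        by_contra! hcon
        have h1 := hcon q hqC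
        have h2 := hcon x₀ hx₀Z.1
        have h3 := dist_triangle_right q x₀ x
        have := hρ.2
        linarith
      have hpre := (hC.image (fun p => dist p x) (by fun_prop)).ordConnected
      obtain ⟨y, hy, hyρ⟩ := hpre.out (mem_image_of_mem _ hz) (mem_image_of_mem _ hw)
        (⟨(Metric.mem_ball.1 hzx).le, hwρ⟩ : ρ x ∈ Icc _ _)
      refine ⟨y, ⟨hy, fun hyU => ?_⟩, ?_⟩
      · simp only [mem_iUnion, exists_prop] at hyU
        obtain ⟨x', hx', hyx'⟩ := hyU
        have hxx' : x ≠ x' := by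
          rintro rfl
          exact absurd hyρ (Metric.mem_ball.1 hyx').ne
        exact disjoint_left.1 (hTd (hs'T x hx) (hs'T x' hx') hxx')
          (Metric.mem_closedBall.2 hyρ.le) (Metric.ball_subset_closedBall hyx')
      · have h1 := dist_triangle_right y z x
        have h2 := Metric.mem_ball.1 hzx
        have h3 : dist y x = ρ x := hyρ
        have := hρ.2
        linarith
    · exact ⟨z, ⟨hz, hzs⟩, by simp; positivity⟩
  obtain ⟨p', hp', hpd⟩ := hdense x₀ hx₀Z.1
  obtain ⟨q', hq', hqd⟩ := hdense q hqC
  have hge := H1_inter_ball_ge hC'conn hp' hpd hq' (b := r) (by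
    have := dist_triangle_left q x₀ q'
    linarith)
  have := hge.trans hC'small
  rw [ENNReal.ofReal_le_ofReal_iff (by positivity)] at this
  linarith

/-- The lower one-dimensional density of a continuum of finite length is at least one almost
everywhere. -/
theorem ae_lower_density_ge {C : Set Plane} (hC : IsPreconnected C) (hcl : IsClosed C)
    (hfin : H1 C < ⊤) :
    ∀ᵐ x ∂(H1.restrict C), ∀ᶠ r in 𝓝[>] (0 : ℝ),
      ENNReal.ofReal (2 * r) ≤ H1 (C ∩ Metric.ball x r) := by
  rw [ae_iff, Measure.restrict_apply' hcl.measurableSet]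
  refine measure_mono_null ?_ (H1_subsingleton_sphere_eq_zero hC hcl hfin)
  intro x hx
  refine ⟨hx.2, fun hev => ?_⟩
  refine hx.1 ?_
  obtain ⟨ε, hε, hsub⟩ := mem_nhdsGT_iff_exists_Ioo_subset.1 hev
  filter_upwards [Ioo_mem_nhdsGT hε] with r hr
  refine H1_inter_ball_ge_two_mul hcl.measurableSet fun ρ hρ => ?_
  have h1 := hsub (⟨hρ.1, hρ.2.trans hr.2⟩ : ρ ∈ Ioo 0 ε)
  obtain ⟨p, hp, q, hq, hpq⟩ := Set.not_subsingleton_iff.1 h1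
  exact ⟨p, hp.1, q, hq.1, hpq, hp.2, hq.2⟩

/-- Closed subsets of finite unions of continua of finite length are rectifiable. -/
theorem isH1Rectifiable_of_subset_iUnion {ι : Type*} [Finite ι] {C : ι → Set Plane}
    (hC : ∀ i, IsPreconnected (C i)) (hcl : ∀ i, IsClosed (C i)) (hfin : ∀ i, H1 (C i) < ⊤)
    {K : Set Plane} (hK : IsClosed K) (hKC : K ⊆ ⋃ i, C i) : IsH1Rectifiable K := by
  have hKfin : H1 K < ⊤ := by
    have := Fintype.ofFinite ι
    refine (measure_mono hKC).trans_lt ((measure_iUnion_le _).trans_lt ?_)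
    rw [tsum_fintype]
    exact ENNReal.sum_lt_top.2 fun i _ => hfin i
  refine ⟨hKfin, ?_⟩
  have hup := ae_upper_density_le_one hK.measurableSet hKfin
  -- One factor 1 - ε is lost in passing from the continuum to K at its density points, the other in
  -- shrinking the radius so that a closed ball fits in the open one.
  have hlow : ∀ i, ∀ᵐ x ∂H1, x ∈ K → x ∈ C i → ∀ ε ∈ Ioo (0 : ℝ) 1, ∀ᶠ r in 𝓝[>] (0 : ℝ),
      ENNReal.ofReal ((1 - ε) ^ 2 * (2 * r)) ≤ H1 (K ∩ Metric.ball x r) := by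
    intro i
    have hm := (hcl i).measurableSet
    have h1 := (ae_restrict_iff' hm).1 (ae_lower_density_ge (hC i) (hcl i) (hfin i))
    have : IsFiniteMeasure (H1.restrict (C i)) := ⟨by simpa using hfin i⟩
    have h2 := (ae_restrict_iff' hm).1 ((ae_restrict_iff' hK.measurableSet).1
      (Besicovitch.ae_tendsto_measure_inter_div (H1.restrict (C i)) K))
    filter_upwards [h1, h2] with x hx1 hx2 hxK hxC ε hε
    have e2 := (hx2 hxC hxK).eventually (lt_mem_nhds (show ENNReal.ofReal (1 - ε) < 1 by
      rw [← ENNReal.ofReal_one, ENNReal.ofReal_lt_ofReal_iff one_pos]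
      linarith [hε.1]))
    have e := (hx1 hxC).and e2
    have hscale : Tendsto (fun r : ℝ => (1 - ε) * r) (𝓝[>] 0) (𝓝[>] 0) := by
      refine tendsto_nhdsWithin_iff.2 ⟨?_, ?_⟩
      · have : Tendsto (fun r : ℝ => (1 - ε) * r) (𝓝 0) (𝓝 ((1 - ε) * 0)) :=
          (continuous_const.mul continuous_id).tendsto 0
        rw [mul_zero] at this
        exact this.mono_left nhdsWithin_le_nhds
      · filter_upwards [self_mem_nhdsWithin] with r hr
        exact mul_pos (sub_pos.2 hε.2) hr
    filter_upwards [hscale.eventually e, self_mem_nhdsWithin] with r hr hr0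
    have hr0 : 0 < r := hr0
    obtain ⟨hra, hrb⟩ := hr
    set s := (1 - ε) * r with hs
    have hsr : s < r := by nlinarith [hε.1]
    calc ENNReal.ofReal ((1 - ε) ^ 2 * (2 * r))
        = ENNReal.ofReal (1 - ε) * ENNReal.ofReal (2 * s) := by
          rw [← ENNReal.ofReal_mul (by linarith [hε.2])]
          congr 1
          rw [hs]; ring
      _ ≤ ENNReal.ofReal (1 - ε) * H1.restrict (C i) (Metric.closedBall x s) := by
          gcongr
          refine hra.trans ?_
          rw [Measure.restrict_apply' hm, inter_comm]
          exact measure_mono (inter_subset_inter_left _ Metric.ball_subset_closedBall)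
      _ ≤ H1.restrict (C i) (K ∩ Metric.closedBall x s) := ENNReal.mul_le_of_le_div hrb.le
      _ ≤ H1 (K ∩ Metric.closedBall x s) := Measure.restrict_apply_le _ _
      _ ≤ H1 (K ∩ Metric.ball x r) :=
          measure_mono (inter_subset_inter_right _ (Metric.closedBall_subset_ball hsr))
  rw [ae_restrict_iff' hK.measurableSet] at hup ⊢
  filter_upwards [hup, ae_all_iff.2 hlow] with x hxu hxl hxK
  obtain ⟨i, hi⟩ := mem_iUnion.1 (hKC hxK)
  refine tendsto_order.2 ⟨fun a ha => ?_, fun b hb => ?_⟩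
  · have hat : a ≠ ⊤ := (ha.trans ENNReal.one_lt_top).ne
    have ha1 : a.toReal < 1 := by
      have := (ENNReal.toReal_lt_toReal hat ENNReal.one_ne_top).2 ha
      simpa using this
    have ha0 : 0 ≤ a.toReal := ENNReal.toReal_nonneg
    filter_upwards [hxl i hxK hi ((1 - a.toReal) / 2) ⟨by linarith, by linarith⟩,
      self_mem_nhdsWithin] with r hr hr0
    have hr0 : 0 < r := hr0
    rw [ENNReal.lt_div_iff_mul_lt (Or.inl (by simpa using hr0)) (Or.inl ENNReal.ofReal_ne_top)]
    refine lt_of_lt_of_le ?_ hr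
    rw [← ENNReal.ofReal_toReal hat, ← ENNReal.ofReal_mul ENNReal.toReal_nonneg,
      ENNReal.ofReal_toReal hat]
    refine (ENNReal.ofReal_lt_ofReal_iff ?_).2 ?_
    · have : 0 < 1 - (1 - a.toReal) / 2 := by linarith
      positivity
    · have : a.toReal < (1 - (1 - a.toReal) / 2) ^ 2 := by nlinarith
      gcongr
  · obtain ⟨t, ht1, htb⟩ : ∃ t : ℝ, 1 < t ∧ ENNReal.ofReal t < b := by
      obtain ⟨c, hc1, hcb⟩ := exists_between hb
      refine ⟨c.toReal, ?_, by rwa [ENNReal.ofReal_toReal (hcb.trans_le le_top).ne]⟩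
      have := (ENNReal.toReal_lt_toReal ENNReal.one_ne_top (hcb.trans_le le_top).ne).2 hc1
      simpa using this
    filter_upwards [hxu hxK t ht1, self_mem_nhdsWithin] with r hr hr0
    have hr0 : 0 < r := hr0
    refine lt_of_le_of_lt (ENNReal.div_le_of_le_mul ?_) htb
    rw [← ENNReal.ofReal_mul (by linarith)]
    exact (measure_mono (inter_subset_inter_right _ Metric.ball_subset_closedBall)).trans hr

/-- A set approximated from within by connected sets of uniformly bounded length has finite
length. -/
theorem H1_le_of_connected_approx {C : Set Plane} {Ck : ℕ → Set Plane} {M : ℝ≥0∞}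
    (hconn : ∀ k, IsPreconnected (Ck k)) (hM : ∀ k, H1 (Ck k) ≤ M)
    (happ : ∀ z ∈ C, ∀ ε : ℝ, 0 < ε → ∀ᶠ k in atTop, ∃ z' ∈ Ck k, dist z' z < ε) :
    H1 C ≤ 16 * M := by
  classical
  have hnull : NullSingletonClass H1 := Measure.nullSingletonClass_hausdorff Plane one_pos
  rcases C.subsingleton_or_nontrivial with hsub | ⟨p, hp, q, hq, hpq⟩
  · rw [hsub.measure_zero]
    exact zero_le
  have hD : 0 < dist p q := dist_pos.2 hpq
  refine H1_le_of_covers fun δ hδ => ?_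
  -- The bound δ/8 controls the diameter of the balls of radius 4ε. The bound by a quarter of the
  -- distance ensures that no ball of radius ε contains approximations of both p and q, so every
  -- ball is left by the approximating connected set.
  set ε := min (δ / 8) (dist p q / 4) with hε
  have hε0 : 0 < ε := lt_min (by positivity) (by positivity)
  have hε1 : ε ≤ δ / 8 := min_le_left _ _
  have hε2 : ε ≤ dist p q / 4 := min_le_right _ _
  obtain ⟨u, huC, hud, hucov⟩ := Vitali.exists_disjoint_subfamily_covering_enlargement_closedBall
    C id (fun _ => ε) ε (fun _ _ => le_rfl) 4 (by norm_num)
  have huc : u.Countable := hud.countable_of_nonempty_interior fun x hx =>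
    ⟨x, Metric.ball_subset_interior_closedBall (Metric.mem_ball_self hε0)⟩
  refine ⟨u, huc.to_subtype, fun x => Metric.closedBall x.1 (4 * ε), ?_, ?_, ?_⟩
  · have : C ⊆ ⋃ x : u, Metric.closedBall x.1 (4 * ε) := fun z hz => by
      obtain ⟨b, hb, hsub⟩ := hucov z hz
      exact mem_iUnion.2 ⟨⟨b, hb⟩, hsub (Metric.mem_closedBall_self hε0.le)⟩
    rw [sdiff_eq_empty.2 this, measure_empty]
  · intro x
    exact (ediam_closedBall_le _ _).trans (ENNReal.ofReal_le_ofReal (by linarith))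
  · rw [ENNReal.tsum_eq_iSup_sum]
    refine iSup_le fun s => ?_
    have hev : ∀ᶠ k in atTop, ∀ x ∈ s, ∃ z' ∈ Ck k, dist z' x.1 < ε / 2 :=
      (Filter.eventually_all_finset s).2 fun x _ => happ x.1 (huC x.2) _ (by positivity)
    obtain ⟨k, hk, ⟨p', hp', hpd⟩, ⟨q', hq', hqd⟩⟩ := (hev.and
      ((happ p hp _ hε0).and (happ q hq _ hε0))).exists
    -- The connected set crosses from distance ε/2 to distance ε, so its length in the ball is at
    -- least ε/2, and 8ε = 16 · ε/2.
    have hlow : ∀ x ∈ s, Metric.ediam (Metric.closedBall x.1 (4 * ε)) ≤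
        16 * H1.restrict (Ck k) (Metric.ball x.1 ε) := by
      intro x hx
      obtain ⟨z, hz, hzx⟩ := hk x hx
      obtain ⟨w, hw, hwx⟩ : ∃ w ∈ Ck k, ε ≤ dist w x.1 := by
        by_contra! hcon
        have h1 := hcon p' hp'
        have h2 := hcon q' hq'
        have h3 := dist_triangle_right p' q' x.1
        have h4 := dist_triangle4 p p' q' q
        rw [dist_comm p p'] at h4
        linarith
      have hge := H1_inter_ball_ge (hconn k) hz hzx.le hw hwx
      rw [Measure.restrict_apply measurableSet_ball, inter_comm]
      calc _ ≤ ENNReal.ofReal (2 * (4 * ε)) := ediam_closedBall_le _ _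
        _ = 16 * ENNReal.ofReal (ε - ε / 2) := by
            rw [show (16 : ℝ≥0∞) = ENNReal.ofReal 16 by simp,
              ← ENNReal.ofReal_mul (by norm_num)]
            congr 1
            ring
        _ ≤ _ := by gcongr
    calc ∑ x ∈ s, Metric.ediam (Metric.closedBall x.1 (4 * ε))
        ≤ ∑ x ∈ s, 16 * H1.restrict (Ck k) (Metric.ball x.1 ε) := Finset.sum_le_sum hlow
      _ = 16 * ∑ x ∈ s, H1.restrict (Ck k) (Metric.ball x.1 ε) := by rw [Finset.mul_sum]
      _ = 16 * H1.restrict (Ck k) (⋃ x ∈ s, Metric.ball x.1 ε) := by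
          rw [measure_biUnion_finset _ fun _ _ => measurableSet_ball]
          intro x _ y _ hxy
          exact (hud x.2 y.2 (Subtype.coe_injective.ne hxy)).mono
            Metric.ball_subset_closedBall Metric.ball_subset_closedBall
      _ ≤ 16 * M := by
          gcongr
          refine (measure_mono (subset_univ _)).trans ?_
          rw [Measure.restrict_apply_univ]
          exact hM k

/-! ### Signed distances -/

theorem inter_frontier_nonempty {C E : Set Plane} (hC : IsPreconnected C) (h1 : (C ∩ E).Nonempty)
    (h2 : (C ∩ Eᶜ).Nonempty) : (C ∩ frontier E).Nonempty := by
  by_contra hcon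
  rw [not_nonempty_iff_eq_empty] at hcon
  have hnf : ∀ z ∈ C, z ∉ frontier E := fun z hz hzf => by
    have : z ∈ C ∩ frontier E := ⟨hz, hzf⟩
    rw [hcon] at this
    exact this
  obtain ⟨a, haC, haE⟩ := h1
  obtain ⟨b, hbC, hbE⟩ := h2
  have hInt : ∀ z ∈ C, z ∈ interior E ∨ z ∈ (closure E)ᶜ := fun z hz => by
    by_contra! h
    exact hnf z hz ⟨not_not.1 h.2, h.1⟩
  obtain ⟨z, -, hz1, hz2⟩ := hC (interior E) (closure E)ᶜ isOpen_interior isClosed_closure.isOpen_compl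
    hInt ⟨a, haC, (hInt a haC).resolve_right fun h => h (subset_closure haE)⟩
    ⟨b, hbC, (hInt b hbC).resolve_left fun h => hbE (interior_subset h)⟩
  exact hz2 (subset_closure (interior_subset hz1))

theorem infDist_frontier_of_notMem {E : Set Plane} {x : Plane} (hx : x ∉ E) (hE : E.Nonempty) :
    Metric.infDist x (frontier E) = Metric.infDist x E := by
  have key : ∀ y ∈ E, ∃ z ∈ frontier E, dist x z ≤ dist x y := by
    intro y hy
    obtain ⟨z, hz, hzf⟩ := inter_frontier_nonempty
      (convex_segment (𝕜 := ℝ) x y).isPreconnected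
      ⟨y, right_mem_segment ℝ x y, hy⟩ ⟨x, left_mem_segment ℝ x y, hx⟩
    refine ⟨z, hzf, ?_⟩
    have := dist_add_dist_of_mem_segment hz
    linarith [dist_nonneg (x := z) (y := y)]
  refine le_antisymm ?_ ?_
  · refine (Metric.le_infDist hE).2 fun {y} hy => ?_
    obtain ⟨z, hz, hzd⟩ := key y hy
    exact (Metric.infDist_le_dist_of_mem hz).trans hzd
  · obtain ⟨y, hy⟩ := hE
    obtain ⟨z, hz, _⟩ := key y hy
    rw [← Metric.infDist_closure (s := E)]
    exact Metric.infDist_le_infDist_of_subset frontier_subset_closure ⟨z, hz⟩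

theorem infDist_frontier_of_mem {E : Set Plane} {x : Plane} (hx : x ∈ E) (hE : Eᶜ.Nonempty) :
    Metric.infDist x (frontier E) = Metric.infDist x Eᶜ := by
  rw [← frontier_compl]
  exact infDist_frontier_of_notMem (by simpa using hx) hE

theorem abs_sdist {E : Set Plane} (hE : E.Nonempty) (hE' : Eᶜ.Nonempty) (x : Plane) :
    |sdist E x| = Metric.infDist x (frontier E) := by
  unfold sdist
  split_ifs with hx
  · rw [abs_neg, abs_of_nonneg Metric.infDist_nonneg, infDist_frontier_of_mem hx hE']
  · rw [abs_of_nonneg Metric.infDist_nonneg, infDist_frontier_of_notMem hx hE]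

/-- Reduces convergence of signed distances to Hausdorff convergence of closures and of frontiers.
It rests on the fact that the segment from x to a point on the other side of E meets the frontier.
-/
theorem sdist_eq {E : Set Plane} (hE : E.Nonempty) (hE' : Eᶜ.Nonempty) (x : Plane) :
    sdist E x = 2 * Metric.infDist x (closure E) - Metric.infDist x (frontier E) := by
  rw [Metric.infDist_closure]
  unfold sdist
  split_ifs with hx
  · rw [infDist_frontier_of_mem hx hE', Metric.infDist_zero_of_mem hx]
    ring
  · rw [infDist_frontier_of_notMem hx hE]
    ring

/-- Recovers the ordinary distance from the signed one by a continuous operation, so that inclusions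
of closures pass to limits. -/
theorem max_sdist_zero (E : Set Plane) (x : Plane) :
    max (sdist E x) 0 = Metric.infDist x E := by
  unfold sdist
  split_ifs with hx
  · rw [Metric.infDist_zero_of_mem hx]
    exact max_eq_right (neg_nonpos.2 Metric.infDist_nonneg)
  · exact max_eq_left Metric.infDist_nonneg

/-! ### Geometry of subgraphs -/

theorem isOpen_Omega (l L : ℝ) : IsOpen (Omega l L) :=
  (isOpen_Ioo.preimage (f := fun p : Plane => p 0) (by fun_prop)).inter
    (isOpen_lt (f := fun _ : Plane => -L) (g := fun p : Plane => p 1) (by fun_prop) (by fun_prop))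

theorem closure_Omega {l L : ℝ} (hl : 0 < l) :
    closure (Omega l L) = {p : Plane | p 0 ∈ Icc (-l) l ∧ -L ≤ p 1} := by
  refine Subset.antisymm (closure_minimal ?_ ?_) ?_
  · exact fun p hp => ⟨Ioo_subset_Icc_self hp.1, hp.2.le⟩
  · exact (isClosed_Icc.preimage (f := fun p : Plane => p 0) (by fun_prop)).inter
      (isClosed_le (f := fun _ : Plane => -L) (g := fun p : Plane => p 1) (by fun_prop)
        (by fun_prop))
  · intro p hp
    -- The direction points towards the vertical axis and upwards, so every point of the closed
    -- container enters Ω at once.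
    have hlim : Tendsto (fun t : ℝ => p + t • (!₂[-p 0, 1] : Plane)) (𝓝[>] 0) (𝓝 p) := by
      have : Continuous fun t : ℝ => p + t • (!₂[-p 0, 1] : Plane) := by fun_prop
      have h := this.tendsto 0
      simp only [zero_smul, add_zero] at h
      exact h.mono_left nhdsWithin_le_nhds
    refine mem_closure_of_tendsto hlim ?_
    filter_upwards [Ioo_mem_nhdsGT (one_pos : (0 : ℝ) < 1)] with t ht
    obtain ⟨⟨h1, h2⟩, h3⟩ := hp
    refine ⟨⟨?_, ?_⟩, ?_⟩ <;>
      simp only [PiLp.add_apply, PiLp.smul_apply, smul_eq_mul, 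
        Matrix.cons_val_zero, Matrix.cons_val_one] <;>
      nlinarith [ht.1, ht.2]

/-- The part of the closed subgraph in the container. -/
def film (l L : ℝ) (h : ℝ → ℝ) : Set Plane := subgraph l h ∩ closure (Omega l L)

theorem mem_film {l L : ℝ} (hl : 0 < l) {h : ℝ → ℝ} {p : Plane} :
    p ∈ film l L h ↔ p 0 ∈ Icc (-l) l ∧ -L ≤ p 1 ∧ p 1 ≤ h (p 0) := by
  rw [film, closure_Omega hl]
  constructor
  · rintro ⟨⟨h1, h2⟩, _, h3⟩
    exact ⟨h1, h3, h2⟩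
  · rintro ⟨h1, h3, h2⟩
    exact ⟨⟨h1, h2⟩, h1, h3⟩

theorem isClosed_film {l L : ℝ} {h : ℝ → ℝ} (hu : UpperSemicontinuousOn h (Icc (-l) l)) :
    IsClosed (film l L h) := by
  refine IsClosed.inter ?_ isClosed_closure
  have := (upperSemicontinuousOn_iff_isClosed_hypograph isClosed_Icc).1 hu
  exact this.preimage (f := fun p : Plane => (p 0, p 1)) (by fun_prop)

theorem film_subset_box {l L : ℝ} (hl : 0 < l) {h : ℝ → ℝ} (hm : MapsTo h (Icc (-l) l) (Icc 0 L)) :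
    film l L h ⊆ {p : Plane | p 0 ∈ Icc (-l) l ∧ p 1 ∈ Icc (-L) L} := fun p hp => by
  obtain ⟨h1, h2, h3⟩ := (mem_film hl).1 hp
  exact ⟨h1, h2, h3.trans (hm h1).2⟩

theorem isCompact_box (l L : ℝ) :
    IsCompact {p : Plane | p 0 ∈ Icc (-l) l ∧ p 1 ∈ Icc (-L) L} := by
  have h1 : IsClosed {p : Plane | p 0 ∈ Icc (-l) l ∧ p 1 ∈ Icc (-L) L} :=
    (isClosed_Icc.preimage (by fun_prop)).inter (isClosed_Icc.preimage (by fun_prop))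
  refine (Metric.isCompact_iff_isClosed_bounded.2 ⟨h1, ?_⟩)
  refine (Metric.isBounded_iff_subset_closedBall (0 : Plane)).2 ⟨|l| + |L|, fun p hp => ?_⟩
  rw [mem_closedBall_zero_iff, EuclideanSpace.norm_eq]
  refine Real.sqrt_le_iff.2 ⟨by positivity, ?_⟩
  simp only [Fin.sum_univ_two, Real.norm_eq_abs, sq_abs]
  have h1 : |p 0| ≤ |l| := (abs_le.2 hp.1).trans (le_abs_self l)
  have h2 : |p 1| ≤ |L| := (abs_le.2 hp.2).trans (le_abs_self L)
  nlinarith [sq_abs (p 0), sq_abs (p 1), abs_nonneg (p 0), abs_nonneg (p 1)]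

theorem region_eq_film_sdiff (l L : ℝ) (h : ℝ → ℝ) (K : Set Plane) :
    region l L h K = film l L h \ K := by
  ext p
  simp only [region, film, mem_inter_iff, Set.mem_sdiff]
  tauto

/-- Cracks are constrained by the subgraph, which is unbounded below, whereas regions are cut at
height -L. Below height 0 the film fills the container because heights are nonnegative; above -L the
cut is not seen. -/
theorem closure_interior_subgraph_inter {l L : ℝ} (hl : 0 < l) (hL : 0 < L) {h : ℝ → ℝ}
    (hm : MapsTo h (Icc (-l) l) (Icc 0 L)) :
    closure (interior (subgraph l h)) ∩ closure (Omega l L) ⊆ closure (interior (film l L h)) := by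
  rintro p ⟨hp1, hp2⟩
  rcases lt_or_ge (p 1) 0 with h0 | h0
  · have hop : IsOpen {q : Plane | q 1 < 0} := isOpen_lt (by fun_prop) (by fun_prop)
    have hΩ := isOpen_Omega l L
    have hsub : {q : Plane | q 1 < 0} ∩ Omega l L ⊆ interior (film l L h) := by
      refine interior_maximal ?_ (hop.inter hΩ)
      rintro q ⟨hq1, hq2, hq3⟩
      have hq2 := Ioo_subset_Icc_self hq2
      have hq1 : q 1 < 0 := hq1
      exact (mem_film hl).2 ⟨hq2, hq3.le, hq1.le.trans (hm hq2).1⟩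
    exact closure_mono hsub (hop.inter_closure ⟨h0, hp2⟩)
  · have hop : IsOpen {q : Plane | -L < q 1} := isOpen_lt (by fun_prop) (by fun_prop)
    have hsub : {q : Plane | -L < q 1} ∩ interior (subgraph l h) ⊆ interior (film l L h) := by
      refine interior_maximal ?_ (hop.inter isOpen_interior)
      rintro q ⟨hq1, hq2⟩
      obtain ⟨h1, h2⟩ := interior_subset hq2
      exact (mem_film hl).2 ⟨h1, le_of_lt hq1, h2⟩
    exact closure_mono hsub (hop.inter_closure
      ⟨show -L < p 1 by linarith, hp1⟩)

/-- A crack has no area, so its complement is dense in the interior of the film, and the crack lies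
in the closure of that interior. Removing it therefore does not change the closure. -/
theorem closure_region {l L : ℝ} (hl : 0 < l) (hL : 0 < L) {h : ℝ → ℝ} {K : Set Plane}
    (hh : IsAdmissibleHeight l L h) (hK : K ⊆ closure (interior (subgraph l h)))
    (hfin : H1 K < ⊤) : closure (region l L h K) = film l L h := by
  rw [region_eq_film_sdiff]
  refine Subset.antisymm (closure_minimal sdiff_subset (isClosed_film hh.usc)) fun p hp => ?_
  by_cases hpK : p ∈ K
  · have hp' := closure_interior_subgraph_inter hl hL hh.mapsTo ⟨hK hpK, hp.2⟩
    have hdense : Dense Kᶜ := Measure.dense_of_ae (μ := volume)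
      (measure_eq_zero_iff_ae_notMem.1 (volume_eq_zero_of_H1_lt_top hfin))
    have h1 := hdense.open_subset_closure_inter (isOpen_interior (s := film l L h))
    have h2 := closure_minimal h1 isClosed_closure hp'
    exact closure_mono (inter_subset_inter_left _ interior_subset) h2
  · exact subset_closure ⟨hp, hpK⟩

theorem frontier_region {l L : ℝ} (hl : 0 < l) (hL : 0 < L) {h : ℝ → ℝ} {K : Set Plane}
    (hh : IsAdmissibleHeight l L h) (hK : K ⊆ closure (interior (subgraph l h)))
    (hKΩ : K ⊆ closure (Omega l L)) (hKc : IsClosed K)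
    (hfin : H1 K < ⊤) : frontier (region l L h K) = frontier (film l L h) ∪ K := by
  have hcl := isClosed_film (L := L) hh.usc
  have hKF : K ⊆ film l L h := by
    have h1 := closure_interior_subgraph_inter hl hL hh.mapsTo
    exact fun p hp => closure_minimal interior_subset hcl (h1 ⟨hK hp, hKΩ hp⟩)
  rw [frontier_eq_closure_inter_closure, closure_region hl hL hh hK hfin, region_eq_film_sdiff,
    compl_sdiff, closure_union, hKc.closure_eq, inter_union_distrib_left, inter_eq_right.2 hKF,
    frontier_eq_closure_inter_closure, hcl.closure_eq, union_comm]

theorem IsAdmissiblePair.closure_region {l L : ℝ} (hl : 0 < l) (hL : 0 < L) {h : ℝ → ℝ}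
    {K : Set Plane} (hp : IsAdmissiblePair l L h K) : closure (region l L h K) = film l L h :=
  FilmLayers.closure_region hl hL hp.height hp.subset hp.crack.rectifiable.1

theorem origin_mem_film {l L : ℝ} (hl : 0 < l) (hL : 0 < L) {h : ℝ → ℝ}
    (hm : MapsTo h (Icc (-l) l) (Icc 0 L)) : (0 : Plane) ∈ film l L h :=
  (mem_film hl).2 ⟨by simp [hl.le], by simpa using hL.le,
    by simpa using (hm (show (0 : ℝ) ∈ Icc (-l) l by simp [hl.le])).1⟩

theorem IsAdmissiblePair.region_nonempty {l L : ℝ} (hl : 0 < l) (hL : 0 < L) {h : ℝ → ℝ}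
    {K : Set Plane} (hp : IsAdmissiblePair l L h K) : (region l L h K).Nonempty := by
  rw [← closure_nonempty_iff, hp.closure_region hl hL]
  exact ⟨0, origin_mem_film hl hL hp.height.mapsTo⟩

theorem region_compl_nonempty (l L : ℝ) (h : ℝ → ℝ) (K : Set Plane) :
    (region l L h K)ᶜ.Nonempty := by
  refine ⟨!₂[l + 1, 0], fun hp => ?_⟩
  have := hp.1.1.1.2
  simp at this
  linarith

/-! ### Variation of the height and length of the boundary. -/

theorem volume_image_coord_one_le (A : Set Plane) :
    volume ((fun p : Plane => p 1) '' A) ≤ H1 A := by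
  rw [← hausdorffMeasure_real]
  have hlip : LipschitzWith 1 fun p : Plane => p 1 := LipschitzWith.of_dist_le_mul fun p q => by
    rw [NNReal.coe_one, one_mul, EuclideanSpace.dist_eq, Real.dist_eq]
    refine Real.le_sqrt_of_sq_le ?_
    simp only [Fin.sum_univ_two, Real.dist_eq, sq_abs]
    nlinarith [sq_nonneg (p 0 - q 0)]
  have := hlip.hausdorffMeasure_image_le (d := 1) zero_le_one A
  simpa using this

/-- The oscillation of the height between two points is bounded by the length of the boundary in
the strip between them. -/
theorem edist_height_le {l L : ℝ} (hl : 0 < l) (hL : 0 < L) {h : ℝ → ℝ}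
    (hm : MapsTo h (Icc (-l) l) (Icc 0 L)) {a b : ℝ} (ha : a ∈ Icc (-l) l) (hb : b ∈ Icc (-l) l)
    (hab : a ≤ b) :
    edist (h b) (h a) ≤ H1 (frontier (film l L h) ∩ {p | p 0 ∈ Icc a b}) := by
  refine le_trans ?_ (volume_image_coord_one_le _)
  have hvol : edist (h b) (h a) = volume (Ioc (min (h a) (h b)) (max (h a) (h b))) := by
    rw [Real.volume_Ioc, edist_dist, dist_comm, Real.dist_eq, max_sub_min_eq_abs, abs_sub_comm]
  rw [hvol]
  -- At a level y between the two heights, the horizontal segment from a to b has one end in the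
  -- film and the other outside, so it meets the frontier. Thus the vertical projection of the
  -- frontier covers all these levels.
  refine measure_mono fun y hy => ?_
  have hcont : Continuous fun t : ℝ => (!₂[t, y] : Plane) := by fun_prop
  have hconn : IsPreconnected ((fun t : ℝ => (!₂[t, y] : Plane)) '' Icc a b) :=
    isPreconnected_Icc.image _ hcont.continuousOn
  have hyL : -L ≤ y := by
    have h1 := (hm ha).1
    have h2 := (hm hb).1
    have : 0 ≤ min (h a) (h b) := le_min h1 h2
    linarith [hy.1]
  have hmem : ∀ t ∈ Icc (-l) l, ((!₂[t, y] : Plane) ∈ film l L h ↔ y ≤ h t) := fun t ht => by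
    rw [mem_film hl]
    simp [ht.1, ht.2, hyL]
  have hex : (((fun t : ℝ => (!₂[t, y] : Plane)) '' Icc a b) ∩ frontier (film l L h)).Nonempty := by
    rcases le_total (h a) (h b) with hle | hle
    · rw [min_eq_left hle, max_eq_right hle] at hy
      exact inter_frontier_nonempty hconn
        ⟨_, ⟨b, right_mem_Icc.2 hab, rfl⟩, (hmem b hb).2 hy.2⟩
        ⟨_, ⟨a, left_mem_Icc.2 hab, rfl⟩, fun hc => absurd ((hmem a ha).1 hc) (not_le.2 hy.1)⟩
    · rw [min_eq_right hle, max_eq_left hle] at hy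
      exact inter_frontier_nonempty hconn
        ⟨_, ⟨a, left_mem_Icc.2 hab, rfl⟩, (hmem a ha).2 hy.2⟩
        ⟨_, ⟨b, right_mem_Icc.2 hab, rfl⟩, fun hc => absurd ((hmem b hb).1 hc) (not_le.2 hy.1)⟩
  obtain ⟨_, ⟨t, ht, rfl⟩, hfr⟩ := hex
  exact ⟨_, ⟨hfr, by simpa using ht⟩, by simp⟩

/-- Consecutive closed strips share a vertical line, which carries positive length where the height
jumps. Splitting each closed interval into its two half-open ones gives two disjoint families, hence
the variation is at most twice the length. -/
theorem boundedVariationOn_of_H1_frontier {l L : ℝ} (hl : 0 < l) (hL : 0 < L) {h : ℝ → ℝ}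
    (hm : MapsTo h (Icc (-l) l) (Icc 0 L)) (hfin : H1 (frontier (film l L h)) < ⊤) :
    BoundedVariationOn h (Icc (-l) l) := by
  set Γ := frontier (film l L h) with hΓ
  have hcoord : Measurable fun p : Plane => p 0 := by fun_prop
  set ν : Measure ℝ := (H1.restrict Γ).map fun p => p 0 with hν
  have hνa : ∀ s, MeasurableSet s → ν s = H1 (Γ ∩ {p | p 0 ∈ s}) := fun s hs => by
    rw [hν, Measure.map_apply hcoord hs, Measure.restrict_apply (hcoord hs), inter_comm]
    rfl
  have hνu : ν univ = H1 Γ := by rw [hνa _ MeasurableSet.univ]; simp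
  have hle : eVariationOn h (Icc (-l) l) ≤ H1 Γ + H1 Γ := by
    refine iSup_le fun ⟨n, u, hu, hus⟩ => ?_
    have hterm : ∀ i, edist (h (u (i + 1))) (h (u i)) ≤
        ν (Ico (u i) (u (i + 1))) + ν (Ioc (u i) (u (i + 1))) := by
      intro i
      rcases (hu (Nat.le_succ i)).eq_or_lt with heq | hlt
      · rw [Nat.succ_eq_add_one] at heq
        rw [heq, edist_self]; exact zero_le
      · refine (edist_height_le hl hL hm (hus i) (hus (i + 1)) hlt.le).trans ?_
        rw [← hνa _ measurableSet_Icc]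
        refine (measure_mono ?_).trans (measure_union_le _ _)
        intro x hx
        rcases hx.2.eq_or_lt with h1 | h1
        · exact Or.inr ⟨by rw [h1]; exact hlt, hx.2⟩
        · exact Or.inl ⟨hx.1, h1⟩
    calc ∑ i ∈ Finset.range n, edist (h (u (i + 1))) (h (u i))
        ≤ ∑ i ∈ Finset.range n, (ν (Ico (u i) (u (i + 1))) + ν (Ioc (u i) (u (i + 1)))) :=
          Finset.sum_le_sum fun i _ => hterm i
      _ = ν (⋃ i ∈ Finset.range n, Ico (u i) (u (i + 1))) +
          ν (⋃ i ∈ Finset.range n, Ioc (u i) (u (i + 1))) := by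
          rw [Finset.sum_add_distrib, measure_biUnion_finset, measure_biUnion_finset]
          · exact (hu.pairwise_disjoint_on_Ioc_succ).set_pairwise _
          · exact fun _ _ => measurableSet_Ioc
          · exact (hu.pairwise_disjoint_on_Ico_succ).set_pairwise _
          · exact fun _ _ => measurableSet_Ico
      _ ≤ H1 Γ + H1 Γ := by
          rw [← hνu]
          exact add_le_add (measure_mono (subset_univ _)) (measure_mono (subset_univ _))
  exact (hle.trans_lt (ENNReal.add_lt_top.2 ⟨hfin, hfin⟩)).ne

/-! ### Convergence of compact sets -/

theorem mem_of_tendsto_infDist {S : ℕ → Set Plane} {T : Set Plane} (hT : IsClosed T)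
    (hne : T.Nonempty)
    (hST : TendstoUniformly (fun k x => Metric.infDist x (S k)) (fun x => Metric.infDist x T) atTop)
    {z : Plane} (hz : Tendsto (fun k => Metric.infDist z (S k)) atTop (𝓝 0)) : z ∈ T := by
  rw [hT.mem_iff_infDist_zero hne]
  exact tendsto_nhds_unique (hST.tendsto_at z) hz

theorem tendsto_infDist_of_mem {S : ℕ → Set Plane} {T : Set Plane}
    (hST : TendstoUniformly (fun k x => Metric.infDist x (S k)) (fun x => Metric.infDist x T) atTop)
    {z : Plane} (hz : z ∈ T) : Tendsto (fun k => Metric.infDist z (S k)) atTop (𝓝 0) := by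
  have := hST.tendsto_at z
  rwa [Metric.infDist_zero_of_mem hz] at this

theorem subset_of_tendsto_infDist {S S' : ℕ → Set Plane} {T T' : Set Plane} (hT' : IsClosed T')
    (hne' : T'.Nonempty) (hne : ∀ k, (S k).Nonempty)
    (hST : TendstoUniformly (fun k x => Metric.infDist x (S k)) (fun x => Metric.infDist x T) atTop)
    (hST' : TendstoUniformly (fun k x => Metric.infDist x (S' k)) (fun x => Metric.infDist x T')
      atTop) (hsub : ∀ k, S k ⊆ S' k) : T ⊆ T' := fun _ hz =>
  mem_of_tendsto_infDist hT' hne' hST' (squeeze_zero (fun _ => Metric.infDist_nonneg)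
    (fun k => Metric.infDist_le_infDist_of_subset (hsub k) (hne k))
    (tendsto_infDist_of_mem hST hz))

/-- A limit of connected sets is connected. -/
theorem isPreconnected_of_tendsto_infDist {S : ℕ → Set Plane} {T : Set Plane} (hT : IsCompact T)
    (hTne : T.Nonempty) (hconn : ∀ k, IsPreconnected (S k)) (hne : ∀ k, (S k).Nonempty)
    (hST : TendstoUniformly (fun k x => Metric.infDist x (S k)) (fun x => Metric.infDist x T)
      atTop) : IsPreconnected T := by
  rw [isPreconnected_closed_iff]
  intro t t' ht ht' hcov hA hB
  by_contra hcon
  rw [not_nonempty_iff_eq_empty] at hcon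
  set A := T ∩ t
  set B := T ∩ t'
  have hAc : IsCompact A := hT.inter_right ht
  have hBc : IsClosed B := hT.isClosed.inter ht'
  have hdisj : Disjoint A B := disjoint_left.2 fun z hz hz' => by
    have : z ∈ T ∩ (t ∩ t') := ⟨hz.1, hz.2, hz'.2⟩
    rw [hcon] at this
    exact this
  obtain ⟨ε, hε, hsep⟩ : ∃ ε : ℝ, 0 < ε ∧ ∀ a ∈ A, ∀ b ∈ B, 2 * ε ≤ dist a b := by
    obtain ⟨r, hr, hsep⟩ := Metric.exists_pos_forall_lt_edist hAc hBc hdisj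
    refine ⟨r / 2, by positivity, fun a ha b hb => ?_⟩
    have := hsep a ha b hb
    rw [edist_nndist, ENNReal.coe_lt_coe] at this
    have h2 : (r : ℝ) < dist a b := by exact_mod_cast this
    linarith
  have hunif := Metric.tendstoUniformly_iff.1 hST ε hε
  obtain ⟨a, ha⟩ := hA
  obtain ⟨b, hb⟩ := hB
  have hnear : ∀ z ∈ T, ∀ᶠ k in atTop, ∃ w ∈ S k, dist z w < ε := fun z hz => by
    filter_upwards [(tendsto_infDist_of_mem hST hz).eventually (gt_mem_nhds hε)] with k hk
    exact (Metric.infDist_lt_iff (hne k)).1 hk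
  obtain ⟨k, hk, ⟨a', ha', haa⟩, ⟨b', hb', hbb⟩⟩ :=
    (hunif.and ((hnear a ha.1).and (hnear b hb.1))).exists
  have hcl : ∀ x ∈ S k, ∃ z ∈ T, dist x z < ε := fun x hx => by
    have := hk x
    rw [Metric.infDist_zero_of_mem hx, Real.dist_eq, sub_zero,
      abs_of_nonneg Metric.infDist_nonneg] at this
    exact (Metric.infDist_lt_iff hTne).1 this
  -- On a connected set close to T this function changes sign, so it vanishes somewhere. A zero is
  -- equidistant from A and B yet within ε of one of them, against the gap 2ε.
  set f : Plane → ℝ := fun x => Metric.infDist x A - Metric.infDist x B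
  have hf : Continuous f := (Metric.continuous_infDist_pt A).sub (Metric.continuous_infDist_pt B)
  have hAne : A.Nonempty := ⟨a, ha⟩
  have hBne : B.Nonempty := ⟨b, hb⟩
  have not_both : ∀ x : Plane, Metric.infDist x A < ε → ¬ Metric.infDist x B < ε := by
    intro x h1 h2
    obtain ⟨y, hy, hxy⟩ := (Metric.infDist_lt_iff hAne).1 h1
    obtain ⟨z, hz, hxz⟩ := (Metric.infDist_lt_iff hBne).1 h2
    have := hsep y hy z hz
    have := dist_triangle_left y z x
    linarith
  have hfa : f a' ≤ 0 := by
    have h1 : Metric.infDist a' A < ε :=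
      (Metric.infDist_le_dist_of_mem ha).trans_lt (by rwa [dist_comm])
    have h2 := not_lt.1 (not_both a' h1)
    simp only [f]; linarith
  have hfb : 0 ≤ f b' := by
    have h1 : Metric.infDist b' B < ε :=
      (Metric.infDist_le_dist_of_mem hb).trans_lt (by rwa [dist_comm])
    have h2 := not_lt.1 fun h => not_both b' h h1
    simp only [f]; linarith
  obtain ⟨x, hx, hx0⟩ := ((hconn k).image f hf.continuousOn).ordConnected.out
    (mem_image_of_mem f ha') (mem_image_of_mem f hb') (⟨hfa, hfb⟩ : (0 : ℝ) ∈ Icc _ _)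
  have hx0 : Metric.infDist x A = Metric.infDist x B := sub_eq_zero.1 hx0
  obtain ⟨z, hz, hxz⟩ := hcl x hx
  rcases hcov hz with hzt | hzt
  · have hzA : z ∈ A := ⟨hz, hzt⟩
    have h1 := (Metric.infDist_le_dist_of_mem hzA).trans_lt hxz
    exact not_both x h1 (hx0 ▸ h1)
  · have hzB : z ∈ B := ⟨hz, hzt⟩
    have h1 := (Metric.infDist_le_dist_of_mem hzB).trans_lt hxz
    exact not_both x (hx0 ▸ h1) h1

/-- A finite family of sequences of nonempty compact sets in a fixed compact set has a common
convergent subsequence. -/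
theorem exists_subseq_tendsto_infDist {ι : Type*} [Finite ι] {Q : Set Plane} (hQ : IsCompact Q)
    (S : ℕ → ι → Set Plane) (hc : ∀ k i, IsCompact (S k i)) (hne : ∀ k i, (S k i).Nonempty)
    (hSQ : ∀ k i, S k i ⊆ Q) :
    ∃ n : ℕ → ℕ, StrictMono n ∧ ∃ T : ι → Set Plane, (∀ i, IsCompact (T i)) ∧
      (∀ i, (T i).Nonempty) ∧ ∀ i, TendstoUniformly (fun k x => Metric.infDist x (S (n k) i))
        (fun x => Metric.infDist x (T i)) atTop := by
  -- Blaschke's selection theorem, on a finite product of hyperspaces with the Hausdorff metric; the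
  -- distance to a set is 1-Lipschitz in the set, uniformly in the point.
  set X : ℕ → ι → TopologicalSpace.NonemptyCompacts Plane := fun k i => ⟨⟨S k i, hc k i⟩, hne k i⟩
  have hcomp : IsCompact (univ.pi fun _ : ι =>
      {A : TopologicalSpace.NonemptyCompacts Plane | (A : Set Plane) ⊆ Q}) :=
    isCompact_univ_pi fun _ =>
      TopologicalSpace.NonemptyCompacts.isCompact_subsets_of_isCompact hQ
  obtain ⟨Y, -, n, hn, hlim⟩ := hcomp.tendsto_subseq (x := X) fun k i _ => hSQ k i
  refine ⟨n, hn, fun i => Y i, fun i => (Y i).isCompact, fun i => (Y i).nonempty, fun i => ?_⟩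
  rw [Metric.tendstoUniformly_iff]
  intro ε hε
  filter_upwards [(Metric.tendsto_nhds.1 (tendsto_pi_nhds.1 hlim i)) ε hε] with k hk x
  have := (Metric.lipschitz_infDist_set x).dist_le_mul (X (n k) i) (Y i)
  rw [NNReal.coe_one, one_mul, dist_comm] at this
  exact this.trans_lt hk

/-! ### Connected components -/

/-- Components are repeated if there are fewer than `m`, so that one index set serves a whole
sequence of boundaries and the pieces can be extracted together. -/
theorem exists_connected_cover {Γ : Set Plane} (hΓ : IsCompact Γ) (hne : Γ.Nonempty) {m : ℕ}
    (hm : ENat.card (ConnectedComponents Γ) ≤ m) :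
    ∃ C : Fin m → Set Plane, (∀ j, IsCompact (C j)) ∧ (∀ j, (C j).Nonempty) ∧
      (∀ j, IsPreconnected (C j)) ∧ ⋃ j, C j = Γ := by
  have hfin : Finite (ConnectedComponents Γ) :=
    ENat.card_lt_top.1 (hm.trans_lt (ENat.natCast_lt_top m))
  have : Nonempty (ConnectedComponents Γ) := ⟨ConnectedComponents.mk ⟨_, hne.some_mem⟩⟩
  have := Fintype.ofFinite (ConnectedComponents Γ)
  have hcard : Fintype.card (ConnectedComponents Γ) ≤ Fintype.card (Fin m) := by
    rw [ENat.card_eq_coe_fintype_card] at hm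
    simpa using hm
  obtain ⟨e⟩ := Function.Embedding.nonempty_of_card_le hcard
  obtain ⟨g, hg⟩ : ∃ g : Fin m → ConnectedComponents Γ, Function.Surjective g :=
    ⟨Function.invFun e, Function.invFun_surjective e.injective⟩
  have : CompactSpace Γ := isCompact_iff_compactSpace.1 hΓ
  choose x hx using fun j => ConnectedComponents.surjective_coe (g j)
  refine ⟨fun j => Subtype.val '' connectedComponent (x j), fun j => ?_, fun j => ?_, fun j => ?_,
    ?_⟩
  · exact isClosed_connectedComponent.isCompact.image continuous_subtype_val
  · exact ⟨_, mem_image_of_mem _ mem_connectedComponent⟩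
  · exact isPreconnected_connectedComponent.image _ continuous_subtype_val.continuousOn
  · refine Subset.antisymm (iUnion_subset fun j => ?_) fun z hz => ?_
    · rintro _ ⟨y, -, rfl⟩
      exact y.2
    · obtain ⟨j, hj⟩ := hg (ConnectedComponents.mk ⟨z, hz⟩)
      refine mem_iUnion.2 ⟨j, ⟨z, hz⟩, ?_, rfl⟩
      rw [← hx j] at hj
      have := ConnectedComponents.coe_eq_coe'.1 hj.symm
      exact this

theorem card_connectedComponents_le {Γ : Set Plane} {m : ℕ} {C : Fin m → Set Plane}
    (hne : ∀ j, (C j).Nonempty) (hC : ∀ j, IsPreconnected (C j)) (hΓ : ⋃ j, C j = Γ) :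
    ENat.card (ConnectedComponents Γ) ≤ m := by
  have hsub : ∀ j, C j ⊆ Γ := fun j => hΓ ▸ subset_iUnion C j
  choose x hx using hne
  set g : Fin m → ConnectedComponents Γ := fun j => ConnectedComponents.mk ⟨x j, hsub j (hx j)⟩
  have hg : Function.Surjective g := by
    intro c
    obtain ⟨⟨z, hz⟩, rfl⟩ := ConnectedComponents.surjective_coe c
    obtain ⟨j, hj⟩ := mem_iUnion.1 (hΓ ▸ hz : z ∈ ⋃ j, C j)
    refine ⟨j, ?_⟩
    have hpre : IsPreconnected (Subtype.val ⁻¹' C j : Set Γ) := by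
      rw [← Topology.IsInducing.subtypeVal.isPreconnected_image, Subtype.image_preimage_coe,
        inter_eq_right.2 (hsub j)]
      exact hC j
    exact ConnectedComponents.coe_eq_coe'.2 (hpre.subset_connectedComponent hj (hx j))
  have hinj := ENat.card_le_card_of_injective (Function.injective_surjInv hg)
  simpa using hinj

/-! ### Compactness of a single layer -/

theorem dist_le_of_coord {p q p' q' : Plane} (h0 : |p 0 - q 0| ≤ |p' 0 - q' 0|)
    (h1 : |p 1 - q 1| ≤ |p' 1 - q' 1|) : dist p q ≤ dist p' q' := by
  rw [EuclideanSpace.dist_eq, EuclideanSpace.dist_eq]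
  refine Real.sqrt_le_sqrt ?_
  simp only [Fin.sum_univ_two, Real.dist_eq]
  gcongr

/-- Lowering a point by a vertical translation inside the container does not increase its distance
from a film. -/
theorem infDist_film_le {l L : ℝ} (hl : 0 < l) (hL : 0 < L) {h : ℝ → ℝ}
    (hm : MapsTo h (Icc (-l) l) (Icc 0 L)) (z : Plane) {y : ℝ} (hy : -L ≤ y) (hyz : y ≤ z 1) :
    Metric.infDist (!₂[z 0, y] : Plane) (film l L h) ≤ Metric.infDist z (film l L h) := by
  refine (Metric.le_infDist ⟨0, origin_mem_film hl hL hm⟩).2 fun {w} hw => ?_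
  obtain ⟨h1, h2, h3⟩ := (mem_film hl).1 hw
  -- The competitor w is lowered as much as z was, and stopped at the bottom of the container.
  have hw' : (!₂[w 0, max (-L) (w 1 - (z 1 - y))] : Plane) ∈ film l L h := by
    rw [mem_film hl]
    refine ⟨by simpa using h1, by simp, ?_⟩
    simp only [Matrix.cons_val_zero, Matrix.cons_val_one]
    exact max_le (h2.trans h3) (by linarith)
  refine (Metric.infDist_le_dist_of_mem hw').trans (dist_le_of_coord ?_ ?_)
  · simp
  · simp only [Matrix.cons_val_one, Matrix.cons_val_zero]
    rw [abs_le]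
    rcases le_total (-L) (w 1 - (z 1 - y)) with hc | hc
    · rw [max_eq_right hc]
      constructor
      · linarith [neg_abs_le (z 1 - w 1), le_abs_self (z 1 - w 1)]
      · linarith [neg_abs_le (z 1 - w 1), le_abs_self (z 1 - w 1)]
    · rw [max_eq_left hc]
      constructor
      · linarith [abs_nonneg (z 1 - w 1)]
      · linarith [le_abs_self (z 1 - w 1)]

/-- A limit of films is a film. -/
theorem exists_film_limit {l L : ℝ} (hl : 0 < l) (hL : 0 < L) {h : ℕ → ℝ → ℝ}
    (hm : ∀ k, MapsTo (h k) (Icc (-l) l) (Icc 0 L)) {F : Set Plane} (hF : IsClosed F)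
    (hFne : F.Nonempty)
    (hlim : TendstoUniformly (fun k x => Metric.infDist x (film l L (h k)))
      (fun x => Metric.infDist x F) atTop) :
    ∃ g : ℝ → ℝ, MapsTo g (Icc (-l) l) (Icc 0 L) ∧ UpperSemicontinuousOn g (Icc (-l) l) ∧
      film l L g = F := by
  have hne : ∀ k, (film l L (h k)).Nonempty := fun k => ⟨0, origin_mem_film hl hL (hm k)⟩
  have hbox : F ⊆ {p : Plane | p 0 ∈ Icc (-l) l ∧ p 1 ∈ Icc (-L) L} := by
    intro z hz
    have hQ := (isCompact_box l L).isClosed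
    have hQne : {p : Plane | p 0 ∈ Icc (-l) l ∧ p 1 ∈ Icc (-L) L}.Nonempty :=
      (hne 0).mono (film_subset_box hl (hm 0))
    rw [hQ.mem_iff_infDist_zero hQne]
    exact tendsto_nhds_unique tendsto_const_nhds (squeeze_zero (fun _ => Metric.infDist_nonneg)
      (fun k => Metric.infDist_le_infDist_of_subset (film_subset_box hl (hm k)) (hne k))
      (tendsto_infDist_of_mem hlim hz))
  have hbase : ∀ x ∈ Icc (-l) l, (!₂[x, 0] : Plane) ∈ F := by
    intro x hx
    refine mem_of_tendsto_infDist hF hFne hlim ?_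
    refine tendsto_const_nhds.congr fun k => (Metric.infDist_zero_of_mem ?_).symm
    rw [mem_film hl]
    exact ⟨by simpa using hx, by simpa using hL.le, by simpa using (hm k hx).1⟩
  have hdown : ∀ z ∈ F, ∀ y, -L ≤ y → y ≤ z 1 → (!₂[z 0, y] : Plane) ∈ F := fun z hz y hy hyz =>
    mem_of_tendsto_infDist hF hFne hlim (squeeze_zero (fun _ => Metric.infDist_nonneg)
      (fun k => infDist_film_le hl hL (hm k) z hy hyz) (tendsto_infDist_of_mem hlim hz))
  -- F is stable under lowering and contains the base at height 0, so each vertical section is an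
  -- interval starting at -L. The limit height is its top.
  set sec : ℝ → Set ℝ := fun x => {y | (!₂[x, y] : Plane) ∈ F}
  have hseccl : ∀ x, IsClosed (sec x) := fun x =>
    hF.preimage (f := fun y : ℝ => (!₂[x, y] : Plane)) (by fun_prop)
  have hsecb : ∀ x, BddAbove (sec x) := fun x =>
    ⟨L, fun y hy => by simpa using (hbox hy).2.2⟩
  set g : ℝ → ℝ := fun x => sSup (sec x)
  have hg0 : ∀ x ∈ Icc (-l) l, 0 ≤ g x := fun x hx => le_csSup (hsecb x) (hbase x hx)
  have hgmem : ∀ x ∈ Icc (-l) l, (!₂[x, g x] : Plane) ∈ F := fun x hx =>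
    (hseccl x).csSup_mem ⟨0, hbase x hx⟩ (hsecb x)
  have hmemF : ∀ z : Plane, z ∈ F ↔ z 0 ∈ Icc (-l) l ∧ -L ≤ z 1 ∧ z 1 ≤ g (z 0) := by
    intro z
    have hz : (!₂[z 0, z 1] : Plane) = z := by
      ext i
      fin_cases i <;> simp
    constructor
    · intro hzF
      refine ⟨(hbox hzF).1, (hbox hzF).2.1, le_csSup (hsecb _) ?_⟩
      simp only [sec, mem_ofPred_eq, hz, hzF]
    · rintro ⟨h1, h2, h3⟩
      have := hdown _ (hgmem _ h1) (z 1) h2 (by simpa using h3)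
      simpa [hz] using this
  refine ⟨g, fun x hx => ⟨hg0 x hx, by simpa using (hbox (hgmem x hx)).2.2⟩, ?_, ?_⟩
  · rw [upperSemicontinuousOn_iff_isClosed_hypograph isClosed_Icc]
    -- The hypograph is unbounded below while F is not; raising points below -L to that level turns
    -- it into a continuous preimage of F.
    have hset : {p : ℝ × ℝ | p.1 ∈ Icc (-l) l ∧ p.2 ≤ g p.1} =
        (fun p : ℝ × ℝ => (!₂[p.1, max (-L) p.2] : Plane)) ⁻¹' F := by
      ext p
      rw [mem_preimage, hmemF]
      simp only [mem_ofPred_eq, Matrix.cons_val_zero, Matrix.cons_val_one,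
        le_max_left, true_and]
      refine and_congr_right fun hp => ?_
      have := hg0 _ hp
      rw [max_le_iff]
      exact ⟨fun h => ⟨by linarith, h⟩, fun h => h.2⟩
    rw [hset]
    exact hF.preimage (by fun_prop)
  · ext z
    rw [mem_film hl, hmemF]

/-- Compactness of layers with boundaries of bounded length and boundedly many components. -/
theorem exists_layer_limit {l L : ℝ} (hl : 0 < l) (hL : 0 < L) {m : ℕ} {M : ℝ≥0∞} (hM : M < ⊤)
    (h : ℕ → ℝ → ℝ) (K : ℕ → Set Plane) (hadm : ∀ k, IsAdmissiblePair l L (h k) (K k))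
    (hcard : ∀ k, ENat.card (ConnectedComponents (frontier (region l L (h k) (K k)))) ≤ m)
    (hlen : ∀ k, H1 (frontier (region l L (h k) (K k))) ≤ M) :
    ∃ n : ℕ → ℕ, StrictMono n ∧ ∃ (g : ℝ → ℝ) (K' : Set Plane), IsAdmissiblePair l L g K' ∧
      ENat.card (ConnectedComponents (frontier (region l L g K'))) ≤ m ∧
      TendstoUniformly (fun k => sdist (region l L (h (n k)) (K (n k))))
        (sdist (region l L g K')) atTop := by
  set E : ℕ → Set Plane := fun k => region l L (h k) (K k) with hE
  have hEne : ∀ k, (E k).Nonempty := fun k => (hadm k).region_nonempty hl hL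
  have hEne' : ∀ k, (E k)ᶜ.Nonempty := fun k => region_compl_nonempty l L _ _
  have hEcl : ∀ k, closure (E k) = film l L (h k) := fun k => (hadm k).closure_region hl hL
  have hmaps : ∀ k, MapsTo (h k) (Icc (-l) l) (Icc 0 L) := fun k => (hadm k).height.mapsTo
  have hQ := isCompact_box l L
  have hFc : ∀ k, IsCompact (film l L (h k)) := fun k =>
    hQ.of_isClosed_subset (isClosed_film (hadm k).height.usc) (film_subset_box hl (hmaps k))
  have hΓF : ∀ k, frontier (E k) ⊆ film l L (h k) := fun k =>
    frontier_subset_closure.trans (hEcl k).subset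
  have hΓc : ∀ k, IsCompact (frontier (E k)) := fun k =>
    (hFc k).of_isClosed_subset isClosed_frontier (hΓF k)
  have hΓne : ∀ k, (frontier (E k)).Nonempty := fun k =>
    nonempty_frontier_iff.2 ⟨hEne k, nonempty_compl.1 (hEne' k)⟩
  have hFne : ∀ k, (film l L (h k)).Nonempty := fun k => (hΓne k).mono (hΓF k)
  choose C hCc hCne hCconn hCU using fun k => exists_connected_cover (hΓc k) (hΓne k) (hcard k)
  have hCΓ : ∀ k j, C k j ⊆ frontier (E k) := fun k j => (hCU k) ▸ subset_iUnion (C k) j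
  -- The films, the boundaries and the connected pieces are indexed together so that a single
  -- extraction handles all of them.
  set S : ℕ → Option (Option (Fin m)) → Set Plane := fun k i =>
    match i with
    | none => film l L (h k)
    | some none => frontier (E k)
    | some (some j) => C k j
  obtain ⟨n, hn, T, hTc, hTne, hTlim⟩ := exists_subseq_tendsto_infDist hQ S
    (fun k i => match i with
      | none => hFc k
      | some none => hΓc k
      | some (some j) => hCc k j)
    (fun k i => match i with
      | none => hFne k
      | some none => hΓne k
      | some (some j) => hCne k j)
    (fun k i => match i with
      | none => film_subset_box hl (hmaps k)
      | some none => (hΓF k).trans (film_subset_box hl (hmaps k))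
      | some (some j) => (hCΓ k j).trans ((hΓF k).trans (film_subset_box hl (hmaps k))))
  set F := T none
  set Γ := T (some none)
  set D : Fin m → Set Plane := fun j => T (some (some j))
  have hFlim : TendstoUniformly (fun k x => Metric.infDist x (film l L (h (n k))))
    (fun x => Metric.infDist x F) atTop := hTlim none
  have hΓlim : TendstoUniformly (fun k x => Metric.infDist x (frontier (E (n k))))
    (fun x => Metric.infDist x Γ) atTop := hTlim (some none)
  have hDlim : ∀ j, TendstoUniformly (fun k x => Metric.infDist x (C (n k) j))
    (fun x => Metric.infDist x (D j)) atTop := fun j => hTlim (some (some j))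
  have hFcl : IsClosed F := (hTc none).isClosed
  have hΓcl : IsClosed Γ := (hTc (some none)).isClosed
  have hDcl : ∀ j, IsClosed (D j) := fun j => (hTc (some (some j))).isClosed
  have hDΓ : ⋃ j, D j = Γ := by
    refine Subset.antisymm (iUnion_subset fun j => ?_) fun z hz => ?_
    · exact subset_of_tendsto_infDist hΓcl (hTne _) (fun k => hCne (n k) j) (hDlim j) hΓlim
        fun k => hCΓ (n k) j
    · by_contra hcon
      have hpos : ∀ j, 0 < Metric.infDist z (D j) := fun j =>
        ((hDcl j).notMem_iff_infDist_pos (hTne _)).1 fun hzj => hcon (mem_iUnion.2 ⟨j, hzj⟩)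
      obtain ⟨ε, hε, hεj⟩ : ∃ ε > 0, ∀ j, ε < Metric.infDist z (D j) := by
        have hev : ∀ᶠ ε in 𝓝[>] (0 : ℝ), ∀ j, ε < Metric.infDist z (D j) :=
          eventually_all.2 fun j => nhdsWithin_le_nhds (gt_mem_nhds (hpos j))
        obtain ⟨ε, h1, h2⟩ := (hev.and self_mem_nhdsWithin).exists
        exact ⟨ε, h2, h1⟩
      have hev : ∀ᶠ k in atTop, ∀ j, ε < Metric.infDist z (C (n k) j) :=
        eventually_all.2 fun j => ((hDlim j).tendsto_at z).eventually (lt_mem_nhds (hεj j))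
      have hev2 := (tendsto_infDist_of_mem hΓlim hz).eventually (gt_mem_nhds hε)
      obtain ⟨k, hk1, hk2⟩ := (hev.and hev2).exists
      obtain ⟨w, hw, hzw⟩ := (Metric.infDist_lt_iff (hΓne (n k))).1 hk2
      rw [← hCU (n k)] at hw
      obtain ⟨j, hj⟩ := mem_iUnion.1 hw
      exact absurd ((Metric.infDist_le_dist_of_mem hj).trans_lt hzw) (not_lt.2 (hk1 j).le)
  have hDconn : ∀ j, IsPreconnected (D j) := fun j =>
    isPreconnected_of_tendsto_infDist (hTc _) (hTne _) (fun k => hCconn (n k) j)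
      (fun k => hCne (n k) j) (hDlim j)
  have hDfin : ∀ j, H1 (D j) < ⊤ := by
    intro j
    refine (H1_le_of_connected_approx (fun k => hCconn (n k) j)
      (fun k => (measure_mono (hCΓ (n k) j)).trans (hlen (n k))) fun z hz ε hε => ?_).trans_lt
      (ENNReal.mul_lt_top (by simp) hM)
    filter_upwards [(tendsto_infDist_of_mem (hDlim j) hz).eventually (gt_mem_nhds hε)] with k hk
    obtain ⟨w, hw, hwz⟩ := (Metric.infDist_lt_iff (hCne (n k) j)).1 hk
    exact ⟨w, hw, by rwa [dist_comm]⟩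
  have hΓFlim : Γ ⊆ F := subset_of_tendsto_infDist hFcl (hTne _) (fun k => hΓne (n k)) hΓlim hFlim
    fun k => hΓF (n k)
  -- A point off F is off the regions for large k, and there the distances to a region and to its
  -- frontier agree.
  have hout : ∀ z, z ∉ F → Metric.infDist z Γ = Metric.infDist z F := by
    intro z hz
    have hpos := (hFcl.notMem_iff_infDist_pos (hTne _)).1 hz
    have hev := (hFlim.tendsto_at z).eventually (lt_mem_nhds hpos)
    refine tendsto_nhds_unique (hΓlim.tendsto_at z) ((hFlim.tendsto_at z).congr' ?_)
    filter_upwards [hev] with k hk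
    have hzE : z ∉ E (n k) := fun hzE => by
      have : z ∈ film l L (h (n k)) := (hEcl (n k)) ▸ subset_closure hzE
      rw [Metric.infDist_zero_of_mem this] at hk
      exact lt_irrefl _ hk
    rw [infDist_frontier_of_notMem hzE (hEne _), ← hEcl, Metric.infDist_closure]
  -- A frontier point is approached by points off F, whose distance to Γ equals their distance to F
  -- and so tends to 0.
  have hfrF : frontier F ⊆ Γ := by
    intro x hx
    rw [hΓcl.mem_iff_infDist_zero (hTne _)]
    refine le_antisymm (le_of_forall_pos_le_add fun ε hε => ?_) Metric.infDist_nonneg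
    have hxF : x ∈ F := hFcl.frontier_subset hx
    have hxc : x ∈ closure Fᶜ := frontier_compl F ▸ hx |>.1
    obtain ⟨z, hz, hxz⟩ := Metric.mem_closure_iff.1 hxc (ε / 2) (by positivity)
    have h1 := Metric.infDist_le_infDist_add_dist (s := Γ) (x := x) (y := z)
    have h2 := Metric.infDist_le_dist_of_mem (x := z) hxF
    rw [hout z hz] at h1
    rw [dist_comm z x] at h2
    linarith
  have hΓfin : H1 Γ < ⊤ := by
    rw [← hDΓ]
    refine (measure_iUnion_le _).trans_lt ?_
    rw [tsum_fintype]
    exact ENNReal.sum_lt_top.2 fun j _ => hDfin j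
  obtain ⟨g, hgm, hgu, hgF⟩ := exists_film_limit hl hL (fun k => hmaps (n k)) hFcl (hTne _) hFlim
  have hgadm : IsAdmissibleHeight l L g := ⟨hgm, hgu, boundedVariationOn_of_H1_frontier hl hL hgm
    ((measure_mono (hgF ▸ hfrF)).trans_lt hΓfin)⟩
  -- This is the largest part of Γ allowed as a crack. It contains all points of Γ interior to F;
  -- the other points of Γ are in the frontier of F, so no boundary is lost.
  set K' : Set Plane := Γ ∩ closure (interior (subgraph l g)) with hK'
  have hK'cl : IsClosed K' := hΓcl.inter isClosed_closure
  have hK'rect : IsH1Rectifiable K' := isH1Rectifiable_of_subset_iUnion hDconn hDcl hDfin hK'cl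
    (hDΓ ▸ inter_subset_left)
  have hK'Ω : K' ⊆ closure (Omega l L) := fun z hz => by
    have : z ∈ film l L g := hgF ▸ hΓFlim hz.1
    exact this.2
  have hpair : IsAdmissiblePair l L g K' := ⟨hgadm, ⟨hK'Ω, hK'cl, hK'rect⟩, inter_subset_right⟩
  have hcl' : closure (region l L g K') = F := (hpair.closure_region hl hL).trans hgF
  have hfr' : frontier (region l L g K') = Γ := by
    rw [frontier_region hl hL hgadm inter_subset_right hK'Ω hK'cl hK'rect.1, hgF]
    refine Subset.antisymm (union_subset hfrF inter_subset_left) fun z hz => ?_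
    by_cases hzi : z ∈ interior F
    · refine Or.inr ⟨hz, subset_closure (interior_mono ?_ hzi)⟩
      rw [← hgF]
      exact inter_subset_left
    · exact Or.inl ⟨subset_closure (hΓFlim hz), hzi⟩
  refine ⟨n, hn, g, K', hpair, ?_, ?_⟩
  · rw [hfr']
    exact card_connectedComponents_le (fun j => hTne _) hDconn hDΓ
  · rw [Metric.tendstoUniformly_iff]
    intro ε hε
    filter_upwards [Metric.tendstoUniformly_iff.1 hFlim (ε / 4) (by positivity),
      Metric.tendstoUniformly_iff.1 hΓlim (ε / 4) (by positivity)] with k hk1 hk2 x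
    rw [sdist_eq (hpair.region_nonempty hl hL) (region_compl_nonempty l L _ _),
      sdist_eq (hEne _) (hEne' _), hcl', hfr', hEcl]
    have h1 := abs_lt.1 (Real.dist_eq _ _ ▸ hk1 x)
    have h2 := abs_lt.1 (Real.dist_eq _ _ ▸ hk2 x)
    rw [Real.dist_eq, abs_lt]
    constructor <;> linarith [h1.1, h1.2, h2.1, h2.2]

/-! ### Sets of finite perimeter -/

/-- Bounded sequences of measures on a compact set converge weakly along an ultrafilter. -/
theorem exists_weak_limit {K : Set Plane} (hK : IsCompact K) {C : NNReal} (μ : ℕ → Measure Plane)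
    (hmass : ∀ n, μ n univ ≤ C) (hsupp : ∀ n, μ n Kᶜ = 0) :
    ∃ ν : Measure Plane, IsFiniteMeasure ν ∧ ∀ f : Plane → ℝ, Continuous f → HasCompactSupport f →
      Tendsto (fun n => ∫ x, f x ∂μ n) (hyperfilter ℕ) (𝓝 (∫ x, f x ∂ν)) := by
  have hfin : ∀ n, IsFiniteMeasure (μ n) := fun n => ⟨(hmass n).trans_lt ENNReal.coe_lt_top⟩
  set X : ℕ → FiniteMeasure Plane := fun n => ⟨μ n, hfin n⟩
  have hc := isCompact_setOfPred_finiteMeasure_le_of_isCompact C hK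
  have hmem : ∀ n, X n ∈ {ν : FiniteMeasure Plane | ν.mass ≤ C ∧ ν Kᶜ = 0} := fun n => by
    refine ⟨?_, ?_⟩
    · have : ((X n).mass : ℝ≥0∞) ≤ C := by
        rw [FiniteMeasure.ennreal_mass]
        exact hmass n
      exact_mod_cast this
    · have : ((X n Kᶜ : NNReal) : ℝ≥0∞) = 0 := by
        rw [FiniteMeasure.ennreal_coeFn_eq_coeFn_toMeasure]
        exact hsupp n
      exact_mod_cast this
  -- A fixed ultrafilter instead of a subsequence lets the limits of several sequences be taken
  -- simultaneously.
  obtain ⟨ν, -, hν⟩ := hc.ultrafilter_le_nhds' ((hyperfilter ℕ).map X)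
    (Filter.Eventually.of_forall hmem : ∀ᶠ n in (hyperfilter ℕ : Filter ℕ), _)
  refine ⟨ν, inferInstance, fun f hf hfc => ?_⟩
  obtain ⟨B, hB⟩ := hfc.exists_bound_of_continuous hf
  have := FiniteMeasure.tendsto_iff_forall_integral_tendsto.1
    (show Tendsto X (hyperfilter ℕ) (𝓝 ν) from hν) (BoundedContinuousFunction.ofNormedAddCommGroup f hf B hB)
  exact this

/-- If the translates of a bounded set in a direction differ from the set by a set of area
proportional to the displacement, the distributional derivative in this direction is a measure. -/
theorem exists_directional_derivative {E : Set Plane} (hE : MeasurableSet E)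
    (hb : Bornology.IsBounded E) (e : Plane) {C : ℝ}
    (hT : ∀ δ ∈ Ioc (0 : ℝ) 1, volume ({x | x - δ • e ∈ E} \ E) ≤ ENNReal.ofReal (C * δ) ∧
      volume (E \ {x | x - δ • e ∈ E}) ≤ ENNReal.ofReal (C * δ)) :
    ∃ μ ν : Measure Plane, IsFiniteMeasure μ ∧ IsFiniteMeasure ν ∧
      ∀ f : Plane → ℝ, ContDiff ℝ ∞ f → HasCompactSupport f →
        ∫ x in E, fderiv ℝ f x e = ∫ x, f x ∂μ - ∫ x, f x ∂ν := by
  set δ : ℕ → ℝ := fun n => 1 / ((n : ℝ) + 1) with hδ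
  have hδ0 : ∀ n, 0 < δ n := fun n => by positivity
  have hδ1 : ∀ n, δ n ≤ 1 := fun n => by
    rw [hδ]
    exact div_le_one_of_le₀ (by linarith [n.cast_nonneg (α := ℝ)]) (by positivity)
  have hδlim : Tendsto δ atTop (𝓝 0) := tendsto_one_div_add_atTop_nhds_zero_nat
  obtain ⟨R, hR⟩ := hb.subset_closedBall (0 : Plane)
  have hEfin : volume E ≠ ⊤ := hb.measure_lt_top.ne
  set T : ℕ → Set Plane := fun n => {x | x - δ n • e ∈ E}
  have hTm : ∀ n, MeasurableSet (T n) := fun n => hE.preimage (by fun_prop)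
  have hTb : ∀ n, T n ⊆ Metric.closedBall 0 (R + ‖e‖) := fun n x hx => by
    have h1 := hR hx
    rw [mem_closedBall_zero_iff] at h1 ⊢
    have h2 : ‖δ n • e‖ ≤ ‖e‖ := by
      rw [norm_smul, Real.norm_of_nonneg (hδ0 n).le]
      exact mul_le_of_le_one_left (norm_nonneg _) (hδ1 n)
    calc ‖x‖ = ‖(x - δ n • e) + δ n • e‖ := by rw [sub_add_cancel]
      _ ≤ _ := (norm_add_le _ _).trans (add_le_add h1 h2)
  have hEb : E ⊆ Metric.closedBall 0 (R + ‖e‖) :=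
    hR.trans (Metric.closedBall_subset_closedBall (by linarith [norm_nonneg e]))
  have limit : ∀ A : ℕ → Set Plane, (∀ n, MeasurableSet (A n)) →
      (∀ n, A n ⊆ Metric.closedBall 0 (R + ‖e‖)) →
      (∀ n, volume (A n) ≤ ENNReal.ofReal (C * δ n)) →
      ∃ ν : Measure Plane, IsFiniteMeasure ν ∧ ∀ f : Plane → ℝ, Continuous f → HasCompactSupport f →
        Tendsto (fun n => (δ n)⁻¹ * ∫ x in A n, f x) (hyperfilter ℕ) (𝓝 (∫ x, f x ∂ν)) := by
    intro A hA hAb hAv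
    obtain ⟨ν, hν, hlim⟩ := exists_weak_limit (isCompact_closedBall (0 : Plane) (R + ‖e‖))
      (C := C.toNNReal) (fun n => ENNReal.ofReal (δ n)⁻¹ • volume.restrict (A n)) (fun n => by
        rw [Measure.smul_apply, Measure.restrict_apply_univ, smul_eq_mul]
        calc ENNReal.ofReal (δ n)⁻¹ * volume (A n)
            ≤ ENNReal.ofReal (δ n)⁻¹ * ENNReal.ofReal (C * δ n) := by gcongr; exact hAv n
          _ = ENNReal.ofReal C := by
            rw [← ENNReal.ofReal_mul (inv_nonneg.2 (hδ0 n).le)]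
            congr 1
            field_simp [(hδ0 n).ne']
          _ = C.toNNReal := rfl) (fun n => by
        rw [Measure.smul_apply, Measure.restrict_apply' (hA n), smul_eq_mul,
          show (Metric.closedBall (0 : Plane) (R + ‖e‖))ᶜ ∩ A n = ∅ from ?_, measure_empty, mul_zero]
        exact eq_empty_of_forall_notMem fun x hx => hx.1 (hAb n hx.2))
    refine ⟨ν, hν, fun f hf hfc => ?_⟩
    refine (hlim f hf hfc).congr fun n => ?_
    rw [integral_smul_measure, ENNReal.toReal_ofReal (inv_nonneg.2 (hδ0 n).le), smul_eq_mul]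
  -- The difference quotient of the indicator function has positive part supported on `T n \ E` and
  -- negative part on `E \ T n`; divided by the step, each has mass at most C.
  obtain ⟨μ, hμ, hμlim⟩ := limit (fun n => T n \ E) (fun n => (hTm n).diff hE)
    (fun n => sdiff_subset.trans (hTb n)) fun n => (hT _ ⟨hδ0 n, hδ1 n⟩).1
  obtain ⟨ν, hν, hνlim⟩ := limit (fun n => E \ T n) (fun n => hE.diff (hTm n))
    (fun n => sdiff_subset.trans hEb) fun n => (hT _ ⟨hδ0 n, hδ1 n⟩).2
  refine ⟨μ, ν, hμ, hν, fun f hf hfc => ?_⟩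
  have hcont := hf.continuous
  have hInt : Integrable f volume := hcont.integrable_of_hasCompactSupport hfc
  have hlim := (hμlim f hcont hfc).sub (hνlim f hcont hfc)
  refine tendsto_nhds_unique ?_ hlim
  have hat : (hyperfilter ℕ : Filter ℕ) ≤ atTop := Nat.cofinite_eq_atTop ▸ hyperfilter_le_cofinite
  refine Tendsto.mono_left ?_ hat
  have hquot : ∀ n, ((δ n)⁻¹ * ∫ x in T n \ E, f x) - (δ n)⁻¹ * ∫ x in E \ T n, f x =
      ∫ x in E, (δ n)⁻¹ * (f (x + δ n • e) - f x) := by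
    intro n
    have h1 := integral_inter_add_sdiff (μ := volume) (f := f) (s := T n) hE hInt.integrableOn
    have h2 := integral_inter_add_sdiff (μ := volume) (f := f) (s := E) (hTm n) hInt.integrableOn
    have h3 : ∫ x in E, f (x + δ n • e) = ∫ x in T n, f x := by
      have := (measurePreserving_add_right (volume : Measure Plane) (δ n • e)).setIntegral_preimage_emb
        (measurableEmbedding_addRight (δ n • e)) f (T n)
      rw [← this]
      congr 1
      ext x
      simp [T]
    have hInt2 : Integrable (fun x => f (x + δ n • e)) volume := hInt.comp_add_right _
    rw [integral_const_mul, integral_sub hInt2.integrableOn hInt.integrableOn, h3, ← h1, ← h2,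
      inter_comm E (T n)]
    ring
  have : Tendsto (fun n => ∫ x in E, (δ n)⁻¹ * (f (x + δ n • e) - f x)) atTop
      (𝓝 (∫ x in E, fderiv ℝ f x e)) := by
    obtain ⟨B, hB⟩ := ContDiff.lipschitzWith_of_hasCompactSupport hfc hf (by simp)
    refine tendsto_integral_of_dominated_convergence (fun _ => B * ‖e‖) (fun n => ?_) ?_ (fun n => ?_)
      ?_
    · exact (by fun_prop : Continuous fun x => (δ n)⁻¹ * (f (x + δ n • e) - f x)).aestronglyMeasurable
    · have : IsFiniteMeasure ((volume : Measure Plane).restrict E) := ⟨by simpa using hEfin.lt_top⟩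
      exact integrable_const _
    · refine Eventually.of_forall fun x => ?_
      rw [norm_mul, Real.norm_of_nonneg (inv_nonneg.2 (hδ0 n).le)]
      have h1 := hB.dist_le_mul (x + δ n • e) x
      rw [dist_eq_norm, dist_eq_norm, add_sub_cancel_left, norm_smul,
        Real.norm_of_nonneg (hδ0 n).le] at h1
      rw [inv_mul_le_iff₀ (hδ0 n)]
      linarith
    · refine Eventually.of_forall fun x => ?_
      have hd : HasFDerivAt f (fderiv ℝ f x) x := (hf.differentiable (by simp) x).hasFDerivAt
      have h1 := hd.hasLineDerivAt e
      have h2 := hasLineDerivAt_iff_tendsto_slope_zero.1 h1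
      refine (h2.comp (tendsto_nhdsWithin_iff.2 ⟨hδlim, Eventually.of_forall fun n =>
        (hδ0 n).ne'⟩)).congr fun n => ?_
      simp
  exact this.congr fun n => (hquot n).symm

theorem fderiv_coord {X : Plane → Plane} {x : Plane} (hX : DifferentiableAt ℝ X x) (v : Plane)
    (i : Fin 2) : (fderiv ℝ X x v) i = fderiv ℝ (fun y => X y i) x v := by
  have h := ((EuclideanSpace.proj (𝕜 := ℝ) i : Plane →L[ℝ] ℝ).hasFDerivAt).comp x hX.hasFDerivAt
  have h2 : HasFDerivAt (fun y => X y i) ((EuclideanSpace.proj (𝕜 := ℝ) i).comp (fderiv ℝ X x)) x := h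
  rw [h2.fderiv]
  rfl

/-- A bounded set with linearly controlled translates has finite perimeter. -/
theorem exists_isPolarOfDeriv {E : Set Plane} (hE : MeasurableSet E)
    (hb : Bornology.IsBounded E) {C : ℝ}
    (hT : ∀ (i : Fin 2), ∀ δ ∈ Ioc (0 : ℝ) 1,
      volume ({x : Plane | x - δ • EuclideanSpace.single i (1 : ℝ) ∈ E} \ E) ≤ ENNReal.ofReal (C * δ) ∧
      volume (E \ {x : Plane | x - δ • EuclideanSpace.single i (1 : ℝ) ∈ E}) ≤
        ENNReal.ofReal (C * δ)) :
    ∃ (P : Measure Plane) (σ : Plane → Plane), IsPolarOfDeriv E P σ := by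
  choose μ ν hμ hν hder using fun i => exists_directional_derivative hE hb _ (hT i)
  -- The positive and negative parts need not be mutually singular. M dominates all of them, and
  -- with G the vector density of the signed parts relative to M, the measure |G| M and the
  -- direction G/|G| give the polar decomposition.
  set M : Measure Plane := ∑ i, (μ i + ν i) with hM
  have hMfin : IsFiniteMeasure M := by rw [hM]; infer_instance
  have hleM : ∀ i, μ i + ν i ≤ M := fun i => by
    rw [hM]
    exact Finset.single_le_sum (f := fun i => μ i + ν i) (fun _ _ => Measure.zero_le _)
      (Finset.mem_univ i)
  have hμM : ∀ i, μ i ≪ M := fun i =>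
    ((Measure.le_add_right le_rfl).trans (hleM i)).absolutelyContinuous
  have hνM : ∀ i, ν i ≪ M := fun i =>
    ((Measure.le_add_left le_rfl).trans (hleM i)).absolutelyContinuous
  set a : Fin 2 → Plane → ℝ := fun i x => ((μ i).rnDeriv M x).toReal
  set b : Fin 2 → Plane → ℝ := fun i x => ((ν i).rnDeriv M x).toReal
  have ham : ∀ i, Measurable (a i) := fun i => (Measure.measurable_rnDeriv _ _).ennreal_toReal
  have hbm : ∀ i, Measurable (b i) := fun i => (Measure.measurable_rnDeriv _ _).ennreal_toReal
  have hai : ∀ i, Integrable (a i) M := fun i => Measure.integrable_toReal_rnDeriv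
  have hbi : ∀ i, Integrable (b i) M := fun i => Measure.integrable_toReal_rnDeriv
  set G : Plane → Plane := fun x => WithLp.toLp 2 fun i => a i x - b i x
  have hGm : Measurable G :=
    (WithLp.measurable_toLp 2 _).comp (measurable_pi_lambda _ fun i => (ham i).sub (hbm i))
  have hGi : Integrable G M := by
    have hbound : ∀ x, ‖G x‖ ≤ ‖∑ i, (|a i x| + |b i x|)‖ := fun x => by
      rw [Real.norm_of_nonneg (Finset.sum_nonneg fun i _ => by positivity)]
      rw [EuclideanSpace.norm_eq]
      refine Real.sqrt_le_iff.2 ⟨Finset.sum_nonneg fun i _ => by positivity, ?_⟩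
      have h0 : |G x 0| ≤ |a 0 x| + |b 0 x| := abs_sub _ _
      have h1 : |G x 1| ≤ |a 1 x| + |b 1 x| := abs_sub _ _
      simp only [Fin.sum_univ_two, Real.norm_eq_abs]
      nlinarith [abs_nonneg (G x 0), abs_nonneg (G x 1)]
    refine Integrable.mono (integrable_finsetSum _ fun i _ => (hai i).abs.add (hbi i).abs)
      hGm.aestronglyMeasurable (Eventually.of_forall hbound)
  have hden : Measurable fun x => ‖G x‖ₑ := hGm.enorm
  refine ⟨M.withDensity fun x => ‖G x‖ₑ, fun x => ‖G x‖⁻¹ • G x, ?_, ?_, ?_, ?_⟩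
  · exact isFiniteMeasure_withDensity hGi.2.ne
  · exact hGm.norm.inv.smul hGm
  · rw [ae_withDensity_iff hden]
    refine Eventually.of_forall fun x hx => ?_
    have hx' : ‖G x‖ ≠ 0 := by simpa using hx
    rw [norm_smul, norm_inv, norm_norm, inv_mul_cancel₀ hx']
  · intro X hX hXc
    have hXi : ∀ i, ContDiff ℝ ∞ fun x => X x i := fun i =>
      (EuclideanSpace.proj (𝕜 := ℝ) i : Plane →L[ℝ] ℝ).contDiff.comp hX
    have hXic : ∀ i, HasCompactSupport fun x => X x i := fun i =>
      hXc.comp_left (g := fun p : Plane => p i) rfl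
    have hdiv : ∀ x, divergence X x =
        ∑ i : Fin 2, fderiv ℝ (fun y => X y i) x (EuclideanSpace.single i 1) := fun x =>
      Finset.sum_congr rfl fun i _ => fderiv_coord (hX.differentiable (by simp) x) _ i
    have hcontd : ∀ i : Fin 2,
        Continuous fun x => fderiv ℝ (fun y => X y i) x (EuclideanSpace.single i 1) := fun i =>
      ((hXi i).continuous_fderiv (by simp)).clm_apply continuous_const
    have hEint : ∀ i : Fin 2, IntegrableOn
        (fun x => fderiv ℝ (fun y => X y i) x (EuclideanSpace.single i 1)) E := fun i => by
      obtain ⟨R, hR⟩ := hb.subset_closedBall (0 : Plane)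
      exact ((hcontd i).continuousOn.integrableOn_compact (isCompact_closedBall 0 R)).mono_set hR
    have hLHS : ∫ x in E, divergence X x = ∑ i, (∫ x, X x i ∂μ i - ∫ x, X x i ∂ν i) := by
      simp_rw [hdiv]
      rw [integral_finsetSum _ fun i _ => hEint i]
      exact Finset.sum_congr rfl fun i _ => hder i _ (hXi i) (hXic i)
    have hprod : ∀ (i : Fin 2) (g : Plane → ℝ), Integrable g M →
        Integrable (fun x => g x * X x i) M := fun i g hg => by
      obtain ⟨B, hB⟩ := (hXic i).exists_bound_of_continuous (hXi i).continuous
      exact hg.mul_bdd (c := B) (hXi i).continuous.aestronglyMeasurable (Eventually.of_forall hB)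
    rw [hLHS, integral_withDensity_eq_integral_toReal_smul hden
      (Eventually.of_forall fun x => enorm_lt_top)]
    have hpt : ∀ x, (‖G x‖ₑ).toReal • inner ℝ (X x) (‖G x‖⁻¹ • G x) =
        ∑ i, (a i x * X x i - b i x * X x i) := by
      intro x
      rw [toReal_enorm, inner_smul_right, smul_eq_mul]
      have h1 : inner ℝ (X x) (G x) = ∑ i, (a i x * X x i - b i x * X x i) := by
        rw [PiLp.inner_apply]
        refine Finset.sum_congr rfl fun i _ => ?_
        rw [← sub_mul]
        rfl
      by_cases h0 : ‖G x‖ = 0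
      · rw [← h1, norm_eq_zero.1 h0]
        simp
      · rw [mul_inv_cancel_left₀ h0, h1]
    simp_rw [hpt]
    have hterm : ∀ i ∈ Finset.univ,
        Integrable (fun x => a i x * X x i - b i x * X x i) M :=
      fun i _ => (hprod i _ (hai i)).sub (hprod i _ (hbi i))
    rw [integral_finsetSum _ hterm]
    refine Finset.sum_congr rfl fun i _ => ?_
    have := hμ i
    have := hν i
    have hMs : SigmaFinite M := inferInstance

    have h1 : ∫ x, a i x * X x i ∂M = ∫ x, X x i ∂μ i := integral_rnDeriv_smul (hμM i)
    have h2 : ∫ x, b i x * X x i ∂M = ∫ x, X x i ∂ν i := integral_rnDeriv_smul (hνM i)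
    rw [integral_sub (hprod i _ (hai i)) (hprod i _ (hbi i)), h1, h2]

/-- The perimeter measure is concentrated on the reduced boundary. -/
theorem ae_mem_reducedBoundary {E : Set Plane} {P : Measure Plane} {σ : Plane → Plane}
    (h : IsPolarOfDeriv E P σ) : ∀ᵐ x ∂P, x ∈ reducedBoundary E := by
  have := h.finite
  have hInt : Integrable σ P := by
    refine Integrable.of_bound h.measurable.aestronglyMeasurable 1 ?_
    filter_upwards [h.norm_eq_one] with x hx using hx.le
  filter_upwards [h.norm_eq_one,
    (Besicovitch.vitaliFamily P).ae_tendsto_average hInt.locallyIntegrable,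
    (Besicovitch.vitaliFamily P).ae_eventually_measure_pos] with x hx1 hx2 hx3
  have hx2 := hx2.comp (Besicovitch.tendsto_filterAt P x)
  have hx3 := (Besicovitch.tendsto_filterAt P x).eventually hx3
  have hpos : ∀ r : ℝ, 0 < r → 0 < P (Metric.ball x r) := by
    intro r hr
    obtain ⟨s, hs1, hs2⟩ := (hx3.and (Ioo_mem_nhdsGT hr)).exists
    exact hs1.trans_le (measure_mono (Metric.closedBall_subset_ball hs2.2))
  refine ⟨σ x, hx1, P, σ, h, hpos, ?_⟩
  rw [Metric.tendsto_nhds]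
  intro ε hε
  have hev := (Metric.tendsto_nhds.1 hx2) (ε / 2) (by positivity)
  obtain ⟨r₀, hr₀, hsub⟩ := mem_nhdsGT_iff_exists_Ioo_subset.1 hev
  filter_upwards [Ioo_mem_nhdsGT hr₀] with r hr
  refine lt_of_le_of_lt ?_ (half_lt_self hε)
  -- Besicovitch differentiation controls averages on closed balls, while the outer normal is
  -- defined with open ones. An open ball is exhausted by closed balls of smaller radii, all within
  -- the controlled range.
  set s : ℕ → ℝ := fun n => r - r / ((n : ℝ) + 2) with hs
  have hs0 : ∀ n, 0 < s n := fun n => by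
    have : r / ((n : ℝ) + 2) < r := div_lt_self hr.1 (by linarith [n.cast_nonneg (α := ℝ)])
    simp only [hs]; linarith
  have hsr : ∀ n, s n < r := fun n => by
    have : 0 < r / ((n : ℝ) + 2) := div_pos hr.1 (by positivity)
    simp only [hs]; linarith
  have hsmono : Monotone s := fun n m hnm => by
    have hnm : (n : ℝ) ≤ m := by exact_mod_cast hnm
    simp only [hs]
    have := hr.1
    gcongr
  have hslim : Tendsto s atTop (𝓝 r) := by
    have h1 : Tendsto (fun n : ℕ => (n : ℝ) + 2) atTop atTop :=
      tendsto_natCast_atTop_atTop.atTop_add tendsto_const_nhds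
    have := (tendsto_const_nhds (x := r)).sub (h1.const_div_atTop r)
    simpa using this
  have hU : ⋃ n, Metric.closedBall x (s n) = Metric.ball x r := by
    refine Subset.antisymm (iUnion_subset fun n => Metric.closedBall_subset_ball (hsr n)) ?_
    intro y hy
    obtain ⟨n, hn⟩ := (hslim.eventually (lt_mem_nhds (Metric.mem_ball.1 hy))).exists
    exact mem_iUnion.2 ⟨n, hn.le⟩
  have hmono : Monotone fun n => Metric.closedBall x (s n) := fun n m hnm =>
    Metric.closedBall_subset_closedBall (hsmono hnm)
  have h1 := tendsto_setIntegral_of_monotone (μ := P) (f := σ)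
    (fun n => Metric.isClosed_closedBall.measurableSet) hmono hInt.integrableOn
  have h2 := tendsto_measure_iUnion_atTop (μ := P) hmono
  rw [hU] at h1 h2
  have h3 : Tendsto (fun n => ⨍ y in Metric.closedBall x (s n), σ y ∂P) atTop
      (𝓝 (⨍ y in Metric.ball x r, σ y ∂P)) := by
    simp_rw [setAverage_eq]
    refine Tendsto.smul (Tendsto.inv₀ ?_ ?_) h1
    · exact (ENNReal.tendsto_toReal (measure_ne_top _ _)).comp h2
    · exact (ENNReal.toReal_pos (hpos r hr.1).ne' (measure_ne_top _ _)).ne'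
  refine le_of_tendsto (h3.dist tendsto_const_nhds) (Eventually.of_forall fun n => ?_)
  exact le_of_lt (hsub ⟨hs0 n, (hsr n).trans hr.2⟩)

/-! ### A Poincaré inequality for sets of finite perimeter -/

/-- The mollification of the indicator function of `E`. -/
noncomputable def mollify (φ : ContDiffBump (0 : Plane)) (E : Set Plane) : Plane → ℝ :=
  convolution (φ.normed volume) (E.indicator fun _ => (1 : ℝ)) (ContinuousLinearMap.lsmul ℝ ℝ) volume

theorem locallyIntegrable_indicator_one {E : Set Plane} (hE : MeasurableSet E) :
    LocallyIntegrable (E.indicator fun _ => (1 : ℝ)) (volume : Measure Plane) :=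
  (locallyIntegrable_const (1 : ℝ)).indicator hE

theorem contDiff_mollify (φ : ContDiffBump (0 : Plane)) {E : Set Plane} (hE : MeasurableSet E) :
    ContDiff ℝ 1 (mollify φ E) :=
  φ.hasCompactSupport_normed.contDiff_convolution_left _ φ.contDiff_normed
    (locallyIntegrable_indicator_one hE)

theorem fderiv_mollify_apply (φ : ContDiffBump (0 : Plane)) {E : Set Plane} (hE : MeasurableSet E)
    (a v : Plane) :
    fderiv ℝ (mollify φ E) a v = ∫ b in E, fderiv ℝ (φ.normed volume) (a - b) v := by
  have hsupp : HasCompactSupport (φ.normed (volume : Measure Plane)) := φ.hasCompactSupport_normed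
  have hsm : ContDiff ℝ 1 (φ.normed (volume : Measure Plane)) := φ.contDiff_normed
  have h1 := hsupp.hasFDerivAt_convolution_left (μ := volume)
    (ContinuousLinearMap.lsmul ℝ ℝ) hsm
    (locallyIntegrable_indicator_one hE) a
  have hfd : fderiv ℝ (mollify φ E) a = _ := h1.fderiv
  rw [hfd]
  have hex := (hsupp.fderiv (𝕜 := ℝ)).convolutionExists_left
    (μ := volume) (ContinuousLinearMap.precompL Plane (ContinuousLinearMap.lsmul ℝ ℝ))
    (hsm.continuous_fderiv one_ne_zero)
    (locallyIntegrable_indicator_one hE) a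
  rw [convolution_eq_swap, ContinuousLinearMap.integral_apply hex.integrable_swap,
    ← integral_indicator hE]
  congr 1
  ext b
  rw [ContinuousLinearMap.precompL_apply]
  by_cases hb : b ∈ E <;> simp [hb]

theorem divergence_mul_const {f : Plane → ℝ} {b : Plane} (hf : DifferentiableAt ℝ f b)
    (v : Plane) : divergence (fun y => f y • v) b = fderiv ℝ f b v := by
  unfold divergence
  have h1 : fderiv ℝ (fun y => f y • v) b = (fderiv ℝ f b).smulRight v :=
    (hf.hasFDerivAt.smul_const v).fderiv
  rw [h1]
  have h2 : v = ∑ i : Fin 2, v i • (EuclideanSpace.single i (1 : ℝ) : Plane) := by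
    ext j
    fin_cases j <;> simp [Fin.sum_univ_two]
  conv_rhs => rw [h2]
  rw [map_sum]
  refine Finset.sum_congr rfl fun i _ => ?_
  rw [map_smul, ContinuousLinearMap.smulRight_apply, PiLp.smul_apply, smul_eq_mul, smul_eq_mul,
    mul_comm]

/-- The mollified perimeter measure. -/
noncomputable def mollifyMeasure (φ : ContDiffBump (0 : Plane)) (P : Measure Plane) (a : Plane) :
    ℝ≥0∞ :=
  ∫⁻ b, ENNReal.ofReal (φ.normed volume (a - b)) ∂P

theorem measurable_mollifyMeasure (φ : ContDiffBump (0 : Plane)) (P : Measure Plane) [SFinite P] :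
    Measurable (mollifyMeasure φ P) := by
  refine Measurable.lintegral_prod_right' (f := fun p : Plane × Plane =>
    ENNReal.ofReal (φ.normed volume (p.1 - p.2))) ?_
  have : Continuous (φ.normed volume) := φ.continuous_normed
  fun_prop

/-- The derivative falls on the kernel, and the perimeter identity is tested with the kernel centred
at a, times v; the polar vector has norm one P-almost everywhere. -/
theorem enorm_fderiv_mollify_apply_le {E : Set Plane} (hE : MeasurableSet E) {P : Measure Plane}
    {σ : Plane → Plane} (h : IsPolarOfDeriv E P σ) (φ : ContDiffBump (0 : Plane)) (a v : Plane) :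
    ‖fderiv ℝ (mollify φ E) a v‖ₑ ≤ ‖v‖ₑ * mollifyMeasure φ P a := by
  have hsm : ContDiff ℝ ∞ (φ.normed (volume : Measure Plane)) := φ.contDiff_normed
  set X : Plane → Plane := fun b => φ.normed volume (a - b) • v
  have hf : ContDiff ℝ ∞ fun b => φ.normed volume (a - b) :=
    hsm.comp (contDiff_const.sub contDiff_id)
  have hX : ContDiff ℝ ∞ X := hf.smul contDiff_const
  have hXc : HasCompactSupport X := by
    have h1 : HasCompactSupport fun b => φ.normed volume (a - b) :=
      φ.hasCompactSupport_normed.comp_homeomorph (Homeomorph.subLeft a)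
    exact h1.smul_right
  have hdiv : ∀ b, divergence X b = -fderiv ℝ (φ.normed volume) (a - b) v := by
    intro b
    have hd : DifferentiableAt ℝ (fun b => φ.normed volume (a - b)) b :=
      hf.differentiable (by simp) b
    rw [show X = fun y => (fun b => φ.normed volume (a - b)) y • v from rfl,
      divergence_mul_const hd]
    have h2 : HasFDerivAt (φ.normed volume) (fderiv ℝ (φ.normed volume) (a - b)) (a - b) :=
      (hsm.differentiable (by simp) _).hasFDerivAt
    have h3 := h2.comp b ((hasFDerivAt_id b).const_sub a)
    have h4 : fderiv ℝ (fun b => φ.normed volume (a - b)) b =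
        (fderiv ℝ (φ.normed volume) (a - b)).comp (-ContinuousLinearMap.id ℝ Plane) := h3.fderiv
    rw [h4]
    simp
  have hkey := h.integral_div X hX hXc
  simp_rw [hdiv] at hkey
  rw [integral_neg, ← fderiv_mollify_apply φ hE] at hkey
  rw [← enorm_neg, hkey]
  refine (enorm_integral_le_lintegral_enorm _).trans ?_
  rw [mollifyMeasure, ← lintegral_const_mul' _ _ (by simp)]
  refine lintegral_mono_ae ?_
  filter_upwards [h.norm_eq_one] with b hb
  rw [inner_smul_left, enorm_mul, mul_comm ‖v‖ₑ]
  have hn : 0 ≤ φ.normed volume (a - b) := φ.nonneg_normed _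
  refine mul_le_mul' (le_of_eq ?_) ?_
  · simp [Real.enorm_of_nonneg hn]
  · rw [← ofReal_norm, ← ofReal_norm]
    refine ENNReal.ofReal_le_ofReal ((norm_inner_le_norm _ _).trans ?_)
    rw [hb, mul_one]

/-- Tonelli: the kernel has integral one, and only points within `φ.rOut` of the ball contribute. -/
theorem lintegral_mollifyMeasure_ball_le (φ : ContDiffBump (0 : Plane)) (P : Measure Plane)
    [SFinite P] (x : Plane) (R : ℝ) :
    ∫⁻ a in Metric.ball x R, mollifyMeasure φ P a ≤ P (Metric.closedBall x (R + φ.rOut)) := by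
  have hc : Continuous (φ.normed (volume : Measure Plane)) := φ.continuous_normed
  unfold mollifyMeasure
  rw [lintegral_lintegral_swap (by
    have : Measurable (Function.uncurry fun a b : Plane =>
        ENNReal.ofReal (φ.normed volume (a - b))) := by
      unfold Function.uncurry
      fun_prop
    exact this.aemeasurable)]
  calc ∫⁻ b, (∫⁻ a in Metric.ball x R, ENNReal.ofReal (φ.normed volume (a - b))) ∂P
      ≤ ∫⁻ b, (Metric.closedBall x (R + φ.rOut)).indicator 1 b ∂P := by
        refine lintegral_mono fun b => ?_
        by_cases hb : b ∈ Metric.closedBall x (R + φ.rOut)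
        · rw [indicator_of_mem hb]
          refine (setLIntegral_le_lintegral _ _).trans (le_of_eq ?_)
          rw [lintegral_sub_right_eq_self (fun a => ENNReal.ofReal (φ.normed volume a)) b,
            ← ofReal_integral_eq_lintegral_ofReal φ.integrable_normed
              (Eventually.of_forall φ.nonneg_normed), φ.integral_normed]
          simp
        · rw [indicator_of_notMem hb, nonpos_iff_eq_zero]
          refine (setLIntegral_congr_fun measurableSet_ball fun a ha => ?_).trans lintegral_zero
          have : a - b ∉ Function.support (φ.normed volume) := by
            rw [φ.support_normed_eq, mem_ball_zero_iff, not_lt]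
            rw [Metric.mem_closedBall, not_le] at hb
            rw [Metric.mem_ball] at ha
            have h1 := dist_triangle_left b x a
            rw [dist_eq_norm a b] at h1
            linarith
          rw [Function.notMem_support.1 this, ENNReal.ofReal_zero]
    _ = P (Metric.closedBall x (R + φ.rOut)) :=
        lintegral_indicator_one Metric.isClosed_closedBall.measurableSet

/-- The increment is the integral of the derivative along the segment; after Tonelli, each translate
of the ball stays in the ball of radius r + ‖v‖. -/
theorem lintegral_mollify_translate_le {E : Set Plane} (hE : MeasurableSet E) {P : Measure Plane}
    {σ : Plane → Plane} (h : IsPolarOfDeriv E P σ) (φ : ContDiffBump (0 : Plane)) (x v : Plane)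
    (r : ℝ) :
    ∫⁻ a in Metric.ball x r, ‖mollify φ E (a + v) - mollify φ E a‖ₑ ≤
      ‖v‖ₑ * P (Metric.closedBall x (r + ‖v‖ + φ.rOut)) := by
  have := h.finite
  have hC1 := contDiff_mollify φ hE
  have hpm := measurable_mollifyMeasure φ P
  have hpt : ∀ a, ‖mollify φ E (a + v) - mollify φ E a‖ₑ ≤
      ∫⁻ t in Ioc (0 : ℝ) 1, ‖v‖ₑ * mollifyMeasure φ P (a + t • v) := by
    intro a
    have hder : ∀ t : ℝ, HasDerivAt (fun t : ℝ => mollify φ E (a + t • v))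
        (fderiv ℝ (mollify φ E) (a + t • v) v) t := by
      intro t
      have h1 : HasFDerivAt (mollify φ E) (fderiv ℝ (mollify φ E) (a + t • v)) (a + t • v) :=
        (hC1.differentiable one_ne_zero _).hasFDerivAt
      have h2 : HasDerivAt (fun t : ℝ => a + t • v) v t := by
        simpa using ((hasDerivAt_id t).smul_const v).const_add a
      exact h1.comp_hasDerivAt t h2
    have hcont : Continuous fun t : ℝ => fderiv ℝ (mollify φ E) (a + t • v) v :=
      ((hC1.continuous_fderiv one_ne_zero).comp (by fun_prop)).clm_apply continuous_const
    have hftc := intervalIntegral.integral_eq_sub_of_hasDerivAt (a := 0) (b := 1)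
      (fun t _ => hder t) (hcont.intervalIntegrable _ _)
    rw [one_smul, zero_smul, add_zero] at hftc
    rw [← hftc, intervalIntegral.integral_of_le zero_le_one]
    exact (enorm_integral_le_lintegral_enorm _).trans
      (lintegral_mono fun t => enorm_fderiv_mollify_apply_le hE h φ _ v)
  calc ∫⁻ a in Metric.ball x r, ‖mollify φ E (a + v) - mollify φ E a‖ₑ
      ≤ ∫⁻ a in Metric.ball x r, ∫⁻ t in Ioc (0 : ℝ) 1,
          ‖v‖ₑ * mollifyMeasure φ P (a + t • v) := lintegral_mono hpt
    _ = ∫⁻ t in Ioc (0 : ℝ) 1, ∫⁻ a in Metric.ball x r,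
          ‖v‖ₑ * mollifyMeasure φ P (a + t • v) := by
        refine lintegral_lintegral_swap ?_
        have : Measurable (Function.uncurry fun (a : Plane) (t : ℝ) =>
            ‖v‖ₑ * mollifyMeasure φ P (a + t • v)) :=
          measurable_const.mul (hpm.comp (by fun_prop))
        exact this.aemeasurable
    _ ≤ ∫⁻ t in Ioc (0 : ℝ) 1, ‖v‖ₑ * P (Metric.closedBall x (r + ‖v‖ + φ.rOut)) := by
        refine setLIntegral_mono' measurableSet_Ioc fun t ht => ?_
        rw [lintegral_const_mul' _ _ (by simp)]
        gcongr
        refine le_trans ?_ (lintegral_mollifyMeasure_ball_le φ P x (r + ‖v‖))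
        rw [← lintegral_indicator measurableSet_ball, ← lintegral_indicator measurableSet_ball,
          ← lintegral_add_right_eq_self
            ((Metric.ball x (r + ‖v‖)).indicator (mollifyMeasure φ P)) (t • v)]
        refine lintegral_mono fun a => ?_
        by_cases ha : a ∈ Metric.ball x r
        · have ha' : a + t • v ∈ Metric.ball x (r + ‖v‖) := by
            rw [Metric.mem_ball, dist_eq_norm] at ha ⊢
            have h1 : ‖t • v‖ ≤ ‖v‖ := by
              rw [norm_smul, Real.norm_of_nonneg ht.1.le]
              exact mul_le_of_le_one_left (norm_nonneg _) ht.2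
            have h2 := norm_add_le (a - x) (t • v)
            rw [show a + t • v - x = (a - x) + t • v by abel]
            linarith
          rw [indicator_of_mem ha, indicator_of_mem ha']
        · rw [indicator_of_notMem ha]
          exact zero_le
    _ = ‖v‖ₑ * P (Metric.closedBall x (r + ‖v‖ + φ.rOut)) := by simp

/-- Substituting b = a + v, the displacement v ranges over a ball of radius 2r, whence the radius 3r
= r + 2r. -/
theorem lintegral_lintegral_mollify_le {E : Set Plane} (hE : MeasurableSet E) {P : Measure Plane}
    {σ : Plane → Plane} (h : IsPolarOfDeriv E P σ) (φ : ContDiffBump (0 : Plane)) (x : Plane)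
    (r : ℝ) :
    ∫⁻ a in Metric.ball x r, ∫⁻ b in Metric.ball x r, ‖mollify φ E b - mollify φ E a‖ₑ ≤
      ENNReal.ofReal (2 * r) * P (Metric.closedBall x (3 * r + φ.rOut)) *
        volume (Metric.ball (0 : Plane) (2 * r)) := by
  have hcont : Continuous (mollify φ E) := (contDiff_mollify φ hE).continuous
  have hin : ∀ a ∈ Metric.ball x r, ∫⁻ b in Metric.ball x r, ‖mollify φ E b - mollify φ E a‖ₑ ≤
      ∫⁻ v in Metric.ball (0 : Plane) (2 * r), ‖mollify φ E (a + v) - mollify φ E a‖ₑ := by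
    intro a ha
    rw [← lintegral_indicator measurableSet_ball, ← lintegral_indicator measurableSet_ball,
      ← lintegral_add_left_eq_self _ a]
    refine lintegral_mono fun v => ?_
    by_cases hv : a + v ∈ Metric.ball x r
    · have hv' : v ∈ Metric.ball (0 : Plane) (2 * r) := by
        rw [mem_ball_zero_iff]
        rw [Metric.mem_ball] at ha hv
        have := dist_triangle_right (a + v) a x
        rw [dist_eq_norm, add_sub_cancel_left] at this
        linarith
      rw [indicator_of_mem hv, indicator_of_mem hv']
    · rw [indicator_of_notMem hv]
      exact zero_le
  calc _ ≤ ∫⁻ a in Metric.ball x r, ∫⁻ v in Metric.ball (0 : Plane) (2 * r),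
          ‖mollify φ E (a + v) - mollify φ E a‖ₑ := setLIntegral_mono' measurableSet_ball hin
    _ = ∫⁻ v in Metric.ball (0 : Plane) (2 * r), ∫⁻ a in Metric.ball x r,
          ‖mollify φ E (a + v) - mollify φ E a‖ₑ := by
        refine lintegral_lintegral_swap ?_
        have : Continuous (Function.uncurry fun a v : Plane =>
            ‖mollify φ E (a + v) - mollify φ E a‖ₑ) := by
          unfold Function.uncurry
          fun_prop
        exact this.measurable.aemeasurable
    _ ≤ ∫⁻ v in Metric.ball (0 : Plane) (2 * r),
          ENNReal.ofReal (2 * r) * P (Metric.closedBall x (3 * r + φ.rOut)) := by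
        refine setLIntegral_mono' measurableSet_ball fun v hv => ?_
        refine (lintegral_mollify_translate_le hE h φ x v r).trans ?_
        rw [mem_ball_zero_iff] at hv
        refine mul_le_mul' ?_ (measure_mono (Metric.closedBall_subset_closedBall (by linarith)))
        rw [← ofReal_norm]
        exact ENNReal.ofReal_le_ofReal hv.le
    _ = _ := by rw [setLIntegral_const]

/-- Poincaré inequality: a set of small perimeter in a ball nearly fills the ball or nearly misses
it. -/
theorem volume_inter_mul_volume_sdiff_le {E : Set Plane} (hE : MeasurableSet E) {P : Measure Plane}
    {σ : Plane → Plane} (h : IsPolarOfDeriv E P σ) (x : Plane) {r : ℝ} (hr : 0 < r) :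
    volume (E ∩ Metric.ball x r) * volume (Metric.ball x r \ E) ≤
      ENNReal.ofReal (2 * r) * P (Metric.closedBall x (4 * r)) *
        volume (Metric.ball (0 : Plane) (2 * r)) := by
  set B := Metric.ball x r with hB
  -- The fixed ratio 2 of the radii yields convergence at almost every point, and outer radii below
  -- r turn the radius 3r into 4r.
  set φ : ℕ → ContDiffBump (0 : Plane) := fun n =>
    ⟨r / ((n : ℝ) + 2) / 2, r / ((n : ℝ) + 2), by positivity, half_lt_self (by positivity)⟩
  have hφr : ∀ n, (φ n).rOut = r / ((n : ℝ) + 2) := fun n => rfl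
  have hφlim : Tendsto (fun n => (φ n).rOut) atTop (𝓝 0) := by
    simp_rw [hφr]
    exact (tendsto_natCast_atTop_atTop.atTop_add tendsto_const_nhds).const_div_atTop r
  have hconv : ∀ᵐ a ∂(volume : Measure Plane),
      Tendsto (fun n => mollify (φ n) E a) atTop (𝓝 (E.indicator (fun _ => (1 : ℝ)) a)) :=
    ContDiffBump.ae_convolution_tendsto_right_of_locallyIntegrable (K := 2) hφlim
      (Eventually.of_forall fun n => by
        change r / ((n : ℝ) + 2) ≤ 2 * (r / ((n : ℝ) + 2) / 2)
        linarith) (locallyIntegrable_indicator_one hE)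
  have hcont : ∀ n, Continuous (mollify (φ n) E) := fun n => (contDiff_mollify (φ n) hE).continuous
  set g : Plane → ℝ := E.indicator fun _ => (1 : ℝ) with hg
  set F : ℕ → Plane → Plane → ℝ≥0∞ := fun n a b => ‖mollify (φ n) E b - mollify (φ n) E a‖ₑ
  have hFm : ∀ n, Continuous (Function.uncurry (F n)) := fun n => by
    have := hcont n
    unfold Function.uncurry
    fun_prop
  have hFatou : ∫⁻ a in B, ∫⁻ b in B, ‖g b - g a‖ₑ ≤
      liminf (fun n => ∫⁻ a in B, ∫⁻ b in B, F n a b) atTop := by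
    calc ∫⁻ a in B, ∫⁻ b in B, ‖g b - g a‖ₑ
        ≤ ∫⁻ a in B, liminf (fun n => ∫⁻ b in B, F n a b) atTop := by
          refine lintegral_mono_ae ((ae_restrict_of_ae hconv).mono fun a ha => ?_)
          calc ∫⁻ b in B, ‖g b - g a‖ₑ = ∫⁻ b in B, liminf (fun n => F n a b) atTop := by
                refine lintegral_congr_ae ((ae_restrict_of_ae hconv).mono fun b hb => ?_)
                exact ((hb.sub ha).enorm.liminf_eq).symm
            _ ≤ _ := lintegral_liminf_le fun n => by
                have := (hFm n).comp (Continuous.prodMk continuous_const continuous_id :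
                  Continuous fun b : Plane => (a, b))
                exact this.measurable
      _ ≤ _ := lintegral_liminf_le fun n =>
          Measurable.lintegral_prod_right (hFm n).measurable
  -- The indicator differs by exactly 1 between a point of E ∩ B and a point of B \ E.
  calc volume (E ∩ B) * volume (B \ E)
      = ∫⁻ a in E ∩ B, ∫⁻ b in B \ E, 1 := by
        rw [setLIntegral_one, setLIntegral_const, mul_comm]
    _ ≤ ∫⁻ a in E ∩ B, ∫⁻ b in B, ‖g b - g a‖ₑ := by
        refine setLIntegral_mono' (hE.inter measurableSet_ball) fun a ha => ?_
        refine le_trans ?_ (lintegral_mono_set (sdiff_subset (s := B) (t := E)))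
        refine setLIntegral_mono' (measurableSet_ball.diff hE) fun b hb => ?_
        rw [hg, indicator_of_mem ha.1, indicator_of_notMem hb.2]
        simp
    _ ≤ ∫⁻ a in B, ∫⁻ b in B, ‖g b - g a‖ₑ := lintegral_mono_set inter_subset_right
    _ ≤ _ := hFatou
    _ ≤ _ := by
        refine (liminf_le_liminf (Eventually.of_forall fun n => ?_)).trans (le_of_eq (liminf_const _))
        refine (lintegral_lintegral_mollify_le hE h (φ n) x r).trans ?_
        gcongr
        rw [hφr]
        have : r / ((n : ℝ) + 2) ≤ r := div_le_self hr.le (by linarith [n.cast_nonneg (α := ℝ)])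
        linarith

/-! ### Federer's theorem for bounded sets of finite perimeter -/

theorem volume_real_ball (x : Plane) {r : ℝ} (hr : 0 ≤ r) :
    volume.real (Metric.ball x r) = r ^ 2 * volume.real (Metric.ball (0 : Plane) 1) := by
  rw [measureReal_def, Measure.addHaar_ball _ _ hr, ENNReal.toReal_mul,
    ENNReal.toReal_ofReal (by positivity), measureReal_def]
  simp

/-- The difference is at most the area of an annulus; used for continuity of the area ratio in the
radius. -/
theorem abs_volume_real_inter_ball_sub_le (E : Set Plane) (x : Plane) {r s : ℝ} (hr : 0 ≤ r)
    (hs : 0 ≤ s) :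
    |volume.real (E ∩ Metric.ball x s) - volume.real (E ∩ Metric.ball x r)| ≤
      |s ^ 2 - r ^ 2| * volume.real (Metric.ball (0 : Plane) 1) := by
  wlog h : r ≤ s generalizing r s
  · rw [abs_sub_comm, abs_sub_comm (s ^ 2)]
    exact this hs hr (le_of_not_ge h)
  have hfin : ∀ t, volume (Metric.ball x t) ≠ ⊤ := fun t => measure_ball_lt_top.ne
  have hsub : Metric.ball x r ⊆ Metric.ball x s := Metric.ball_subset_ball h
  have h1 : volume.real (E ∩ Metric.ball x r) ≤ volume.real (E ∩ Metric.ball x s) :=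
    measureReal_mono (inter_subset_inter_right _ hsub)
      (measure_ne_top_of_subset inter_subset_right (hfin s))
  have h2 : volume.real (E ∩ Metric.ball x s) ≤ volume.real (E ∩ Metric.ball x r) +
      volume.real (Metric.ball x s \ Metric.ball x r) := by
    refine (measureReal_mono (fun y hy => ?_) ?_).trans (measureReal_union_le _ _)
    · by_cases hyr : y ∈ Metric.ball x r
      · exact Or.inl ⟨hy.1, hyr⟩
      · exact Or.inr ⟨hy.2, hyr⟩
    · exact (measure_union_lt_top
        (measure_ne_top_of_subset inter_subset_right (hfin r)).lt_top
        (measure_ne_top_of_subset sdiff_subset (hfin s)).lt_top).ne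
  have h3 : volume.real (Metric.ball x s \ Metric.ball x r) =
      s ^ 2 * volume.real (Metric.ball (0 : Plane) 1) -
        r ^ 2 * volume.real (Metric.ball (0 : Plane) 1) := by
    rw [← volume_real_ball x hs, ← volume_real_ball x hr]
    exact measureReal_sdiff hsub measurableSet_ball (hfin s)
  rw [abs_of_nonneg (by linarith), abs_of_nonneg (by nlinarith)]
  linarith

theorem mem_densityPoints_of_tendsto {E : Set Plane} {x : Plane} {θ : ℝ}
    (h : Tendsto (fun r : ℝ => volume.real (E ∩ Metric.ball x r) / volume.real (Metric.ball x r))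
      (𝓝[>] 0) (𝓝 θ)) : x ∈ densityPoints E (ENNReal.ofReal θ) := by
  refine (ENNReal.tendsto_ofReal h).congr' ?_
  filter_upwards [self_mem_nhdsWithin] with r hr
  have h1 : volume (Metric.ball x r) ≠ ⊤ := measure_ball_lt_top.ne
  have h2 : volume (Metric.ball x r) ≠ 0 := (Metric.measure_ball_pos _ _ hr).ne'
  have h3 : 0 < volume.real (Metric.ball x r) := ENNReal.toReal_pos h2 h1
  rw [ENNReal.ofReal_div_of_pos h3, ofReal_measureReal
    (measure_ne_top_of_subset inter_subset_right h1), ofReal_measureReal h1]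

/-- The Poincaré inequality makes d(1 - d) tend to 0, where d is the area ratio. This alone would
allow oscillation between 0 and 1, but d is continuous in the radius and cannot cross 1/2 once d(1 -
d) < 1/4, so it stays near one end. -/
theorem mem_densityPoints_of_perimeter_density_zero {E : Set Plane} (hE : MeasurableSet E)
    {P : Measure Plane} {σ : Plane → Plane} (h : IsPolarOfDeriv E P σ) {x : Plane}
    (hx : ∀ t > 0, ∀ᶠ r in 𝓝[>] (0 : ℝ), P (Metric.closedBall x r) ≤ ENNReal.ofReal (t * r)) :
    x ∈ densityPoints E 0 ∨ x ∈ densityPoints E 1 := by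
  set κ := volume.real (Metric.ball (0 : Plane) 1) with hκ
  have hκ0 : 0 < κ := ENNReal.toReal_pos (Metric.measure_ball_pos _ _ one_pos).ne'
    measure_ball_lt_top.ne
  set V : ℝ → ℝ := fun r => volume.real (E ∩ Metric.ball x r) with hV
  set d : ℝ → ℝ := fun r => V r / volume.real (Metric.ball x r) with hd
  have hball : ∀ r : ℝ, 0 < r → volume.real (Metric.ball x r) = r ^ 2 * κ :=
    fun r hr => volume_real_ball x hr.le
  have hfin : ∀ t, volume (Metric.ball x t) ≠ ⊤ := fun t => measure_ball_lt_top.ne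
  have hsum : ∀ r : ℝ, 0 < r → V r + volume.real (Metric.ball x r \ E) = r ^ 2 * κ := by
    intro r hr
    rw [← hball r hr]
    change volume.real (E ∩ _) + _ = _
    rw [inter_comm]
    exact measureReal_inter_add_sdiff hE (hfin r)
  have hd0 : ∀ r : ℝ, 0 < r → 0 ≤ d r := fun r hr => div_nonneg measureReal_nonneg measureReal_nonneg
  have hd1 : ∀ r : ℝ, 0 < r → d r ≤ 1 := by
    intro r hr
    have h2 : 0 ≤ volume.real (Metric.ball x r \ E) := measureReal_nonneg
    rw [hd]
    dsimp only
    rw [hball r hr, div_le_one (by positivity)]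
    linarith [hsum r hr]
  have hprod : Tendsto (fun r => d r * (1 - d r)) (𝓝[>] 0) (𝓝 0) := by
    rw [Metric.tendsto_nhds]
    intro ε hε
    have h4 : Tendsto (fun r : ℝ => 4 * r) (𝓝[>] 0) (𝓝[>] 0) := by
      refine tendsto_nhdsWithin_iff.2 ⟨?_, ?_⟩
      · exact ((continuous_const_mul (4 : ℝ)).tendsto' 0 0 (by simp)).mono_left nhdsWithin_le_nhds
      · filter_upwards [self_mem_nhdsWithin] with r (hr : 0 < r)
        exact mul_pos (by norm_num) hr
    -- With this constant the Poincaré bound 2r · (εκ/64)(4r) · (2r)²κ equals (ε/2)(r²κ)².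
    filter_upwards [h4.eventually (hx (ε * κ / 64) (by positivity)), self_mem_nhdsWithin]
      with r hr (hr0 : 0 < r)
    have hpoin := volume_inter_mul_volume_sdiff_le hE h x hr0
    have hreal : V r * volume.real (Metric.ball x r \ E) ≤
        2 * r * (ε * κ / 64 * (4 * r)) * ((2 * r) ^ 2 * κ) := by
      rw [← volume_real_ball (0 : Plane) (by positivity : 0 ≤ 2 * r)]
      have h5 : volume (E ∩ Metric.ball x r) * volume (Metric.ball x r \ E) ≤
          ENNReal.ofReal (2 * r) * ENNReal.ofReal (ε * κ / 64 * (4 * r)) *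
            volume (Metric.ball (0 : Plane) (2 * r)) := hpoin.trans (by gcongr)
      have h6 := ENNReal.toReal_mono (ENNReal.mul_ne_top (ENNReal.mul_ne_top ENNReal.ofReal_ne_top
        ENNReal.ofReal_ne_top) measure_ball_lt_top.ne) h5
      rw [ENNReal.toReal_mul, ENNReal.toReal_mul, ENNReal.toReal_mul,
        ENNReal.toReal_ofReal (by positivity), ENNReal.toReal_ofReal (by positivity)] at h6
      exact h6
    have hdv : d r * (1 - d r) = V r * volume.real (Metric.ball x r \ E) / (r ^ 2 * κ) ^ 2 := by
      have h7 : volume.real (Metric.ball x r \ E) = r ^ 2 * κ - V r := by linarith [hsum r hr0]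
      rw [h7, hd]
      dsimp only
      rw [hball r hr0]
      field_simp
    have hle : d r * (1 - d r) ≤ ε / 2 := by
      rw [hdv, div_le_iff₀ (by positivity)]
      refine hreal.trans (le_of_eq ?_)
      ring
    rw [Real.dist_0_eq_abs, abs_of_nonneg (mul_nonneg (hd0 r hr0) (by linarith [hd1 r hr0]))]
    linarith
  have hcont : ContinuousOn d (Ioi 0) := by
    have hVc : ContinuousOn V (Ioi 0) := by
      intro r hr
      have h8 : Tendsto (fun s : ℝ => |s ^ 2 - r ^ 2| * κ) (𝓝[Ioi 0] r) (𝓝 0) := by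
        refine Tendsto.mono_left ?_ nhdsWithin_le_nhds
        exact (by fun_prop : Continuous fun s : ℝ => |s ^ 2 - r ^ 2| * κ).tendsto' r 0 (by simp)
      refine tendsto_sub_nhds_zero_iff.1 (squeeze_zero_norm' ?_ h8)
      filter_upwards [self_mem_nhdsWithin] with s (hs : 0 < s)
      exact abs_volume_real_inter_ball_sub_le E x (le_of_lt hr) hs.le
    refine (hVc.div (f := V) (g := fun r => r ^ 2 * κ) (by fun_prop) ?_).congr ?_
    · intro r (hr : 0 < r)
      positivity
    · intro r hr
      rw [hd]
      dsimp only
      rw [hball r hr]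
      rfl
  obtain ⟨r₀, hr₀, hne⟩ : ∃ r₀ > 0, ∀ r ∈ Ioo 0 r₀, d r * (1 - d r) < 1 / 4 := by
    have h9 := hprod.eventually (gt_mem_nhds (by norm_num : (0 : ℝ) < 1 / 4))
    obtain ⟨r₀, hr₀, h10⟩ := mem_nhdsGT_iff_exists_Ioo_subset.1 h9
    exact ⟨r₀, hr₀, h10⟩
  have hnear : ∀ᶠ r in 𝓝[>] (0 : ℝ), r ∈ Ioo 0 r₀ := Ioo_mem_nhdsGT hr₀
  by_cases hlow : ∃ a ∈ Ioo 0 r₀, d a < 1 / 2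
  · left
    obtain ⟨a, ha, hda⟩ := hlow
    have hall : ∀ r ∈ Ioo 0 r₀, d r < 1 / 2 := by
      intro r hr
      by_contra! hge
      obtain ⟨c, hc, hdc⟩ := (isPreconnected_Ioo (a := (0 : ℝ)) (b := r₀)).intermediate_value ha hr
        (hcont.mono Ioo_subset_Ioi_self) ⟨hda.le, hge⟩
      have := hne c hc
      rw [hdc] at this
      norm_num at this
    rw [← ENNReal.ofReal_zero]
    refine mem_densityPoints_of_tendsto ?_
    have h2 : Tendsto (fun r => 2 * (d r * (1 - d r))) (𝓝[>] 0) (𝓝 0) := by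
      simpa using hprod.const_mul 2
    refine tendsto_of_tendsto_of_tendsto_of_le_of_le' tendsto_const_nhds h2 ?_ ?_
    · filter_upwards [hnear] with r hr using hd0 r hr.1
    · filter_upwards [hnear] with r hr
      change d r ≤ _
      nlinarith [hd0 r hr.1, hall r hr]
  · right
    push Not at hlow
    rw [← ENNReal.ofReal_one]
    refine mem_densityPoints_of_tendsto ?_
    have h2 : Tendsto (fun r => 1 - 2 * (d r * (1 - d r))) (𝓝[>] 0) (𝓝 1) := by
      simpa using (hprod.const_mul 2).const_sub 1
    refine tendsto_of_tendsto_of_tendsto_of_le_of_le' h2 tendsto_const_nhds ?_ ?_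
    · filter_upwards [hnear] with r hr
      change _ ≤ d r
      nlinarith [hd1 r hr.1, hlow r hr]
    · filter_upwards [hnear] with r hr using hd1 r hr.1

/-- Federer's theorem: off an `H1`-null set, every point of the plane belongs to the reduced
boundary of `E` or is a point of density zero or one. -/
theorem ae_mem_reducedBoundary_or_densityPoints {E : Set Plane} (hE : MeasurableSet E)
    {P : Measure Plane} {σ : Plane → Plane} (h : IsPolarOfDeriv E P σ) :
    ∀ᵐ x ∂H1, x ∈ reducedBoundary E ∨ x ∈ densityPoints E 0 ∨ x ∈ densityPoints E 1 := by
  have := h.finite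
  have hN : P (reducedBoundary E)ᶜ = 0 := ae_mem_reducedBoundary h
  filter_upwards [ae_density_eq_zero_of_null hN] with x hx
  by_cases hxr : x ∈ reducedBoundary E
  · exact Or.inl hxr
  · exact Or.inr (mem_densityPoints_of_perimeter_density_zero hE h (hx hxr))

/-! ### Admissible regions have finite perimeter -/

theorem volume_le_lintegral_section {A : Set Plane} (hA : MeasurableSet A) {f : ℝ → ℝ≥0∞}
    (hf : ∀ x : ℝ, volume {y : ℝ | !₂[x, y] ∈ A} ≤ f x) : volume A ≤ ∫⁻ x, f x := by
  have h1 : MeasurePreserving (fun q : ℝ × ℝ => (!₂[q.1, q.2] : Plane)) volume volume := by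
    have := (PiLp.volume_preserving_toLp (Fin 2)).comp (volume_preserving_finTwoArrow ℝ).symm
    exact this
  rw [← h1.measure_preimage hA.nullMeasurableSet, Measure.volume_eq_prod,
    Measure.prod_apply (h1.measurable hA)]
  exact lintegral_mono hf

/-- The integrals cancel except on two end strips of width δ, where monotonicity applies; a - 1
bounds the left strip because δ ≤ 1. -/
theorem integral_sub_translate_le {W : ℝ → ℝ} (hW : Monotone W) {a b δ : ℝ} (hδ : δ ∈ Ioc 0 1) :
    ∫ x in a..b, (W x - W (x - δ)) ≤ δ * (W b - W (a - 1)) := by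
  have hInt : ∀ c d, IntervalIntegrable W volume c d := fun c d => hW.intervalIntegrable
  have hWδ : Monotone fun x => W (x - δ) := fun x y hxy => hW (by linarith)
  rw [intervalIntegral.integral_sub (hInt _ _) hWδ.intervalIntegrable,
    intervalIntegral.integral_comp_sub_right (fun x => W x) δ,
    intervalIntegral.integral_interval_sub_interval_comm' (hInt _ _) (hInt _ _) (hInt _ _)]
  have h1 : ∫ x in b - δ..b, W x ≤ ∫ x in b - δ..b, W b :=
    intervalIntegral.integral_mono_on (by linarith [hδ.1]) (hInt _ _) (by simp)
      fun x hx => hW hx.2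
  have h2 : ∫ x in a - δ..a, W (a - 1) ≤ ∫ x in a - δ..a, W x :=
    intervalIntegral.integral_mono_on (by linarith [hδ.1]) (by simp) (hInt _ _)
      fun x hx => hW (by linarith [hx.1, hδ.2])
  rw [intervalIntegral.integral_const, smul_eq_mul] at h1 h2
  rw [mul_sub]
  linarith

/-- A function of bounded variation, extended by a constant below its values to the left of the
interval, grows no faster than some monotone function. -/
theorem exists_monotone_increments {l L : ℝ} (hl : 0 < l) {h : ℝ → ℝ}
    (hh : IsAdmissibleHeight l L h) :
    ∃ W : ℝ → ℝ, Monotone W ∧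
      (∀ x ∈ Icc (-l) l, ∀ y ∈ Icc (-l) l, y ≤ x → h x - h y ≤ W x - W y) ∧
      ∀ x ∈ Icc (-l) l, ∀ y < -l, h x + L ≤ W x - W y := by
  -- Clamping the argument to the interval extends the height to the line without increasing its
  -- variation, so the Jordan decomposition is global.
  have hbv : BoundedVariationOn (h ∘ fun x => max (-l) (min l x)) univ := by
    refine ne_top_of_le_ne_top hh.variation (eVariationOn.comp_le_of_monotoneOn _ _ ?_ ?_)
    · exact fun x _ y _ hxy => max_le_max le_rfl (min_le_min le_rfl hxy)
    · exact fun x _ => ⟨le_max_left _ _, max_le (by linarith) (min_le_left _ _)⟩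
  obtain ⟨p, q, hp, hq, hpq⟩ := hbv.locallyBoundedVariationOn.exists_monotoneOn_sub_monotoneOn
  rw [monotoneOn_univ] at hp hq
  have hL : 0 ≤ L := by
    have := hh.mapsTo (show (0 : ℝ) ∈ Icc (-l) l by simp [hl.le])
    exact this.1.trans this.2
  have heq : ∀ x ∈ Icc (-l) l, h x = p x - q x := fun x hx => by
    have := congrFun hpq x
    simpa [hx.1, hx.2] using this
  -- The jump 2L at the left wall pays for a whole column of film, whose length h + L is at most 2L.
  refine ⟨fun x => p x + if -l ≤ x then 2 * L else 0, fun x y hxy => ?_, fun x hx y hy hyx => ?_,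
    fun x hx y hy => ?_⟩
  · refine add_le_add (hp hxy) ?_
    split_ifs <;> linarith
  · simp only [hx.1, hy.1, if_true]
    rw [heq x hx, heq y hy]
    linarith [hq hyx]
  · simp only [hx.1, if_true, not_le.2 hy, if_false]
    linarith [hp (hy.le.trans hx.1), (hh.mapsTo hx).2]

/-- The vertical section over x is contained between heights h(x - δ) and h(x), or is a full column
near the left wall; both are bounded by the increment of a monotone function over δ, which is then
integrated. -/
theorem volume_film_sdiff_horizontal_le {l L : ℝ} (hl : 0 < l) {h : ℝ → ℝ}
    (hh : IsAdmissibleHeight l L h) : ∃ C : ℝ, 0 ≤ C ∧ ∀ δ ∈ Ioc (0 : ℝ) 1,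
      volume (film l L h \ {x : Plane | x - δ • EuclideanSpace.single 0 (1 : ℝ) ∈ film l L h}) ≤
        ENNReal.ofReal (C * δ) := by
  obtain ⟨W, hW, hWin, hWout⟩ := exists_monotone_increments hl hh
  refine ⟨W l - W (-l - 1), sub_nonneg.2 (hW (by linarith)), fun δ hδ => ?_⟩
  have hcl := isClosed_film (L := L) hh.usc
  have hmeas : MeasurableSet
      (film l L h \ {x : Plane | x - δ • EuclideanSpace.single 0 (1 : ℝ) ∈ film l L h}) :=
    hcl.measurableSet.diff ((hcl.preimage (continuous_sub_right _)).measurableSet)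
  have hmono : ∀ x, 0 ≤ W x - W (x - δ) := fun x => sub_nonneg.2 (hW (by linarith [hδ.1]))
  refine (volume_le_lintegral_section (f := (Icc (-l) l).indicator fun x =>
    ENNReal.ofReal (W x - W (x - δ))) hmeas fun x => ?_).trans ?_
  · by_cases hx : x ∈ Icc (-l) l
    · rw [indicator_of_mem hx]
      rcases lt_or_ge (x - δ) (-l) with hlt | hge
      · refine (measure_mono (t := Icc (-L) (h x)) fun y hy => ?_).trans ?_
        · have := (mem_film hl).1 hy.1
          simpa using this.2
        · rw [Real.volume_Icc]
          exact ENNReal.ofReal_le_ofReal (by linarith [hWout x hx _ hlt])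
      · have hx' : x - δ ∈ Icc (-l) l := ⟨hge, by linarith [hδ.1, hx.2]⟩
        refine (measure_mono (t := Icc (h (x - δ)) (h x)) fun y hy => ?_).trans ?_
        · have h1 := (mem_film hl).1 hy.1
          have h2 : ¬ _ := hy.2
          rw [mem_ofPred_eq, mem_film hl] at h2
          simp only [PiLp.sub_apply, PiLp.smul_apply] at h1 h2
          simp at h1 h2
          exact ⟨(h2 (by linarith) (by linarith [hx'.2]) h1.2.1).le, h1.2.2⟩
        · rw [Real.volume_Icc]
          exact ENNReal.ofReal_le_ofReal (hWin x hx _ hx' (by linarith [hδ.1]))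
    · rw [indicator_of_notMem hx, nonpos_iff_eq_zero]
      refine measure_mono_null (t := ∅) (fun y hy => hx ?_) measure_empty
      have := ((mem_film hl).1 hy.1).1
      simpa using this
  · rw [lintegral_indicator measurableSet_Icc, ← restrict_Ioc_eq_restrict_Icc,
      ← ofReal_integral_eq_lintegral_ofReal _ (Eventually.of_forall hmono),
      ← intervalIntegral.integral_of_le (by linarith)]
    · refine ENNReal.ofReal_le_ofReal ((integral_sub_translate_le hW hδ).trans (le_of_eq ?_))
      ring
    · have hWδ : Monotone fun x => W (x - δ) := fun x y hxy => hW (by linarith)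
      exact ((hW.intervalIntegrable (a := -l) (b := l)).sub hWδ.intervalIntegrable).1

/-- Raising the film uncovers only a strip of height δ at the bottom of the container. -/
theorem volume_film_sdiff_vertical_le {l L : ℝ} (hl : 0 < l) {h : ℝ → ℝ}
    (hh : IsAdmissibleHeight l L h) {δ : ℝ} (hδ : 0 < δ) :
      volume (film l L h \ {x : Plane | x - δ • EuclideanSpace.single 1 (1 : ℝ) ∈ film l L h}) ≤
        ENNReal.ofReal (2 * l * δ) := by
  have hcl := isClosed_film (L := L) hh.usc
  have hmeas : MeasurableSet
      (film l L h \ {x : Plane | x - δ • EuclideanSpace.single 1 (1 : ℝ) ∈ film l L h}) :=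
    hcl.measurableSet.diff ((hcl.preimage (continuous_sub_right _)).measurableSet)
  refine (volume_le_lintegral_section (f := (Icc (-l) l).indicator fun x =>
    ENNReal.ofReal δ) hmeas fun x => ?_).trans ?_
  · by_cases hx : x ∈ Icc (-l) l
    · rw [indicator_of_mem hx]
      refine (measure_mono (t := Icc (-L) (-L + δ)) fun y hy => ?_).trans ?_
      · have h1 := (mem_film hl).1 hy.1
        have h2 : ¬ _ := hy.2
        rw [mem_ofPred_eq, mem_film hl] at h2
        simp at h1 h2
        refine ⟨h1.2.1, ?_⟩
        by_contra! hlt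
        linarith [h2 hx.1 hx.2 (by linarith)]
      · rw [Real.volume_Icc]
        exact ENNReal.ofReal_le_ofReal (by linarith)
    · rw [indicator_of_notMem hx, nonpos_iff_eq_zero]
      refine measure_mono_null (t := ∅) (fun y hy => hx ?_) measure_empty
      have := ((mem_film hl).1 hy.1).1
      simpa using this
  · rw [lintegral_indicator measurableSet_Icc, setLIntegral_const, Real.volume_Icc,
      ← ENNReal.ofReal_mul hδ.le]
    exact ENNReal.ofReal_le_ofReal (by linarith)

theorem IsAdmissiblePair.measurableSet_region {l L : ℝ} {h : ℝ → ℝ} {K : Set Plane}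
    (hp : IsAdmissiblePair l L h K) : MeasurableSet (region l L h K) := by
  rw [region_eq_film_sdiff]
  exact (isClosed_film hp.height.usc).measurableSet.diff hp.crack.closed.measurableSet

theorem IsAdmissiblePair.exists_isPolarOfDeriv {l L : ℝ} (hl : 0 < l) {h : ℝ → ℝ} {K : Set Plane}
    (hp : IsAdmissiblePair l L h K) :
    ∃ (P : Measure Plane) (σ : Plane → Plane), IsPolarOfDeriv (region l L h K) P σ := by
  have hE := hp.measurableSet_region
  have hb : Bornology.IsBounded (region l L h K) := by
    rw [region_eq_film_sdiff]
    exact (isCompact_box l L).isBounded.subset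
      (sdiff_subset.trans (film_subset_box hl hp.height.mapsTo))
  have hK0 : volume K = 0 := volume_eq_zero_of_H1_lt_top hp.crack.rectifiable.1
  obtain ⟨C, hC, hhor⟩ := volume_film_sdiff_horizontal_le (L := L) hl hp.height
  have hfilm : ∀ (i : Fin 2), ∀ δ ∈ Ioc (0 : ℝ) 1,
      volume (film l L h \ {x : Plane | x - δ • EuclideanSpace.single i (1 : ℝ) ∈ film l L h}) ≤
        ENNReal.ofReal ((C + 2 * l) * δ) := by
    intro i δ hδ
    fin_cases i
    · exact (hhor δ hδ).trans (ENNReal.ofReal_le_ofReal (by nlinarith [hδ.1]))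
    · exact (volume_film_sdiff_vertical_le hl hp.height hδ.1).trans
        (ENNReal.ofReal_le_ofReal (by nlinarith [hδ.1]))
  refine FilmLayers.exists_isPolarOfDeriv hE hb (C := C + 2 * l) fun i δ hδ => ?_
  set v : Plane := δ • EuclideanSpace.single i (1 : ℝ) with hv
  have hmp : MeasurePreserving (fun x : Plane => x - v) volume volume :=
    measurePreserving_sub_right volume v
  have hone : volume (region l L h K \ {x : Plane | x - v ∈ region l L h K}) ≤
      ENNReal.ofReal ((C + 2 * l) * δ) := by
    have hsub : region l L h K \ {x : Plane | x - v ∈ region l L h K} ⊆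
        (film l L h \ {x : Plane | x - v ∈ film l L h}) ∪ (fun x : Plane => x - v) ⁻¹' K := by
      rw [region_eq_film_sdiff]
      rintro x ⟨hx1, hx2⟩
      by_cases hxK : x - v ∈ K
      · exact Or.inr hxK
      · exact Or.inl ⟨hx1.1, fun hx3 => hx2 ⟨hx3, hxK⟩⟩
    refine (measure_mono hsub).trans ((measure_union_le _ _).trans ?_)
    rw [hmp.measure_preimage hp.crack.closed.measurableSet.nullMeasurableSet, hK0, add_zero]
    exact hfilm i δ hδ
  refine ⟨?_, hone⟩
  -- A set and its translate have equal finite area, so the two one-sided differences have equal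
  -- area and one estimate suffices.
  change volume ((fun x : Plane => x - v) ⁻¹' region l L h K \ region l L h K) ≤ _
  rw [measure_sdiff_symm (hmp.measurable hE).nullMeasurableSet hE.nullMeasurableSet
    (hmp.measure_preimage hE.nullMeasurableSet)
    (measure_ne_top_of_subset inter_subset_right hb.measure_lt_top.ne)]
  exact hone

/-- Off an `H1`-null set, the points of the plane which are not in the reduced boundary of an
admissible region have density zero or one. -/
theorem IsAdmissiblePair.ae_trichotomy {l L : ℝ} (hl : 0 < l) {h : ℝ → ℝ} {K : Set Plane}
    (hp : IsAdmissiblePair l L h K) :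
    ∀ᵐ x ∂H1, x ∈ reducedBoundary (region l L h K) ∨ x ∈ densityPoints (region l L h K) 0 ∨
      x ∈ densityPoints (region l L h K) 1 := by
  obtain ⟨P, σ, hP⟩ := hp.exists_isPolarOfDeriv hl
  exact ae_mem_reducedBoundary_or_densityPoints hp.measurableSet_region hP

/-! ### The surface energy controls the length of the boundaries -/

theorem norm_unitNormal (E : Set Plane) (x : Plane) : ‖unitNormal E x‖ = 1 := by
  unfold unitNormal
  split_ifs with h1 h2
  · exact h1.choose_spec.1
  · exact h2.choose_spec.1
  · simp

theorem mem_densityPoints_one_of_mem_interior {E : Set Plane} {x : Plane} (hx : x ∈ interior E) :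
    x ∈ densityPoints E 1 := by
  obtain ⟨ε, hε, hsub⟩ := Metric.isOpen_iff.1 isOpen_interior x hx
  refine tendsto_const_nhds.congr' ?_
  filter_upwards [Ioo_mem_nhdsGT hε] with r hr
  rw [inter_eq_self_of_subset_right
    ((Metric.ball_subset_ball hr.2.le).trans (hsub.trans interior_subset)),
    ENNReal.div_self (Metric.measure_ball_pos _ _ hr.1).ne' measure_ball_lt_top.ne]

theorem mem_densityPoints_zero_of_notMem_closure {E : Set Plane} {x : Plane}
    (hx : x ∉ closure E) : x ∈ densityPoints E 0 := by
  obtain ⟨ε, hε, hsub⟩ := Metric.isOpen_iff.1 isClosed_closure.isOpen_compl x hx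
  refine tendsto_const_nhds.congr' ?_
  filter_upwards [Ioo_mem_nhdsGT hε] with r hr
  have : E ∩ Metric.ball x r = ∅ := by
    rw [← disjoint_iff_inter_eq_empty]
    refine (disjoint_compl_right (a := closure E)).mono subset_closure ?_
    exact (Metric.ball_subset_ball hr.2.le).trans hsub
  rw [this, measure_empty, ENNReal.zero_div]

/-- Every nonzero value of the integrand contains a tension bounded below by `c₁`. The substance is
that the trichotomy for both sets, the inclusion of closures and the constraint on the film boundary
leave no boundary point in the default case. -/
theorem le_density {l L c₁ c₂ : ℝ} {φ₀ φ₁ φ₀₁ : Plane → Plane → ℝ} (hc₁ : 0 < c₁)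
    (h₁ : IsComparable l L c₁ c₂ φ₁) (h₂ : IsComparable l L c₁ c₂ (regimeOne φ₀ φ₁ φ₀₁))
    (h₃ : IsComparable l L c₁ c₂ φ₀₁) {S₁ S₀ : Set Plane}
    (hInt : frontier S₁ ∩ interior S₀ = ∅) (hcl : closure S₀ ⊆ closure S₁) {x : Plane}
    (hxΩ : x ∈ Omega l L) (hx : x ∈ frontier S₀ ∪ frontier S₁)
    (ht₁ : x ∈ reducedBoundary S₁ ∨ x ∈ densityPoints S₁ 0 ∨ x ∈ densityPoints S₁ 1)
    (ht₀ : x ∈ reducedBoundary S₀ ∨ x ∈ densityPoints S₀ 0 ∨ x ∈ densityPoints S₀ 1) :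
    c₁ ≤ density l L φ₀ φ₁ φ₀₁ S₁ S₀ x := by
  have hxc : x ∈ closure (Omega l L) := subset_closure hxΩ
  have b₁ : ∀ E, c₁ ≤ φ₁ x (unitNormal E x) := fun E => by
    simpa [norm_unitNormal] using (h₁ x hxc (unitNormal E x)).1
  have b₂ : ∀ E, c₁ ≤ regimeOne φ₀ φ₁ φ₀₁ x (unitNormal E x) := fun E => by
    simpa [norm_unitNormal] using (h₂ x hxc (unitNormal E x)).1
  have b₃ : ∀ E, c₁ ≤ φ₀₁ x (unitNormal E x) := fun E => by
    simpa [norm_unitNormal] using (h₃ x hxc (unitNormal E x)).1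
  -- No bound on φ₀ is assumed, but φ₀ dominates `regimeOne`, which is bounded below.
  have b₄ : ∀ E, c₁ ≤ regimeTwo φ₀ φ₁ x (unitNormal E x) := fun E =>
    le_min (b₁ E) ((b₂ E).trans (min_le_left _ _))
  unfold density
  split_ifs with k₁ k₂ k₃ k₄ k₅ k₆ k₇ k₈
  · exact b₁ _
  · exact b₂ _
  · exact b₃ _
  · linarith [b₁ S₁, b₂ S₁]
  · linarith [b₁ S₁]
  · linarith [b₄ S₁]
  · linarith [b₃ S₀]
  · exact b₂ _
  · exfalso
    by_cases hr₁ : x ∈ reducedBoundary S₁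
    · by_cases hr₀ : x ∈ reducedBoundary S₀
      · exact k₂ ⟨⟨hxΩ, hr₀⟩, hr₁⟩
      · exact k₁ ⟨hxΩ, hr₁, hr₀⟩
    by_cases hf₁ : x ∈ frontier S₁
    · rcases ht₁.resolve_left hr₁ with hd₁ | hd₁
      · exact k₆ ⟨⟨hxΩ, hf₁⟩, hd₁⟩
      rcases ht₀ with hr₀ | hd₀ | hd₀
      · exact k₄ ⟨⟨⟨hxΩ, hr₀⟩, hf₁⟩, hd₁⟩
      · exact k₅ ⟨⟨⟨hxΩ, hf₁⟩, hd₁⟩, hd₀⟩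
      by_cases hf₀ : x ∈ frontier S₀
      · exact k₈ ⟨⟨⟨hxΩ, hf₀⟩, hf₁⟩, hd₀⟩
      -- A film boundary point of substrate density one off the frontier of `S₀` would be interior
      -- to the substrate or outside its closure. The constraint excludes the former, and the latter
      -- falls into the fifth portion.
      have hi₀ : x ∉ interior S₀ := fun hi => (eq_empty_iff_forall_notMem.1 hInt) x ⟨hf₁, hi⟩
      have hx₀ : x ∉ closure S₀ := fun hx₀ => hf₀ ⟨hx₀, hi₀⟩
      exact k₅ ⟨⟨⟨hxΩ, hf₁⟩, hd₁⟩, mem_densityPoints_zero_of_notMem_closure hx₀⟩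
    · have hf₀ : x ∈ frontier S₀ := hx.resolve_right hf₁
      rcases ht₀ with hr₀ | hd₀
      · exact k₃ ⟨hxΩ, hr₀, hf₁⟩
      have hi₁ : x ∈ interior S₁ := by
        by_contra hi₁
        exact hf₁ ⟨hcl hf₀.1, hi₁⟩
      exact k₇ ⟨⟨⟨hxΩ, hf₀, hf₁⟩, hd₀.symm⟩, mem_densityPoints_one_of_mem_interior hi₁⟩

/-- Expresses the order of the heights by closed sets; heights need not converge pointwise, whereas
inclusions survive Hausdorff limits. -/
theorem film_subset_film_iff {l L : ℝ} (hl : 0 < l) (hL : 0 < L) {h₁ h₀ : ℝ → ℝ}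
    (hm : MapsTo h₀ (Icc (-l) l) (Icc 0 L)) :
    film l L h₀ ⊆ film l L h₁ ↔ ∀ x ∈ Icc (-l) l, h₀ x ≤ h₁ x := by
  constructor
  · intro h x hx
    have hp : (!₂[x, h₀ x] : Plane) ∈ film l L h₀ :=
      (mem_film hl).2 ⟨by simpa using hx, by simpa using by linarith [(hm hx).1], by simp⟩
    simpa using ((mem_film hl).1 (h hp)).2.2
  · intro h p hp
    obtain ⟨h1, h2, h3⟩ := (mem_film hl).1 hp
    exact (mem_film hl).2 ⟨h1, h2, h3.trans (h _ h1)⟩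

theorem mul_H1_inter_Omega_le_surfaceEnergy {l L : ℝ} (hl : 0 < l) (hL : 0 < L)
    {φ₀ φ₁ φ₀₁ : Plane → Plane → ℝ} (hφ : AdmissibleTensions l L φ₀ φ₁ φ₀₁) :
    ∃ c : ℝ, 0 < c ∧ ∀ A ∈ B1 l L,
      ENNReal.ofReal c * H1 ((frontier A.2 ∪ frontier A.1) ∩ Omega l L) ≤
        surfaceEnergy l L φ₀ φ₁ φ₀₁ A := by
  obtain ⟨c₁, c₂, hc₁, -, hφ₁, hφ₂, hφ₃⟩ := hφ.bounds
  refine ⟨c₁, hc₁, ?_⟩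
  rintro A ⟨h₁, h₀, K₁, K₀, hp₁, hp₀, rfl, hle, hInt⟩
  have hcl : closure (region l L h₀ K₀) ⊆ closure (region l L h₁ K₁) := by
    rw [hp₁.closure_region hl hL, hp₀.closure_region hl hL]
    exact (film_subset_film_iff hl hL hp₀.height.mapsTo).2 hle
  unfold surfaceEnergy
  refine le_trans ?_ (lintegral_mono_set (inter_subset_left (t := Omega l L)))
  rw [← setLIntegral_const]
  refine setLIntegral_mono_ae' ((isClosed_frontier.measurableSet.union
    isClosed_frontier.measurableSet).inter (isOpen_Omega l L).measurableSet) ?_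
  filter_upwards [hp₁.ae_trichotomy hl, hp₀.ae_trichotomy hl] with x ht₁ ht₀ hx
  exact ENNReal.ofReal_le_ofReal (le_density hc₁ hφ₁ hφ₂ hφ₃ hInt hcl hx.2 hx.1 ht₁ ht₀)

theorem H1_vertical_lt_top (c a b : ℝ) : H1 {p : Plane | p 0 = c ∧ p 1 ∈ Icc a b} < ⊤ := by
  have hiso : Isometry fun t : ℝ => (!₂[c, t] : Plane) := Isometry.of_dist_eq fun s t => by
    rw [EuclideanSpace.dist_eq]
    simp [Real.sqrt_sq_eq_abs, Real.dist_eq]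
  have himg : {p : Plane | p 0 = c ∧ p 1 ∈ Icc a b} ⊆ (fun t : ℝ => (!₂[c, t] : Plane)) '' Icc a b := by
    rintro p ⟨h0, h1⟩
    refine ⟨p 1, h1, ?_⟩
    ext i
    fin_cases i <;> simp [h0]
  refine (measure_mono himg).trans_lt ?_
  rw [hiso.hausdorffMeasure_image (Or.inl zero_le_one), hausdorffMeasure_real]
  exact isCompact_Icc.measure_lt_top

theorem H1_horizontal_lt_top (c a b : ℝ) : H1 {p : Plane | p 0 ∈ Icc a b ∧ p 1 = c} < ⊤ := by
  have hiso : Isometry fun t : ℝ => (!₂[t, c] : Plane) := Isometry.of_dist_eq fun s t => by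
    rw [EuclideanSpace.dist_eq]
    simp [Real.sqrt_sq_eq_abs, Real.dist_eq]
  have himg : {p : Plane | p 0 ∈ Icc a b ∧ p 1 = c} ⊆ (fun t : ℝ => (!₂[t, c] : Plane)) '' Icc a b := by
    rintro p ⟨h0, h1⟩
    refine ⟨p 0, h0, ?_⟩
    ext i
    fin_cases i <;> simp [h1]
  refine (measure_mono himg).trans_lt ?_
  rw [hiso.hausdorffMeasure_image (Or.inl zero_le_one), hausdorffMeasure_real]
  exact isCompact_Icc.measure_lt_top

/-- The energy does not see ∂Ω, so the boundary length there is bounded by the two walls and the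
bottom. The top of the box is open on the side of Ω and contributes only its end points. -/
theorem H1_box_sdiff_Omega_lt_top (l L : ℝ) :
    H1 ({p : Plane | p 0 ∈ Icc (-l) l ∧ p 1 ∈ Icc (-L) L} \ Omega l L) < ⊤ := by
  have hsub : {p : Plane | p 0 ∈ Icc (-l) l ∧ p 1 ∈ Icc (-L) L} \ Omega l L ⊆
      ({p : Plane | p 0 = -l ∧ p 1 ∈ Icc (-L) L} ∪ {p : Plane | p 0 = l ∧ p 1 ∈ Icc (-L) L}) ∪
        {p : Plane | p 0 ∈ Icc (-l) l ∧ p 1 = -L} := by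
    rintro p ⟨⟨h0, h1⟩, hΩ⟩
    by_contra hcon
    simp only [mem_union, mem_ofPred_eq, not_or, not_and] at hcon
    refine hΩ ⟨⟨lt_of_le_of_ne h0.1 fun h => hcon.1.1 h.symm h1,
      lt_of_le_of_ne h0.2 fun h => hcon.1.2 h h1⟩, lt_of_le_of_ne h1.1 fun h => hcon.2 h0 h.symm⟩
  exact (measure_mono hsub).trans_lt (measure_union_lt_top
    (measure_union_lt_top (H1_vertical_lt_top _ _ _) (H1_vertical_lt_top _ _ _))
    (H1_horizontal_lt_top _ _ _))

theorem exists_length_bound {l L : ℝ} (hl : 0 < l) (hL : 0 < L) {φ₀ φ₁ φ₀₁ : Plane → Plane → ℝ}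
    (hφ : AdmissibleTensions l L φ₀ φ₁ φ₀₁) {T : ℝ≥0∞} (hT : T < ⊤) :
    ∃ M : ℝ≥0∞, M < ⊤ ∧ ∀ A ∈ B1 l L, surfaceEnergy l L φ₀ φ₁ φ₀₁ A ≤ T →
      H1 (frontier A.2 ∪ frontier A.1) ≤ M := by
  obtain ⟨c, hc, hcA⟩ := mul_H1_inter_Omega_le_surfaceEnergy hl hL hφ
  have hc0 : ENNReal.ofReal c ≠ 0 := (ENNReal.ofReal_pos.2 hc).ne'
  refine ⟨T / ENNReal.ofReal c +
    H1 ({p : Plane | p 0 ∈ Icc (-l) l ∧ p 1 ∈ Icc (-L) L} \ Omega l L),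
    ENNReal.add_lt_top.2 ⟨ENNReal.div_lt_top hT.ne hc0, H1_box_sdiff_Omega_lt_top l L⟩,
    fun A hA hAT => ?_⟩
  rw [← measure_inter_add_sdiff _ (isOpen_Omega l L).measurableSet]
  refine add_le_add ?_ (measure_mono (sdiff_subset_sdiff_left ?_))
  · rw [ENNReal.le_div_iff_mul_le (Or.inl hc0) (Or.inl ENNReal.ofReal_ne_top), mul_comm]
    exact (hcA A hA).trans hAT
  · obtain ⟨h₁, h₀, K₁, K₀, hp₁, hp₀, rfl, -, -⟩ := hA
    refine union_subset (frontier_subset_closure.trans ?_) (frontier_subset_closure.trans ?_)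
    · rw [hp₀.closure_region hl hL]
      exact film_subset_box hl hp₀.height.mapsTo
    · rw [hp₁.closure_region hl hL]
      exact film_subset_box hl hp₁.height.mapsTo

/-! ### Stability of the constraints and compactness -/

theorem closure_subset_closure_of_tendsto_sdist {E F : ℕ → Set Plane} {E' F' : Set Plane}
    (hE : ∀ k, (E k).Nonempty) (hF' : F'.Nonempty) (hsub : ∀ k, closure (E k) ⊆ closure (F k))
    (hEs : ∀ x, Tendsto (fun k => sdist (E k) x) atTop (𝓝 (sdist E' x)))
    (hFs : ∀ x, Tendsto (fun k => sdist (F k) x) atTop (𝓝 (sdist F' x))) :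
    closure E' ⊆ closure F' := by
  intro x hx
  have h1 := (hEs x).max (tendsto_const_nhds (x := (0 : ℝ)))
  have h2 := (hFs x).max (tendsto_const_nhds (x := (0 : ℝ)))
  simp only [max_sdist_zero] at h1 h2
  have h3 : Metric.infDist x F' ≤ Metric.infDist x E' :=
    le_of_tendsto_of_tendsto' h2 h1 fun k => by
      rw [← Metric.infDist_closure (s := F k), ← Metric.infDist_closure (s := E k)]
      exact Metric.infDist_le_infDist_of_subset (hsub k) (hE k).closure
  rw [← Metric.infDist_closure (s := E'), Metric.infDist_zero_of_mem hx] at h3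
  exact (Metric.mem_closure_iff_infDist_zero hF').2 (le_antisymm h3 Metric.infDist_nonneg)

/-- At a common point x the signed distance of F' is -d < 0 and that of E' is 0. For large k the
ball of radius d/2 at x lies in F k and contains a frontier point of E k, against disjointness. -/
theorem frontier_inter_interior_eq_empty_of_tendsto_sdist {E F : ℕ → Set Plane} {E' F' : Set Plane}
    (hE : ∀ k, (E k).Nonempty) (hEc : ∀ k, (E k)ᶜ.Nonempty) (hE' : E'.Nonempty)
    (hEc' : E'ᶜ.Nonempty) (hFc' : F'ᶜ.Nonempty)
    (hdisj : ∀ k, frontier (E k) ∩ interior (F k) = ∅)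
    (hEs : ∀ x, Tendsto (fun k => sdist (E k) x) atTop (𝓝 (sdist E' x)))
    (hFs : ∀ x, Tendsto (fun k => sdist (F k) x) atTop (𝓝 (sdist F' x))) :
    frontier E' ∩ interior F' = ∅ := by
  refine eq_empty_iff_forall_notMem.2 ?_
  rintro x ⟨hxE, hxF⟩
  set d := Metric.infDist x F'ᶜ with hd
  have hd0 : 0 < d := by
    refine (Metric.infDist_pos_iff_notMem_closure hFc').1 ?_
    rwa [closure_compl, notMem_compl_iff]
  have h0 : sdist F' x = -d := by
    unfold sdist
    rw [if_pos (interior_subset hxF)]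
  have hE0 : |sdist E' x| = 0 := by
    rw [abs_sdist hE' hEc', Metric.infDist_zero_of_mem hxE]
  have e1 := (hEs x).abs.eventually (gt_mem_nhds (show |sdist E' x| < d / 2 by linarith))
  have e2 := (hFs x).eventually (gt_mem_nhds (show sdist F' x < -(d / 2) by linarith))
  obtain ⟨k, hk1, hk2⟩ := (e1.and e2).exists
  have hxk : x ∈ F k := by
    by_contra hxk
    unfold sdist at hk2
    rw [if_neg hxk] at hk2
    linarith [Metric.infDist_nonneg (x := x) (s := F k)]
  have hball : Metric.ball x (d / 2) ⊆ F k := by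
    intro y hy
    by_contra hyk
    unfold sdist at hk2
    rw [if_pos hxk] at hk2
    have h3 := Metric.infDist_le_dist_of_mem (x := x) (show y ∈ (F k)ᶜ from hyk)
    rw [Metric.mem_ball'] at hy
    linarith
  rw [abs_sdist (hE k) (hEc k)] at hk1
  have hne : (frontier (E k)).Nonempty := by
    have := inter_frontier_nonempty (C := univ) isPreconnected_univ (E := E k)
      (by simpa using hE k) (by simpa using hEc k)
    simpa using this
  obtain ⟨z, hz, hzd⟩ := (Metric.infDist_lt_iff hne).1 hk1
  exact eq_empty_iff_forall_notMem.1 (hdisj k) z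
    ⟨hz, interior_maximal hball Metric.isOpen_ball (Metric.mem_ball'.2 hzd)⟩

end FilmLayers

/-! ### Compactness of pairs of layers. -/

theorem mainTheorem8 (l L : ℝ) (hl : 0 < l) (hL : 0 < L)
    (φ₀ φ₁ φ₀₁ : FilmLayers.Plane → FilmLayers.Plane → ℝ)
    (hφ : FilmLayers.AdmissibleTensions l L φ₀ φ₁ φ₀₁)
    (m₁ m₀ : ℕ) (A : ℕ → Set FilmLayers.Plane × Set FilmLayers.Plane)
    (hA : ∀ k, A k ∈ FilmLayers.B1m l L m₁ m₀)
    (hbound : (⨆ k, (FilmLayers.surfaceEnergy l L φ₀ φ₁ φ₀₁ (A k) + volume (A k).1)) < ⊤) :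
    ∃ n : ℕ → ℕ, StrictMono n ∧
      ∃ B ∈ FilmLayers.B1m l L m₁ m₀,
        FilmLayers.TauConverges l L (fun k => A (n k)) B := by
  obtain ⟨M, hM, hlen⟩ := FilmLayers.exists_length_bound hl hL hφ hbound
  have hlenA : ∀ k, FilmLayers.H1 (frontier (A k).2 ∪ frontier (A k).1) ≤ M := fun k =>
    hlen _ (hA k).1 (le_self_add.trans (le_iSup (fun k =>
      FilmLayers.surfaceEnergy l L φ₀ φ₁ φ₀₁ (A k) + volume (A k).1) k))
  have hlen₁ : ∀ k, FilmLayers.H1 (frontier (A k).1) ≤ M := fun k =>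
    (measure_mono subset_union_right).trans (hlenA k)
  have hlen₀ : ∀ k, FilmLayers.H1 (frontier (A k).2) ≤ M := fun k =>
    (measure_mono subset_union_left).trans (hlenA k)
  choose h₁ h₀ K₁ K₀ hp₁ hp₀ hAeq hle hdisj using fun k => (hA k).1
  obtain rfl : A = fun k => (FilmLayers.region l L (h₁ k) (K₁ k),
      FilmLayers.region l L (h₀ k) (K₀ k)) := funext hAeq
  obtain ⟨n₁, hn₁, g₁, K₁', hg₁, hc₁, ht₁⟩ := FilmLayers.exists_layer_limit hl hL hM h₁ K₁ hp₁
    (fun k => (hA k).2.1) hlen₁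
  -- The substrates are extracted along the subsequence already chosen for the film composites, so
  -- one composed subsequence serves both.
  obtain ⟨n₀, hn₀, g₀, K₀', hg₀, hc₀, ht₀⟩ := FilmLayers.exists_layer_limit hl hL hM
    (fun k => h₀ (n₁ k)) (fun k => K₀ (n₁ k)) (fun k => hp₀ _) (fun k => (hA _).2.2)
    (fun k => hlen₀ _)
  have ht₁' : TendstoUniformly
      (fun k => FilmLayers.sdist (FilmLayers.region l L (h₁ (n₁ (n₀ k))) (K₁ (n₁ (n₀ k)))))
      (FilmLayers.sdist (FilmLayers.region l L g₁ K₁')) atTop := fun u hu =>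
    hn₀.tendsto_atTop.eventually (ht₁ u hu)
  have hB : (FilmLayers.region l L g₁ K₁', FilmLayers.region l L g₀ K₀') ∈
      FilmLayers.B1 l L := by
    refine ⟨g₁, g₀, K₁', K₀', hg₁, hg₀, rfl, ?_, ?_⟩
    · rw [← FilmLayers.film_subset_film_iff hl hL hg₀.height.mapsTo, ← hg₀.closure_region hl hL,
        ← hg₁.closure_region hl hL]
      refine FilmLayers.closure_subset_closure_of_tendsto_sdist
        (fun k => (hp₀ _).region_nonempty hl hL) (hg₁.region_nonempty hl hL) (fun k => ?_)
        (fun x => ht₀.tendsto_at x) (fun x => ht₁'.tendsto_at x)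
      rw [(hp₀ _).closure_region hl hL, (hp₁ _).closure_region hl hL,
        FilmLayers.film_subset_film_iff hl hL (hp₀ _).height.mapsTo]
      exact hle _
    · exact FilmLayers.frontier_inter_interior_eq_empty_of_tendsto_sdist
        (fun k => (hp₁ _).region_nonempty hl hL)
        (fun k => FilmLayers.region_compl_nonempty l L _ _) (hg₁.region_nonempty hl hL)
        (FilmLayers.region_compl_nonempty l L _ _) (FilmLayers.region_compl_nonempty l L _ _)
        (fun k => hdisj _) (fun x => ht₁'.tendsto_at x) (fun x => ht₀.tendsto_at x)
  refine ⟨n₁ ∘ n₀, hn₁.comp hn₀, _, ⟨hB, hc₁, hc₀⟩, fun k => (hA _).1, hB, ?_, ?_, ?_, ?_⟩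
  · exact (iSup_le fun k => hlen₁ _).trans_lt hM
  · exact (iSup_le fun k => hlen₀ _).trans_lt hM
  · exact ht₁'.tendstoLocallyUniformly
  · exact ht₀.tendstoLocallyUniformly
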